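/- Notation. Let $\alpha=e^{\pi i/4}$. A (constraint) function of arity $n$ is a map $f:\{0,1\}^n\to\mathbb C$, with support $\mathrm{supp}(f)=\{x: f(x)\neq 0\}$. The family $\mathscr A$ consists of the functions $f$ whose support is the solution set of a system $Ax=b$ of linear equations over $\mathbb Z_2$ and which on it have the form $f(x)=\lambda\, i^{L(x)+2Q(x)}$, where $\lambda\ne 0$ is a complex constant and, in a set of free variables of the support (taken with the integer values $0,1$), $L$ is a linear polynomial and $Q$ is a homogeneous multilinear polynomial of degree $2$, both with integer coefficients. The family $\mathscr L$ of local affine functions consists of the functions $f$ such that for every $s=(s_1,\dots,s_n)\in\mathrm{supp}(f)$ the function $(M_{\alpha^{s_1}}\otimes\cdots\otimes M_{\alpha^{s_n}})f$ is in $\mathscr A$, where $M_c=\begin{bmatrix}1&0\\0&c\end{bmatrix}$; that is, $x\mapsto \alpha^{\sum_i s_ix_i}f(x)$ is in $\mathscr A$. A signature grid $\Omega$ over a family $\mathscr F$ is a finite graph $(V,E)$ (parallel edges and loops are allowed) with a function $f_v\in\mathscr F$, of arity $\deg v$, for each vertex $v$, whose inputs are matched with the edge ends at $v$. The problem $\mathrm{Holant}(\mathscr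 F)$ is to compute, given $\Omega$, $$\mathrm{Holant}_\Omega=\sum_{\sigma:E\to\{0,1\}}\ \prod_{v\in V} f_v(\sigma|_{E(v)}).$$ The description of the functions is part of the input: each $f_v$ is given by a table of its values, in which zero values may be left out. The values are algebraic numbers, given exactly: the input specifies a field $\mathbb Q(\alpha,\theta)$, with $\theta$ an algebraic integer, by the minimal polynomial of $\theta$ over $\mathbb Q(\alpha)$ (its coefficients lie in $\mathbb Z[\alpha]$), and, with $d$ its degree, a number is given as $\frac1q\sum_{k<d}c_k\theta^k$ with $c_k\in\mathbb Z[\alpha]$ and an integer $q>0$, all integers being written in binary. The output is $\mathrm{Holant}_\Omega$, in the same form. Theorem. There is a polynomial time algorithm for $\mathrm{Holant}(\mathscr L)$: a Turing machine that, given any signature grid over $\mathscr L$ as above, outputs its Holant value in time bounded by a polynomial in the length of the input. -/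

import Mathlib

noncomputable section

namespace Holant

open Complex Polynomial
open scoped IntermediateField

/-! ### Constraint functions -/

/-- The Boolean cube `{0,1}ⁿ`, with the elements `0, 1` of `ℤ/2`. -/
abbrev Cube (n : ℕ) : Type := Fin n → ZMod 2

/-- A constraint function of arity `n`. -/
abbrev CFun (n : ℕ) : Type := Cube n → ℂ

/-- The support of a constraint function. -/
def supp {n : ℕ} (f : CFun n) : Set (Cube n) := {x | f x ≠ 0}

/-- A relation is affine if it is the solution set of a linear system `A x = b` over `ℤ/2`. -/
def IsAffineRel {n : ℕ} (R : Set (Cube n)) : Prop :=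
  ∃ (k : ℕ) (A : Matrix (Fin k) (Fin n) (ZMod 2)) (b : Fin k → ZMod 2),
    R = {x | A.mulVec x = b}

/-- The variables in `J` are free variables for `R`: every assignment to them extends in
exactly one way to an element of `R`. -/
def IsFreeSet {n : ℕ} (J : Finset (Fin n)) (R : Set (Cube n)) : Prop :=
  ∀ y : J → ZMod 2, ∃! x : Cube n, x ∈ R ∧ ∀ j : J, x j = y j

/-- The family `𝒜` of affine functions: the support is affine, and, as a function of a set of
free variables of the support, `f` is there `lam * i ^ (L + 2 Q)` with `L` linear and `Q`
multilinear, homogeneous of degree 2, both with integer coefficients (a constant term of `L` is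
absorbed in `lam`). The variables take the integer values `0, 1` in the exponent. -/
def affineFun (n : ℕ) : Set (CFun n) :=
  {f | IsAffineRel (supp f) ∧
    ∃ (J : Finset (Fin n)) (lam : ℂ) (L : Fin n → ℤ) (Q : Fin n → Fin n → ℤ),
      ((supp f).Nonempty → IsFreeSet J (supp f)) ∧ lam ≠ 0 ∧
      ∀ x ∈ supp f, f x = lam * I ^
        ((∑ j ∈ J, L j * ((x j).val : ℤ)) +
          2 * ∑ j ∈ J, ∑ k ∈ J with j < k, Q j k * ((x j).val : ℤ) * ((x k).val : ℤ))}

/-- `α = e^{π i / 4}`. -/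
def alpha : ℂ := Complex.exp (Real.pi / 4 * I)

/-- The matrix `M_c = diag(1, c)`. -/
def transM (c : ℂ) : Matrix (ZMod 2) (ZMod 2) ℂ :=
  Matrix.diagonal fun b => if b = 0 then 1 else c

/-- The holographic transformation `(M₁ ⊗ ⋯ ⊗ Mₙ) f`. -/
def transform {n : ℕ} (M : Fin n → Matrix (ZMod 2) (ZMod 2) ℂ) (f : CFun n) : CFun n :=
  fun x => ∑ y : Cube n, (∏ i, M i (x i) (y i)) * f y

/-- The family `ℒ` of local affine functions. -/
def localAffine (n : ℕ) : Set (CFun n) :=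
  {f | ∀ s ∈ supp f, transform (fun i => transM (alpha ^ (s i).val)) f ∈ affineFun n}

/-! ### Exact algebraic numbers

Finitely many algebraic numbers always lie in a common field `ℚ(α, θ)` with `θ` an algebraic
integer. The minimal polynomial of `θ` over `ℚ(α)` is then `X ^ d + ∑ i < d, mᵢ X ^ i` with
`mᵢ ∈ ℤ[α]`, and each element of the field is `(∑ i < d, cᵢ θ ^ i) / q` with `cᵢ ∈ ℤ[α]`
and `q` a positive integer. -/

/-- Integer coordinates of an element of `ℤ[α]` in the basis `1, α, α², α³`. -/
abbrev CycInt : Type := Fin 4 → ℤ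

/-- The element of `ℤ[α]` with the given coordinates. -/
def CycInt.value (c : CycInt) : ℂ := ∑ j : Fin 4, (c j : ℂ) * alpha ^ (j : ℕ)

/-- Coordinates of an element of `ℚ(α, θ)`: numerators `cᵢ` and a common denominator. -/
structure AlgNum where
  coeffs : List CycInt
  den : ℕ

/-- The number with the given coordinates. -/
def AlgNum.value (θ : ℂ) (q : AlgNum) : ℂ :=
  (∑ i : Fin q.coeffs.length, (q.coeffs.get i).value * θ ^ (i : ℕ)) / (q.den : ℂ)

/-- `q` consists of `d` coordinates and a positive denominator. -/
def AlgNum.WellFormed (d : ℕ) (q : AlgNum) : Prop := q.coeffs.length = d ∧ 0 < q.den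

/-- The monic polynomial `X ^ d + ∑ i < d, mᵢ X ^ i` given by the list of the `mᵢ`. -/
def modulusPoly (m : List CycInt) : ℂ[X] :=
  X ^ m.length + ∑ i : Fin m.length, C (m.get i).value * X ^ (i : ℕ)

/-- The list `m` describes the minimal polynomial of `θ` over `ℚ(α)`. -/
def Describes (m : List CycInt) (θ : ℂ) : Prop :=
  (minpoly ℚ⟮alpha⟯ θ).map (algebraMap ℚ⟮alpha⟯ ℂ) = modulusPoly m

/-! ### Signature grids -/

/-- A vertex of a signature grid with edge set `Fin m`: its incident edges, listed in the order
in which they are the inputs of its function (an edge that is a loop at the vertex is listed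
twice), and the table of the values of its function, where values that are not listed are zero. -/
structure Vertex (m : ℕ) where
  edges : List (Fin m)
  table : List (List (ZMod 2) × AlgNum)

/-- The constraint function at a vertex. -/
def Vertex.fn {m : ℕ} (θ : ℂ) (v : Vertex m) : CFun v.edges.length :=
  fun x => ((v.table.lookup (List.ofFn x)).map (AlgNum.value θ)).getD 0

/-- The table of a vertex has at most one row for each input, and its values are given by `d`
coordinates. -/
def Vertex.WellFormed {m : ℕ} (d : ℕ) (v : Vertex m) : Prop :=
  (v.table.map Prod.fst).Nodup ∧
    ∀ r ∈ v.table, r.1.length = v.edges.length ∧ r.2.WellFormed d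

/-- The data of a signature grid, as given to an algorithm. -/
structure Grid where
  modulus : List CycInt
  numEdges : ℕ
  vertices : List (Vertex numEdges)

/-- `Ω` is a signature grid over `ℚ(α, θ)` with functions from the family `𝓕`. Each edge has
exactly two ends; parallel edges and loops are allowed. -/
def Grid.IsInstance (𝓕 : ∀ n : ℕ, Set (CFun n)) (Ω : Grid) (θ : ℂ) : Prop :=
  Describes Ω.modulus θ ∧
    (∀ e : Fin Ω.numEdges, (Ω.vertices.flatMap Vertex.edges).count e = 2) ∧
    ∀ v ∈ Ω.vertices, v.WellFormed Ω.modulus.length ∧ v.fn θ ∈ 𝓕 v.edges.length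

/-- The Holant value: the sum over all assignments to the edges of the product of the values of
the functions at the vertices. -/
def Grid.holant (θ : ℂ) (Ω : Grid) : ℂ :=
  ∑ σ : Fin Ω.numEdges → ZMod 2,
    (Ω.vertices.map fun v => v.fn θ fun i => σ (v.edges.get i)).prod

/-! ### Encodings as words; integers are written in binary -/

/-- The alphabet. -/
inductive Sym : Type
  | bit (b : Bool)
  | neg
  | left
  | right

/-- A list, as the concatenation of the codes of its entries between brackets. -/
def encList {X : Type} (e : X → List Sym) (l : List X) : List Sym :=
  Sym.left :: (l.flatMap e ++ [Sym.right])

def encNat (n : ℕ) : List Sym := encList (fun b => [Sym.bit b]) n.bits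

def encInt (z : ℤ) : List Sym :=
  if z < 0 then Sym.neg :: encNat z.natAbs else encNat z.natAbs

def encCycInt (c : CycInt) : List Sym := encList encInt (List.ofFn c)

def encAlgNum (q : AlgNum) : List Sym := encList encCycInt q.coeffs ++ encNat q.den

def encRow (r : List (ZMod 2) × AlgNum) : List Sym :=
  encList (fun b => [Sym.bit (decide (b = 1))]) r.1 ++ encAlgNum r.2

def encVertex {m : ℕ} (v : Vertex m) : List Sym :=
  encList (fun e : Fin m => encNat (e : ℕ)) v.edges ++ encList encRow v.table

def encGrid (Ω : Grid) : List Sym :=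
  encList encCycInt Ω.modulus ++ encNat Ω.numEdges ++ encList encVertex Ω.vertices

/-! ### The problem `Holant(𝓕)` -/

/-- The inputs of the problem `Holant(𝓕)`. -/
def Input (𝓕 : ∀ n : ℕ, Set (CFun n)) : Type := {Ω : Grid // ∃ θ : ℂ, Ω.IsInstance 𝓕 θ}

/-- `Holant(𝓕)` is computable in polynomial time: a Turing machine, whose running time is bounded
by a polynomial in the length of the input (the description of the functions included), computes
the coordinates of the Holant value. -/
def InPolyTime (𝓕 : ∀ n : ℕ, Set (CFun n)) : Prop :=
  ∃ F : Input 𝓕 → AlgNum,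
    Nonempty (Turing.TM2ComputableInPolyTime (fun Ω : Input 𝓕 => encGrid Ω.1) encAlgNum F) ∧
    ∀ (Ω : Input 𝓕) (θ : ℂ), Ω.1.IsInstance 𝓕 θ →
      (F Ω).WellFormed Ω.1.modulus.length ∧ (F Ω).value θ = Ω.1.holant θ

end Holant

end

/-!
The Holant problem for local affine functions can be solved in polynomial time, for the following
reason. Call a function `h` on a vector space over `ℤ/2` one with quadratic phase on a set `A`
(`Quad`) if it is nonzero on `A`, and its second differences
`h (y + b + b') * h y / (h (y + b) * h (y + b'))` are signs that depend on `b` and `b'` only. Affine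
functions have this property on their supports. Let `σ₀` be any point of the support of the product
of the functions of a signature grid. By definition of `ℒ`, the function at each vertex becomes
affine if it is twisted by `α ^ (σ₀ e)` at each edge end. Each edge has two ends, so that the
product of all twists consists of powers of `α ^ 2 = i`, and has itself quadratic phase. Hence the
product of the local affine functions has quadratic phase on its support (`quad_weight`), although
its factors need not have it. The algorithm does not need `σ₀`.

The support of each function is affine, and so a system of linear equations for the common support
is found by elimination from the rows of the tables with nonzero values (`annih_spec`,
`solve_spec`). The sum over this affine space is taken one direction `b` after the other
(`LoopInv.loopStep`). As `h (y + b) = ± i ^ k * h y`, with `k` fixed and a sign that is given by an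
affine form in `y`, the two terms add up to `(1 ± i ^ k) * h y`. For even `k` this factor is `2` on
an affine subspace and `0` elsewhere; for odd `k` it is `1 + i ^ k` times a fourth root of unity
that depends on the sign only. The sign becomes an auxiliary coordinate, and the result is again a
function with quadratic phase. All that the algorithm does with the functions is to evaluate them
and to compare values, so it applies to functions that are given by tables. Equality of two numbers
is decided by their coordinates in `ℚ(α, θ)` (`Describes.eq_of_pval_eq`). The numbers are represented
without subtraction, as polynomials in `α` and `θ` with natural coefficients, where `-1 = α ^ 4`;
the sum of the coefficients is then multiplicative, and bounds the length of all numbers (`NAr`).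

The running time is bounded for a Turing machine with several stacks. Structured programs for such
machines are compiled in `Run.stepsTo`. A function between types whose elements are coded by binary
trees is in the class `PT` if such a program computes it in polynomial time. The class is closed
under composition, pairs, case distinction and iteration along lists with results of polynomial
size (`PT.foldl`), and so contains arithmetic with binary numbers, polynomials, linear algebra, the
parser for the input, and the algorithm (`PT.answer`). The theorem follows from
`computableInPolyTime_answer` and `answer_spec`.
-/

noncomputable section
namespace Holant

/-! ### A structured language for stack machines -/

/-- The stacks of the machines that are built here: `d` holds the data on which a program works,
`z` saves data, `r` serves to transfer symbols between stacks, and `c` is a unary counter. -/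
inductive Stk : Type
  | d | z | r | c
  deriving DecidableEq

instance : Fintype Stk :=
  ⟨{.d, .z, .r, .c}, fun k => by cases k <;> simp⟩

instance : DecidableEq Sym := fun _ _ => Classical.propDecidable _

instance : Fintype Sym :=
  ⟨{.bit true, .bit false, .neg, .left, .right}, fun s => by
    rcases s with b | _ | _ | _
    · cases b <;> simp
    all_goals simp⟩

/-- The contents of the stacks. -/
abbrev Mem : Type := Stk → List Sym

/-- Structured programs. `sw k f` pops the stack `k` and goes on with `f s`, where `s` is the
symbol found (`none` if the stack is empty). `loop k go f` pops `k`, and, as long as the symbol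
`s` found satisfies `go`, runs `f s` and starts again. -/
inductive Prog : Type
  | skip
  | push (k : Stk) (s : Sym)
  | seq (p q : Prog)
  | sw (k : Stk) (f : Option Sym → Prog)
  | loop (k : Stk) (go : Option Sym → Bool) (f : Option Sym → Prog)

open Function (update)

/-- `Run p m t m'`: the program `p`, started with stacks `m`, ends after `t` steps with stacks
`m'`. -/
inductive Run : Prog → Mem → ℕ → Mem → Prop
  | skip (m) : Run .skip m 1 m
  | push (k s m) : Run (.push k s) m 1 (update m k (s :: m k))
  | seq {p q m t m' t' m''} : Run p m t m' → Run q m' t' m'' → Run (.seq p q) m (t + t') m''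
  | sw {k f m t m'} : Run (f (m k).head?) (update m k (m k).tail) t m' →
      Run (.sw k f) m (t + 1) m'
  | loopStop {k go f m} : go (m k).head? = false → Run (.loop k go f) m 1 (update m k (m k).tail)
  | loopGo {k go f m t m' t' m''} : go (m k).head? = true →
      Run (f (m k).head?) (update m k (m k).tail) t m' → Run (.loop k go f) m' t' m'' →
      Run (.loop k go f) m (t + t' + 1) m''

/-- The labels of the machine that executes a program. -/
def Prog.Lab : Prog → Type
  | .skip => Unit
  | .push _ _ => Unit
  | .seq p q => p.Lab ⊕ q.Lab
  | .sw _ f => Option (Σ s, (f s).Lab)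
  | .loop _ _ f => Option (Σ s, (f s).Lab)

instance Prog.finite_lab (p : Prog) : Finite p.Lab := by
  induction p with
  | skip => exact inferInstanceAs (Finite Unit)
  | push => exact inferInstanceAs (Finite Unit)
  | seq p q hp hq => exact inferInstanceAs (Finite (p.Lab ⊕ q.Lab))
  | sw k f hf => exact inferInstanceAs (Finite (Option (Σ s, (f s).Lab)))
  | loop k go f hf => exact inferInstanceAs (Finite (Option (Σ s, (f s).Lab)))

/-- The label at which the execution of a program starts. -/
def Prog.entry : ∀ p : Prog, p.Lab
  | .skip => ()
  | .push _ _ => ()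
  | .seq p _ => Sum.inl p.entry
  | .sw _ _ => none
  | .loop _ _ _ => none

/-- Statements of the machines: the internal state is the symbol popped last. -/
abbrev MStmt (Λ : Type) : Type := Turing.TM2.Stmt (fun _ : Stk => Sym) Λ (Option Sym)

/-- Configurations of the machines. -/
abbrev MCfg (Λ : Type) : Type := Turing.TM2.Cfg (fun _ : Stk => Sym) Λ (Option Sym)

/-- The statements of the machine that executes a program inside a larger machine with labels
`Λ`: `emb` places the labels of the program, and `next` is the label of what comes after it. -/
def Prog.stmt {Λ : Type} : ∀ p : Prog, (p.Lab → Λ) → Λ → p.Lab → MStmt Λ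
  | .skip, _, next, _ => .goto fun _ => next
  | .push k s, _, next, _ => .push k (fun _ => s) (.goto fun _ => next)
  | .seq p q, emb, _, Sum.inl l => p.stmt (fun l => emb (.inl l)) (emb (.inr q.entry)) l
  | .seq _ q, emb, next, Sum.inr l => q.stmt (fun l => emb (.inr l)) next l
  | .sw k f, emb, _, none =>
      .pop k (fun _ s => s) (.goto fun s => emb (some ⟨s, (f s).entry⟩))
  | .sw _ f, emb, next, some ⟨s, l⟩ => (f s).stmt (fun l => emb (some ⟨s, l⟩)) next l
  | .loop k go f, emb, next, none =>
      .pop k (fun _ s => s)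
        (.goto fun s => if go s = true then emb (some ⟨s, (f s).entry⟩) else next)
  | .loop _ _ f, emb, _, some ⟨s, l⟩ => (f s).stmt (fun l => emb (some ⟨s, l⟩)) (emb none) l

/-- `n` steps of a machine lead from `a` to `b`. -/
def StepsTo {Λ : Type} (M : Λ → MStmt Λ) (n : ℕ) (a b : MCfg Λ) : Prop :=
  (flip bind (Turing.TM2.step M))^[n] (some a) = some b

theorem StepsTo.trans {Λ : Type} {M : Λ → MStmt Λ} {n n' : ℕ} {a b c : MCfg Λ}
    (h : StepsTo M n a b) (h' : StepsTo M n' b c) : StepsTo M (n + n') a c := by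
  unfold StepsTo at *
  rw [add_comm, Function.iterate_add_apply, h, h']

theorem StepsTo.one {Λ : Type} {M : Λ → MStmt Λ} {a b : MCfg Λ}
    (h : Turing.TM2.step M a = some b) : StepsTo M 1 a b := h

/-- The compiled machine simulates the program, step by step. -/
theorem Run.stepsTo {Λ : Type} {M : Λ → MStmt Λ} {p : Prog} {m : Mem} {t : ℕ} {m' : Mem}
    (h : Run p m t m') : ∀ (emb : p.Lab → Λ) (next : Λ), (∀ l, M (emb l) = p.stmt emb next l) →
      ∀ v, ∃ v', StepsTo M t ⟨some (emb p.entry), v, m⟩ ⟨some next, v', m'⟩ := by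
  induction h with
  | skip m => exact fun emb next hM v => ⟨v, StepsTo.one (by simp [hM, Prog.stmt])⟩
  | push k s m => exact fun emb next hM v => ⟨v, StepsTo.one (by simp [hM, Prog.stmt])⟩
  | @seq p q m t m' t' m'' _ _ ih ih' =>
    intro emb next hM v
    obtain ⟨v', h⟩ := ih (fun l => emb (.inl l)) (emb (.inr q.entry)) (fun l => hM (.inl l)) v
    obtain ⟨v'', h'⟩ := ih' (fun l => emb (.inr l)) next (fun l => hM (.inr l)) v'
    exact ⟨v'', h.trans h'⟩
  | @sw k f m t m' _ ih =>
    intro emb next hM v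
    obtain ⟨v', h⟩ := ih (fun l => emb (some ⟨_, l⟩)) next (fun l => hM (some ⟨_, l⟩)) (m k).head?
    refine ⟨v', ?_⟩
    rw [add_comm]
    refine StepsTo.trans (StepsTo.one ?_) h
    rw [Turing.TM2.step, Prog.entry, hM none]
    rfl
  | @loopStop k go f m hgo =>
    intro emb next hM v
    refine ⟨(m k).head?, StepsTo.one ?_⟩
    rw [Turing.TM2.step, Prog.entry, hM none]
    simp [Prog.stmt, hgo]
  | @loopGo k go f m t m' t' m'' hgo _ _ ih ih' =>
    intro emb next hM v
    obtain ⟨v', h⟩ := ih (fun l => emb (some ⟨_, l⟩)) (emb none) (fun l => hM (some ⟨_, l⟩))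
      (m k).head?
    obtain ⟨v'', h'⟩ := ih' emb next hM v'
    refine ⟨v'', ?_⟩
    rw [add_comm]
    refine StepsTo.trans (StepsTo.one ?_) (h.trans h')
    rw [Turing.TM2.step, Prog.entry, hM none]
    simp [Prog.stmt, hgo]

/-- The machine that executes a program on an input on the stack `r`, and leaves the output on
the stack `z`. -/
def Prog.machine (p : Prog) : Turing.FinTM2 :=
  letI := Fintype.ofFinite p.Lab
  { K := Stk
    k₀ := .r
    k₁ := .z
    Γ := fun _ => Sym
    Λ := Option p.Lab
    main := some p.entry
    σ := Option Sym
    initialState := none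
    Γk₀Fin := inferInstanceAs (Fintype Sym)
    m := fun l => match l with
      | none => .load (fun _ => none) .halt
      | some l => p.stmt some none l }

/-- The stacks with the given contents. -/
def mem (d z r c : List Sym) : Mem
  | .d => d
  | .z => z
  | .r => r
  | .c => c

section
variable (d z r c l : List Sym)

@[simp] theorem mem_d : mem d z r c .d = d := rfl
@[simp] theorem mem_z : mem d z r c .z = z := rfl
@[simp] theorem mem_r : mem d z r c .r = r := rfl
@[simp] theorem mem_c : mem d z r c .c = c := rfl

@[simp] theorem update_mem_d : update (mem d z r c) .d l = mem l z r c := by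
  funext k; cases k <;> simp [mem, update]
@[simp] theorem update_mem_z : update (mem d z r c) .z l = mem d l r c := by
  funext k; cases k <;> simp [mem, update]
@[simp] theorem update_mem_r : update (mem d z r c) .r l = mem d z l c := by
  funext k; cases k <;> simp [mem, update]
@[simp] theorem update_mem_c : update (mem d z r c) .c l = mem d z r l := by
  funext k; cases k <;> simp [mem, update]

end

/-- A program that computes, within polynomial time, the code of `f a` from the code of `a` gives
a polynomial time Turing machine for `f`. -/
theorem Prog.computableInPolyTime {α β : Type} {ea : α → List Sym} {eb : β → List Sym} {f : α → β}
    (p : Prog) (q : Polynomial ℕ)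
    (h : ∀ a, ∃ t ≤ q.eval (ea a).length,
      Run p (mem [] [] (ea a) []) t (mem [] (eb (f a)) [] [])) :
    Nonempty (Turing.TM2ComputableInPolyTime ea eb f) := by
  refine ⟨{ tm := p.machine
            inputAlphabet := Equiv.refl _
            outputAlphabet := Equiv.refl _
            time := q + 1
            outputsFun := fun a => ?_ }⟩
  have h := h a
  have h2 : ∃ n ≤ (q + 1).eval (ea a).length,
      (flip bind p.machine.step)^[n] (some (Turing.initList p.machine (ea a))) =
        some (Turing.haltList p.machine (eb (f a))) := by
    obtain ⟨t, ht, hr⟩ := h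
    obtain ⟨v, hv⟩ := hr.stepsTo (M := p.machine.m) some none (fun l => rfl) none
    refine ⟨t + 1, by simpa using ht, ?_⟩
    have e1 : Turing.initList p.machine (ea a) =
        ⟨some (some p.entry), none, mem [] [] (ea a) []⟩ := by
      unfold Turing.initList
      congr 1
      funext k
      cases k <;> rfl
    have e2 : Turing.haltList p.machine (eb (f a)) = ⟨none, none, mem [] (eb (f a)) [] []⟩ := by
      unfold Turing.haltList
      congr 1
      funext k
      cases k <;> rfl
    rw [e1, e2]
    exact StepsTo.trans hv (StepsTo.one rfl)
  refine ⟨⟨h2.choose, ?_⟩, h2.choose_spec.1⟩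
  have e : ∀ l : List Sym, l.map (Equiv.refl Sym).invFun = l := List.map_id
  rw [Option.map_some]
  exact (e (ea a)).symm ▸ (e (eb (f a))).symm ▸ h2.choose_spec.2

/-! ### Trees as data -/

/-- Binary trees, the data on which programs work. -/
inductive Tree : Type
  | nil
  | node (a b : Tree)

/-- The code of a tree in Polish notation. -/
def Tree.code : Tree → List Sym
  | .nil => [.bit false]
  | .node a b => .bit true :: (a.code ++ b.code)

/-- The number of nodes of a tree, which is the length of its code. -/
def Tree.size : Tree → ℕ
  | .nil => 1
  | .node a b => a.size + b.size + 1

theorem Tree.length_code (t : Tree) : t.code.length = t.size := by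
  induction t with
  | nil => rfl
  | node a b iha ihb => simp [code, size, iha, ihb]

theorem Tree.code_node_append (a b : Tree) (l : List Sym) :
    (Tree.node a b).code ++ l = .bit true :: (a.code ++ (b.code ++ l)) := by
  simp [code]

theorem Tree.size_pos (t : Tree) : 0 < t.size := by
  cases t <;> simp [size]

/-- `Exec p m m' T`: the program leads from `m` to `m'` in at most `T` steps. -/
def Exec (p : Prog) (m m' : Mem) (T : ℕ) : Prop := ∃ t ≤ T, Run p m t m'

theorem Exec.seq {p q : Prog} {m m' m'' : Mem} {T T' : ℕ} (h : Exec p m m' T)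
    (h' : Exec q m' m'' T') : Exec (.seq p q) m m'' (T + T') := by
  obtain ⟨t, ht, h⟩ := h
  obtain ⟨t', ht', h'⟩ := h'
  exact ⟨_, add_le_add ht ht', h.seq h'⟩

theorem Exec.mono {p : Prog} {m m' : Mem} {T T' : ℕ} (h : Exec p m m' T) (hT : T ≤ T') :
    Exec p m m' T' :=
  h.imp fun _ ht => ⟨ht.1.trans hT, ht.2⟩

theorem Exec.pushD (s : Sym) (D Z R C : List Sym) :
    Exec (.push .d s) (mem D Z R C) (mem (s :: D) Z R C) 1 :=
  ⟨1, le_rfl, by simpa using Run.push .d s (mem D Z R C)⟩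

theorem Exec.swD {f : Option Sym → Prog} {s : Sym} {D Z R C : List Sym} {m' : Mem} {T : ℕ}
    (h : Exec (f (some s)) (mem D Z R C) m' T) :
    Exec (.sw .d f) (mem (s :: D) Z R C) m' (T + 1) := by
  obtain ⟨t, ht, h⟩ := h
  exact ⟨_, Nat.add_le_add_right ht 1, .sw (by simpa using h)⟩

/-! ### Moving trees between stacks -/

/-- Push a symbol, if there is one. -/
def pushOpt (k : Stk) : Option Sym → Prog
  | some s => .push k s
  | none => .skip

/-- Remove the topmost tree of the stack `k`, and, if `keep` holds, put its code, reversed, on the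
stack `r`. The stack `c` counts the subtrees that are still to come. -/
def takeTree (k : Stk) (keep : Bool) : Prog :=
  .seq (.push .c .neg) (.loop .c Option.isSome fun _ => .sw k fun s =>
    .seq (bif keep then pushOpt .r s else .skip)
      (if s = some (.bit true) then .seq (.push .c .neg) (.push .c .neg) else .seq .skip .skip))

/-- Empty the stack `r` onto the stack `k`. -/
def emptyTo (k : Stk) : Prog := .loop .r Option.isSome fun s => pushOpt k s

/-- Empty the stack `r` onto the stacks `k` and `l`. -/
def emptyToBoth (k l : Stk) : Prog :=
  .loop .r Option.isSome fun s => .seq (pushOpt k s) (pushOpt l s)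

/-- The loop of `takeTree` on the stack `d`, with a continuation: the counter drops by one when a
tree has been read. -/
theorem run_takeTree_d_loop (keep : Bool) (t : Tree) : ∀ (D Z R C : List Sym) (T : ℕ) (m : Mem),
    Run (.loop .c Option.isSome fun _ => .sw .d fun s =>
      .seq (bif keep then pushOpt .r s else .skip)
        (if s = some (.bit true) then .seq (.push .c .neg) (.push .c .neg) else .seq .skip .skip))
      (mem D Z ((bif keep then t.code.reverse else []) ++ R) C) T m →
    Run (.loop .c Option.isSome fun _ => .sw .d fun s =>
      .seq (bif keep then pushOpt .r s else .skip)
        (if s = some (.bit true) then .seq (.push .c .neg) (.push .c .neg) else .seq .skip .skip))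
      (mem (t.code ++ D) Z R (.neg :: C)) (T + 5 * t.size) m := by
  induction t with
  | nil =>
    intro D Z R C T m h
    rw [show T + 5 * Tree.nil.size = (1 + (1 + 1) + 1) + T + 1 by simp [Tree.size]; ring]
    refine .loopGo (by rfl) (.sw (.seq (m' := mem D Z
      ((bif keep then Tree.nil.code.reverse else []) ++ R) C) ?_ ?_)) h
    · cases keep
      · simpa [Tree.code] using Run.skip _
      · simpa [Tree.code, pushOpt] using Run.push .r (.bit false) (mem D Z R C)
    · simpa [Tree.code] using (Run.skip _).seq (Run.skip _)
  | node a b iha ihb =>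
    intro D Z R C T m h
    rw [show T + 5 * (a.node b).size =
      (1 + (1 + 1) + 1) + (T + 5 * b.size + 5 * a.size) + 1 by simp [Tree.size]; ring]
    refine .loopGo (m' := mem (a.code ++ (b.code ++ D)) Z
      ((bif keep then [.bit true] else []) ++ R) (.neg :: .neg :: C)) (by rfl)
      (.sw (.seq (m' := mem (a.code ++ (b.code ++ D)) Z
      ((bif keep then [.bit true] else []) ++ R) C) ?_ ?_)) (iha _ _ _ _ _ _ (ihb _ _ _ _ _ _ ?_))
    · cases keep
      · simpa [Tree.code] using Run.skip _
      · simpa [Tree.code, pushOpt] using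
          Run.push .r (.bit true) (mem (a.code ++ (b.code ++ D)) Z R C)
    · have h1 := Run.push .c .neg (mem (a.code ++ (b.code ++ D)) Z
        ((bif keep then [.bit true] else []) ++ R) C)
      have h2 := Run.push .c .neg (mem (a.code ++ (b.code ++ D)) Z
        ((bif keep then [.bit true] else []) ++ R) (.neg :: C))
      simpa [Tree.code] using h1.seq (by simpa using h2)
    · cases keep <;> simpa [Tree.code] using h

/-- The loop of `takeTree` on the stack `z`. -/
theorem run_takeTree_z_loop (keep : Bool) (t : Tree) : ∀ (D Z R C : List Sym) (T : ℕ) (m : Mem),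
    Run (.loop .c Option.isSome fun _ => .sw .z fun s =>
      .seq (bif keep then pushOpt .r s else .skip)
        (if s = some (.bit true) then .seq (.push .c .neg) (.push .c .neg) else .seq .skip .skip))
      (mem D Z ((bif keep then t.code.reverse else []) ++ R) C) T m →
    Run (.loop .c Option.isSome fun _ => .sw .z fun s =>
      .seq (bif keep then pushOpt .r s else .skip)
        (if s = some (.bit true) then .seq (.push .c .neg) (.push .c .neg) else .seq .skip .skip))
      (mem D (t.code ++ Z) R (.neg :: C)) (T + 5 * t.size) m := by
  induction t with
  | nil =>
    intro D Z R C T m h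
    rw [show T + 5 * Tree.nil.size = (1 + (1 + 1) + 1) + T + 1 by simp [Tree.size]; ring]
    refine .loopGo (by rfl) (.sw (.seq (m' := mem D Z
      ((bif keep then Tree.nil.code.reverse else []) ++ R) C) ?_ ?_)) h
    · cases keep
      · simpa [Tree.code] using Run.skip _
      · simpa [Tree.code, pushOpt] using Run.push .r (.bit false) (mem D Z R C)
    · simpa [Tree.code] using (Run.skip _).seq (Run.skip _)
  | node a b iha ihb =>
    intro D Z R C T m h
    rw [show T + 5 * (a.node b).size =
      (1 + (1 + 1) + 1) + (T + 5 * b.size + 5 * a.size) + 1 by simp [Tree.size]; ring]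
    refine .loopGo (m' := mem D (a.code ++ (b.code ++ Z))
      ((bif keep then [.bit true] else []) ++ R) (.neg :: .neg :: C)) (by rfl)
      (.sw (.seq (m' := mem D (a.code ++ (b.code ++ Z))
      ((bif keep then [.bit true] else []) ++ R) C) ?_ ?_)) (iha _ _ _ _ _ _ (ihb _ _ _ _ _ _ ?_))
    · cases keep
      · simpa [Tree.code] using Run.skip _
      · simpa [Tree.code, pushOpt] using
          Run.push .r (.bit true) (mem D (a.code ++ (b.code ++ Z)) R C)
    · have h1 := Run.push .c .neg (mem D (a.code ++ (b.code ++ Z))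
        ((bif keep then [.bit true] else []) ++ R) C)
      have h2 := Run.push .c .neg (mem D (a.code ++ (b.code ++ Z))
        ((bif keep then [.bit true] else []) ++ R) (.neg :: C))
      simpa [Tree.code] using h1.seq (by simpa using h2)
    · cases keep <;> simpa [Tree.code] using h

theorem exec_takeTree_d (keep : Bool) (t : Tree) (D Z R : List Sym) :
    Exec (takeTree .d keep) (mem (t.code ++ D) Z R [])
      (mem D Z ((bif keep then t.code.reverse else []) ++ R) []) (5 * t.size + 2) := by
  refine ⟨1 + (1 + 5 * t.size), by omega, .seq (.push _ _ _) ?_⟩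
  rw [update_mem_c]
  refine run_takeTree_d_loop keep t D Z R [] 1 _ ?_
  simpa using Run.loopStop (k := .c) (m := mem D Z ((bif keep then t.code.reverse else []) ++ R) [])
    (go := Option.isSome) rfl

theorem exec_takeTree_z (keep : Bool) (t : Tree) (D Z R : List Sym) :
    Exec (takeTree .z keep) (mem D (t.code ++ Z) R [])
      (mem D Z ((bif keep then t.code.reverse else []) ++ R) []) (5 * t.size + 2) := by
  refine ⟨1 + (1 + 5 * t.size), by omega, .seq (.push _ _ _) ?_⟩
  rw [update_mem_c]
  refine run_takeTree_z_loop keep t D Z R [] 1 _ ?_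
  simpa using Run.loopStop (k := .c) (m := mem D Z ((bif keep then t.code.reverse else []) ++ R) [])
    (go := Option.isSome) rfl

theorem exec_emptyTo_d (l : List Sym) : ∀ D Z C : List Sym,
    Exec (emptyTo .d) (mem D Z l C) (mem (l.reverse ++ D) Z [] C) (2 * l.length + 1) := by
  induction l with
  | nil =>
    exact fun D Z C => ⟨1, le_rfl, by
      simpa [emptyTo] using Run.loopStop (k := .r) (go := Option.isSome) (m := mem D Z [] C) rfl⟩
  | cons s l ih =>
    intro D Z C
    obtain ⟨t, ht, h⟩ := ih (s :: D) Z C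
    refine ⟨1 + t + 1, by simp; omega, .loopGo (m' := mem (s :: D) Z l C) rfl ?_ ?_⟩
    · simpa [pushOpt] using Run.push .d s (mem D Z l C)
    · rw [List.reverse_cons, List.append_assoc]
      exact h

theorem exec_emptyTo_z (l : List Sym) : ∀ D Z C : List Sym,
    Exec (emptyTo .z) (mem D Z l C) (mem D (l.reverse ++ Z) [] C) (2 * l.length + 1) := by
  induction l with
  | nil =>
    exact fun D Z C => ⟨1, le_rfl, by
      simpa [emptyTo] using Run.loopStop (k := .r) (go := Option.isSome) (m := mem D Z [] C) rfl⟩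
  | cons s l ih =>
    intro D Z C
    obtain ⟨t, ht, h⟩ := ih D (s :: Z) C
    refine ⟨1 + t + 1, by simp; omega, .loopGo (m' := mem D (s :: Z) l C) rfl ?_ ?_⟩
    · simpa [pushOpt] using Run.push .z s (mem D Z l C)
    · rw [List.reverse_cons, List.append_assoc]
      exact h

theorem exec_emptyToBoth (l : List Sym) : ∀ D Z C : List Sym,
    Exec (emptyToBoth .d .z) (mem D Z l C) (mem (l.reverse ++ D) (l.reverse ++ Z) [] C)
      (3 * l.length + 1) := by
  induction l with
  | nil =>
    exact fun D Z C => ⟨1, le_rfl, by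
      simpa [emptyToBoth] using Run.loopStop (k := .r) (go := Option.isSome)
        (m := mem D Z [] C) rfl⟩
  | cons s l ih =>
    intro D Z C
    obtain ⟨t, ht, h⟩ := ih (s :: D) (s :: Z) C
    refine ⟨(1 + 1) + t + 1, by simp; omega, .loopGo (m' := mem (s :: D) (s :: Z) l C) rfl ?_ ?_⟩
    · simpa [pushOpt] using (Run.push .d s (mem D Z l C)).seq
        (by simpa using Run.push .z s (mem (s :: D) Z l C))
    · rw [List.reverse_cons, List.append_assoc, List.append_assoc]
      exact h

/-- Remove the topmost tree of `d`. -/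
def dropD : Prog := takeTree .d false
/-- Remove the topmost tree of `z`. -/
def dropZ : Prog := takeTree .z false
/-- Move the topmost tree of `d` to `z`. -/
def saveD : Prog := .seq (takeTree .d true) (emptyTo .z)
/-- Move the topmost tree of `z` to `d`. -/
def fetchZ : Prog := .seq (takeTree .z true) (emptyTo .d)
/-- Copy the topmost tree of `d` to `z`. -/
def copyD : Prog := .seq (takeTree .d true) (emptyToBoth .d .z)
/-- Copy the topmost tree of `z` to `d`. -/
def copyZ : Prog := .seq (takeTree .z true) (emptyToBoth .d .z)

section
variable (t : Tree) (D Z : List Sym)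

theorem exec_dropD : Exec dropD (mem (t.code ++ D) Z [] []) (mem D Z [] []) (8 * t.size + 3) :=
  (exec_takeTree_d false t D Z []).mono (by omega)

theorem exec_dropZ : Exec dropZ (mem D (t.code ++ Z) [] []) (mem D Z [] []) (8 * t.size + 3) :=
  (exec_takeTree_z false t D Z []).mono (by omega)

theorem exec_saveD :
    Exec saveD (mem (t.code ++ D) Z [] []) (mem D (t.code ++ Z) [] []) (8 * t.size + 3) := by
  have h := exec_emptyTo_z t.code.reverse D Z []
  rw [List.reverse_reverse] at h
  refine ((exec_takeTree_d true t D Z []).seq (by simpa using h)).mono ?_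
  simp [Tree.length_code]; omega

theorem exec_fetchZ :
    Exec fetchZ (mem D (t.code ++ Z) [] []) (mem (t.code ++ D) Z [] []) (8 * t.size + 3) := by
  have h := exec_emptyTo_d t.code.reverse D Z []
  rw [List.reverse_reverse] at h
  refine ((exec_takeTree_z true t D Z []).seq (by simpa using h)).mono ?_
  simp [Tree.length_code]; omega

theorem exec_copyD :
    Exec copyD (mem (t.code ++ D) Z [] []) (mem (t.code ++ D) (t.code ++ Z) [] [])
      (8 * t.size + 3) := by
  have h := exec_emptyToBoth t.code.reverse D Z []
  rw [List.reverse_reverse] at h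
  refine ((exec_takeTree_d true t D Z []).seq (by simpa using h)).mono ?_
  simp [Tree.length_code]; omega

theorem exec_copyZ :
    Exec copyZ (mem D (t.code ++ Z) [] []) (mem (t.code ++ D) (t.code ++ Z) [] [])
      (8 * t.size + 3) := by
  have h := exec_emptyToBoth t.code.reverse D Z []
  rw [List.reverse_reverse] at h
  refine ((exec_takeTree_z true t D Z []).seq (by simpa using h)).mono ?_
  simp [Tree.length_code]; omega

end

/-! ### Functions computable in polynomial time -/

/-- A type whose elements are coded as trees. -/
class Enc (α : Type) where
  enc : α → Tree

open Enc (enc)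

/-- The size of the tree that codes `a`. -/
def size {α : Type} [Enc α] (a : α) : ℕ := (enc a).size

/-- A natural number that depends on `a` is bounded by a polynomial in the size of `a`. -/
def Bdd {α : Type} [Enc α] (F : α → ℕ) : Prop :=
  ∃ q : Polynomial ℕ, ∀ a, F a ≤ q.eval (size a)

/-- `f` is computable in polynomial time by a program that takes the code of `a` on the stack `d`
to the code of `f a`, whatever the stacks `d` and `z` hold below. -/
@[fun_prop]
def PT {α β : Type} [Enc α] [Enc β] (f : α → β) : Prop :=
  ∃ (p : Prog) (T : α → ℕ), Bdd T ∧ ∀ a D Z,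
    Exec p (mem ((enc a).code ++ D) Z [] []) (mem ((enc (f a)).code ++ D) Z [] []) (T a)

theorem eval_mono (q : Polynomial ℕ) : Monotone fun n : ℕ => q.eval n := by
  intro m n h
  simp only [Polynomial.eval_eq_sum, Polynomial.sum]
  gcongr

section Bdd
variable {α β : Type} [Enc α] [Enc β] {F G : α → ℕ}

theorem Bdd.mono (hG : Bdd G) (h : ∀ a, F a ≤ G a) : Bdd F :=
  hG.imp fun _ hq a => (h a).trans (hq a)

theorem Bdd.const (n : ℕ) : Bdd fun _ : α => n := ⟨Polynomial.C n, by simp⟩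

theorem Bdd.size : Bdd (size : α → ℕ) := ⟨Polynomial.X, by simp⟩

theorem Bdd.add (hF : Bdd F) (hG : Bdd G) : Bdd fun a => F a + G a := by
  obtain ⟨p, hp⟩ := hF
  obtain ⟨q, hq⟩ := hG
  exact ⟨p + q, fun a => by simpa using add_le_add (hp a) (hq a)⟩

theorem Bdd.mul (hF : Bdd F) (hG : Bdd G) : Bdd fun a => F a * G a := by
  obtain ⟨p, hp⟩ := hF
  obtain ⟨q, hq⟩ := hG
  exact ⟨p * q, fun a => by simpa using Nat.mul_le_mul (hp a) (hq a)⟩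

theorem Bdd.eval (q : Polynomial ℕ) (hF : Bdd F) : Bdd fun a => q.eval (F a) := by
  obtain ⟨p, hp⟩ := hF
  exact ⟨q.comp p, fun a => by simpa using eval_mono q (hp a)⟩

theorem size_pos (a : α) : 0 < Holant.size a := Tree.size_pos _

end Bdd

/-- The total length of the stacks. -/
def memLength (m : Mem) : ℕ := (m .d).length + (m .z).length + (m .r).length + (m .c).length

theorem memLength_update_tail (m : Mem) (k : Stk) :
    memLength (Function.update m k (m k).tail) ≤ memLength m := by
  cases k <;> simp [memLength, Function.update]

/-- Each step adds at most one symbol to the stacks. -/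
theorem Run.memLength_le {p : Prog} {m m' : Mem} {t : ℕ} (h : Run p m t m') :
    memLength m' ≤ memLength m + t := by
  induction h with
  | skip => omega
  | push k s m => cases k <;> simp [memLength, Function.update] <;> omega
  | seq _ _ ih ih' => omega
  | @sw k f m t m' _ ih =>
    have := memLength_update_tail m k
    omega
  | @loopStop k go f m _ =>
    have := memLength_update_tail m k
    omega
  | @loopGo k go f m _ _ _ _ _ _ _ ih ih' =>
    have := memLength_update_tail m k
    omega

section PT
variable {α β γ δ : Type} [Enc α] [Enc β] [Enc γ] [Enc δ]

/-- Within polynomial time, only a result of polynomial size can be written. -/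
theorem PT.bdd_size {f : α → β} (hf : PT f) : Bdd fun a => size (f a) := by
  obtain ⟨p, T, hT, h⟩ := hf
  refine (Bdd.size.add hT).mono fun a => ?_
  obtain ⟨t, ht, hr⟩ := h a [] []
  have := hr.memLength_le
  simp [memLength, Tree.length_code] at this
  simp only [size]
  omega

theorem Bdd.comp {F : β → ℕ} {f : α → β} (hF : Bdd F) (hf : PT f) : Bdd fun a => F (f a) := by
  obtain ⟨q, hq⟩ := hF
  exact (hf.bdd_size.eval q).mono fun a => hq _

/-- A function that is the identity on codes is computable in polynomial time. -/
theorem PT.of_enc_eq {f : α → β} (h : ∀ a, enc (f a) = enc a) : PT f :=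
  ⟨.skip, fun _ => 1, .const 1, fun a D Z => by rw [h]; exact ⟨1, le_rfl, .skip _⟩⟩

theorem PT.congr_enc {f : α → β} {g : α → γ} (hf : PT f) (h : ∀ a, enc (f a) = enc (g a)) :
    PT g := by
  obtain ⟨p, T, hT, hp⟩ := hf
  exact ⟨p, T, hT, fun a D Z => h a ▸ hp a D Z⟩

@[fun_prop]
theorem PT.id' : PT fun a : α => a := PT.of_enc_eq fun _ => rfl

@[fun_prop]
theorem PT.comp {g : β → γ} {f : α → β} (hg : PT g) (hf : PT f) : PT fun a => g (f a) := by
  obtain ⟨q, T', hT', hq⟩ := hg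
  have hT'' := hT'.comp hf
  obtain ⟨p, T, hT, hp⟩ := hf
  exact ⟨.seq p q, _, hT.add hT'', fun a D Z => (hp a D Z).seq (hq _ D Z)⟩

/-- Write the code of a tree. -/
def pushTree : Tree → Prog
  | .nil => .push .d (.bit false)
  | .node a b => .seq (pushTree b) (.seq (pushTree a) (.push .d (.bit true)))

theorem exec_pushTree (t : Tree) : ∀ D Z,
    Exec (pushTree t) (mem D Z [] []) (mem (t.code ++ D) Z [] []) t.size := by
  induction t with
  | nil => exact fun D Z => Exec.pushD _ _ _ _ _
  | node a b iha ihb =>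
    intro D Z
    rw [Tree.code_node_append]
    refine ((ihb D Z).seq ((iha _ Z).seq (Exec.pushD _ _ _ _ _))).mono ?_
    simp [Tree.size]; omega

@[fun_prop]
theorem PT.const (b : β) : PT fun _ : α => b := by
  refine ⟨.seq dropD (pushTree (enc b)), _,
    ((Bdd.const 8).mul Bdd.size |>.add (.const 3)).add (.const (enc b).size), fun a D Z => ?_⟩
  exact (exec_dropD _ D Z).seq (exec_pushTree _ D Z)

instance : Enc Tree := ⟨fun t => t⟩

instance {α β : Type} [Enc α] [Enc β] : Enc (α × β) := ⟨fun a => .node (enc a.1) (enc a.2)⟩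

theorem enc_prod (a : α) (b : β) : enc (a, b) = .node (enc a) (enc b) := rfl

@[simp] theorem size_prod (a : α) (b : β) : size (a, b) = size a + size b + 1 := rfl

@[fun_prop]
theorem PT.prodMk {f : α → β} {g : α → γ} (hf : PT f) (hg : PT g) : PT fun a => (f a, g a) := by
  obtain ⟨p, T, hT, hp⟩ := hf
  obtain ⟨q, T', hT', hq⟩ := hg
  refine ⟨.seq copyD (.seq q (.seq fetchZ (.seq p (.push .d (.bit true))))), _,
    ((Bdd.const 8).mul Bdd.size |>.add (.const 3)).add (hT'.add
      (((Bdd.const 8).mul Bdd.size |>.add (.const 3)).add (hT.add (.const 1)))), fun a D Z => ?_⟩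
  rw [enc_prod, Tree.code_node_append]
  exact (exec_copyD _ D Z).seq ((hq a _ _).seq ((exec_fetchZ _ _ _).seq
    ((hp a _ _).seq (Exec.pushD _ _ _ _ _))))

theorem PT.fst' : PT fun a : α × β => a.1 := by
  refine ⟨.sw .d fun _ => .seq saveD (.seq dropD fetchZ), _,
    ((Bdd.const 24).mul Bdd.size).add (.const 10), ?_⟩
  rintro ⟨a, b⟩ D Z
  rw [enc_prod, Tree.code_node_append]
  refine (Exec.swD ((exec_saveD _ _ _).seq ((exec_dropD _ _ _).seq (exec_fetchZ _ _ _)))).mono ?_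
  simp only [size_prod]
  simp only [size]; omega

theorem PT.snd' : PT fun a : α × β => a.2 := by
  refine ⟨.sw .d fun _ => dropD, _,
    ((Bdd.const 8).mul Bdd.size).add (.const 4), ?_⟩
  rintro ⟨a, b⟩ D Z
  rw [enc_prod, Tree.code_node_append]
  refine (Exec.swD (exec_dropD _ _ _)).mono ?_
  simp only [size_prod]
  simp only [size]; omega

@[fun_prop]
theorem PT.fst {f : α → β × γ} (hf : PT f) : PT fun a => (f a).1 := PT.fst'.comp hf

@[fun_prop]
theorem PT.snd {f : α → β × γ} (hf : PT f) : PT fun a => (f a).2 := PT.snd'.comp hf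

end PT

/-! ### Lists, Booleans and options -/

/-- The tree that codes a list. -/
def encTreeList {α : Type} [Enc α] : List α → Tree
  | [] => .nil
  | a :: l => .node (enc a) (encTreeList l)

instance {α : Type} [Enc α] : Enc (List α) := ⟨encTreeList⟩

instance : Enc Bool := ⟨fun b => bif b then .node .nil .nil else .nil⟩

instance : Enc Unit := ⟨fun _ => .nil⟩

instance {α : Type} [Enc α] : Enc (Option α) :=
  ⟨fun o => match o with
    | none => .nil
    | some a => .node (enc a) .nil⟩

section
variable {α β γ δ : Type} [Enc α] [Enc β] [Enc γ] [Enc δ]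

theorem enc_nil : enc ([] : List α) = .nil := rfl
theorem enc_cons (a : α) (l : List α) : enc (a :: l) = .node (enc a) (enc l) := rfl
@[simp] theorem size_nil : size ([] : List α) = 1 := rfl
@[simp] theorem size_cons (a : α) (l : List α) : size (a :: l) = size a + size l + 1 := rfl
@[simp] theorem size_none : size (none : Option α) = 1 := rfl
@[simp] theorem size_some (a : α) : size (some a) = size a + 2 := rfl
theorem size_bool_le (b : Bool) : size b ≤ 3 := by cases b <;> simp [size, enc, Tree.size]

theorem length_le_size (l : List α) : l.length ≤ size l := by
  induction l with
  | nil => simp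
  | cons a l ih => simp; omega

theorem size_le_of_mem {l : List α} {a : α} (h : a ∈ l) : size a ≤ size l := by
  induction l with
  | nil => simp at h
  | cons b l ih =>
    rcases List.mem_cons.1 h with rfl | h
    · simp; omega
    · have := ih h
      simp; omega

theorem size_append (l l' : List α) : size (l ++ l') + 1 = size l + size l' := by
  induction l with
  | nil => simp; omega
  | cons b l ih => simp; omega

theorem size_reverse (l : List α) : size l.reverse = size l := by
  induction l with
  | nil => rfl
  | cons b l ih =>
    have := size_append l.reverse [b]
    simp at *; omega

theorem size_le_of_forall_mem {l : List α} {n : ℕ} (h : ∀ a ∈ l, size a ≤ n) :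
    size l ≤ l.length * (n + 1) + 1 := by
  induction l with
  | nil => simp
  | cons b l ih =>
    have h1 := ih fun a ha => h a (List.mem_cons_of_mem _ ha)
    have h2 := h b List.mem_cons_self
    simp [add_mul] at *; omega

/-- The program for iterating `p` along a list: the loop consumes the list on `d`, and keeps the
accumulator and, below it, the context on `z`. -/
def foldBody (p : Prog) : Prog :=
  .seq fetchZ (.seq (.push .d (.bit true)) (.seq copyZ
    (.seq (.push .d (.bit true)) (.seq p saveD))))

/-- The loop of a program for `List.foldl`. -/
def foldLoop (p : Prog) : Prog :=
  .loop .d (fun s => decide (s = some (.bit true))) fun _ => foldBody p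

/-- All partial accumulators are of size at most `M`, and a step takes at most `N` units of time on
them. -/
theorem exec_foldLoop {step : γ → β → α → β} {p : Prog} {T : γ × β × α → ℕ}
    (hp : ∀ t D Z, Exec p (mem ((enc t).code ++ D) Z [] [])
      (mem ((enc (step t.1 t.2.1 t.2.2)).code ++ D) Z [] []) (T t))
    (c : γ) {M N : ℕ} (l : List α) : ∀ acc : β,
    (∀ l₁ l₂, l = l₁ ++ l₂ → size (l₁.foldl (step c) acc) ≤ M) →
    (∀ x ∈ l, ∀ b, size b ≤ M → T (c, b, x) ≤ N) → ∀ D Z,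
    Exec (foldLoop p) (mem ((enc l).code ++ D) ((enc acc).code ++ ((enc c).code ++ Z)) [] [])
      (mem D ((enc (l.foldl (step c) acc)).code ++ ((enc c).code ++ Z)) [] [])
      (l.length * (16 * M + 8 * size c + N + 20) + 1) := by
  induction l with
  | nil =>
    intro acc _ _ D Z
    refine ⟨1, by omega, ?_⟩
    simpa [foldLoop, enc_nil, Tree.code] using Run.loopStop (k := .d)
      (go := fun s => decide (s = some (.bit true))) (f := fun _ => foldBody p)
      (m := mem (.bit false :: D) ((enc acc).code ++ ((enc c).code ++ Z)) [] []) (by simp)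
  | cons x l ih =>
    intro acc hM hN D Z
    have h0 : size acc ≤ M := hM [] (x :: l) rfl
    have h1 : size (step c acc x) ≤ M := hM [x] l rfl
    have hT := hN x List.mem_cons_self acc h0
    obtain ⟨t', ht', hr'⟩ := ih (step c acc x) (fun l₁ l₂ e => hM (x :: l₁) l₂ (by rw [e]; rfl))
      (fun y hy => hN y (List.mem_cons_of_mem _ hy)) D Z
    have hb : Exec (foldBody p)
        (mem ((enc x).code ++ ((enc l).code ++ D)) ((enc acc).code ++ ((enc c).code ++ Z)) [] [])
        (mem ((enc l).code ++ D) ((enc (step c acc x)).code ++ ((enc c).code ++ Z)) [] [])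
        (16 * M + 8 * size c + N + 19) := by
      have h2 := hp (c, acc, x) ((enc l).code ++ D) ((enc c).code ++ Z)
      simp only [enc_prod, Tree.code_node_append] at h2
      refine Exec.mono ((exec_fetchZ _ _ _).seq ((Exec.pushD _ _ _ _ _).seq
        ((exec_copyZ _ _ _).seq ((Exec.pushD _ _ _ _ _).seq (h2.seq (exec_saveD _ _ _)))))) ?_
      simp only [size] at *
      omega
    obtain ⟨t, ht, hr⟩ := hb
    refine ⟨t + t' + 1, by simp only [List.length_cons, add_mul]; omega, ?_⟩
    rw [enc_cons, Tree.code_node_append]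
    exact .loopGo (by simp) (by simpa using hr) hr'

/-- Iteration along a list is computable in polynomial time, provided that the step is, and that
the accumulator stays of polynomial size. -/
theorem PT.foldl {step : γ → β → α → β} {init : γ → β} {l : γ → List α}
    (hs : PT fun t : γ × β × α => step t.1 t.2.1 t.2.2) (hi : PT init) (hl : PT l)
    {F : γ → ℕ} (hF : Bdd F)
    (hb : ∀ c l₁ l₂, l c = l₁ ++ l₂ → size (l₁.foldl (step c) (init c)) ≤ F c) :
    PT fun c => (l c).foldl (step c) (init c) := by
  have h0 : PT fun c => (c, init c, l c) := by fun_prop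
  have hls := hl.bdd_size
  obtain ⟨P, T₀, hT₀, hP⟩ := h0
  obtain ⟨p, T, ⟨q, hq⟩, hp⟩ := hs
  refine ⟨.seq P (.sw .d fun _ => .seq saveD (.sw .d fun _ => .seq saveD (.seq (foldLoop p)
    (.seq fetchZ dropZ)))), fun c => T₀ c + ((8 * size c + 3 + (8 * F c + 3 +
      ((size (l c) * (16 * F c + 8 * size c + q.eval (size c + F c + size (l c) + 2) + 20) + 1) +
      ((8 * F c + 3) + (8 * size c + 3))) + 1)) + 1), ?_, fun c D Z => ?_⟩
  · have h8 : ∀ {G : γ → ℕ}, Bdd G → Bdd fun c => 8 * G c + 3 :=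
      fun h => ((Bdd.const 8).mul h).add (.const 3)
    exact hT₀.add (((h8 .size).add (((h8 hF).add (((hls.mul ((((((Bdd.const 16).mul hF).add
      ((Bdd.const 8).mul .size)).add (Bdd.eval q (((Bdd.size.add hF).add hls).add (.const 2)))).add
      (.const 20)))).add (.const 1)).add ((h8 hF).add (h8 .size)))).add (.const 1))).add (.const 1))
  · refine (hP c D Z).seq ?_
    rw [enc_prod, Tree.code_node_append, enc_prod]
    have hi' : size (init c) ≤ F c := hb c [] (l c) rfl
    have hr' : size ((l c).foldl (step c) (init c)) ≤ F c := hb c (l c) [] (by simp)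
    refine Exec.mono (Exec.swD ((exec_saveD _ _ _).seq (T' := 8 * F c + 3 +
      ((size (l c) * (16 * F c + 8 * size c + q.eval (size c + F c + size (l c) + 2) + 20) + 1) +
      ((8 * F c + 3) + (8 * size c + 3))) + 1) ?_)) le_rfl
    rw [Tree.code_node_append]
    refine Exec.swD (((exec_saveD _ _ _).mono ?_).seq (((exec_foldLoop hp c (M := F c)
      (N := q.eval (size c + F c + size (l c) + 2)) (l c) (init c) ?_ ?_ D Z).mono ?_).seq
      (((exec_fetchZ _ _ _).mono ?_).seq (exec_dropZ _ _ _))))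
    · simp only [size] at *; omega
    · exact hb c
    · intro x hx b hb'
      refine (hq _).trans (eval_mono q ?_)
      have := size_le_of_mem hx
      simp; omega
    · gcongr
      exact length_le_size _
    · simp only [size] at *; omega

theorem PT.foldr {step : γ → α → β → β} {init : γ → β} {l : γ → List α}
    (hs : PT fun t : γ × α × β => step t.1 t.2.1 t.2.2) (hi : PT init)
    (hl : PT fun c => (l c).reverse) {F : γ → ℕ} (hF : Bdd F)
    (hb : ∀ c l₁ l₂, l c = l₁ ++ l₂ → size (l₂.foldr (step c) (init c)) ≤ F c) :
    PT fun c => (l c).foldr (step c) (init c) := by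
  have h := PT.foldl (step := fun c b a => step c a b) (init := init)
    (l := fun c => (l c).reverse)
    (by exact hs.comp (f := fun t : γ × β × α => (t.1, t.2.2, t.2.1)) (by fun_prop)) hi hl hF
    (fun c l₁ l₂ e => by
      rw [List.reverse_eq_iff, List.reverse_append] at e
      have := hb c _ _ e
      rwa [List.foldr_reverse] at this)
  simpa using h

@[fun_prop]
theorem PT.cons {f : α → β} {g : α → List β} (hf : PT f) (hg : PT g) :
    PT fun a => f a :: g a :=
  (hf.prodMk hg).congr_enc fun _ => rfl

@[fun_prop]
theorem PT.some {f : α → β} (hf : PT f) : PT fun a => some (f a) :=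
  (hf.prodMk (PT.const ())).congr_enc fun _ => rfl

/-- Case distinction on a list. -/
theorem PT.listCases {l : γ → List α} {f : γ → β} {g : γ → α → List α → β} (hl : PT l) (hf : PT f)
    (hg : PT fun t : γ × α × List α => g t.1 t.2.1 t.2.2) :
    PT fun c => match l c with
      | [] => f c
      | a :: as => g c a as := by
  obtain ⟨p, T, ⟨P, hP⟩, hp⟩ := hf
  obtain ⟨q, T', ⟨P', hP'⟩, hq⟩ := hg
  obtain ⟨r, T₀, hT₀, hr⟩ := (show PT fun c => (c, l c) by fun_prop)
  refine ⟨.seq r (.sw .d fun _ => .seq saveD (.sw .d fun s =>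
      if s = Option.some (.bit true) then
        .seq (.push .d (.bit true)) (.seq fetchZ (.seq (.push .d (.bit true)) q))
      else .seq fetchZ p)), _,
    hT₀.add ((((Bdd.const 20).mul Bdd.size).add (.const 20)).add
      ((Bdd.size.eval P).add (((Bdd.size.add hl.bdd_size).add (.const 1)).eval P'))), ?_⟩
  intro x D Z
  refine (hr x D Z).seq ?_
  rw [enc_prod, Tree.code_node_append]
  beta_reduce
  cases hlx : l x with
  | nil =>
    rw [enc_nil]
    refine (Exec.swD ((exec_saveD _ _ _).seq (Exec.swD
      (T := (8 * (enc x).size + 3) + T x) ?_))).mono ?_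
    · rw [if_neg (by simp)]
      exact (exec_fetchZ (enc x) D Z).seq (hp x D Z)
    · have := hP x
      simp only [size] at *
      omega
  | cons a as =>
    rw [enc_cons, Tree.code_node_append]
    refine (Exec.swD ((exec_saveD _ _ _).seq (Exec.swD
      (T := 1 + ((8 * (enc x).size + 3) + (1 + T' (x, a, as)))) ?_))).mono ?_
    · rw [if_pos rfl]
      refine (Exec.pushD _ _ _ _ _).seq ((exec_fetchZ _ _ _).seq
        ((Exec.pushD _ _ _ _ _).seq ?_))
      have := hq (x, a, as) D Z
      simp only [enc_prod, Tree.code_node_append] at this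
      exact this
    · have h3 := hP' (x, a, as)
      have : size (x, a, as) = size x + size (a :: as) + 1 := rfl
      rw [this] at h3
      simp only [size] at *
      omega

theorem PT.optionCases {o : γ → Option α} {f : γ → β} {g : γ → α → β} (ho : PT o) (hf : PT f)
    (hg : PT fun t : γ × α => g t.1 t.2) :
    PT fun c => match o c with
      | none => f c
      | Option.some a => g c a := by
  have h1 : PT fun c => (o c).toList := ho.congr_enc fun c => by cases o c <;> rfl
  refine (PT.listCases (g := fun c a _ => g c a) h1 hf (by
    exact hg.comp (f := fun t : γ × α × List α => (t.1, t.2.1)) (by fun_prop))).congr_enc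
      fun c => ?_
  cases o c <;> rfl

@[fun_prop]
theorem PT.cond {b : γ → Bool} {f g : γ → β} (hb : PT b) (hf : PT f) (hg : PT g) :
    PT fun c => bif b c then f c else g c := by
  have h1 : PT fun c => (bif b c then [()] else []) :=
    hb.congr_enc fun c => by cases b c <;> rfl
  refine (PT.listCases (g := fun c _ _ => f c) h1 hg (by fun_prop)).congr_enc fun c => ?_
  cases b c <;> rfl

@[fun_prop]
theorem PT.ite {p : γ → Prop} [DecidablePred p] {f g : γ → β} (hb : PT fun c => decide (p c))
    (hf : PT f) (hg : PT g) : PT fun c => if p c then f c else g c :=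
  (hb.cond hf hg).congr_enc fun c => by by_cases h : p c <;> simp [h]

@[fun_prop]
theorem PT.not {b : γ → Bool} (hb : PT b) : PT fun c => !(b c) :=
  (hb.cond (PT.const false) (PT.const true)).congr_enc fun c => by cases b c <;> rfl

@[fun_prop]
theorem PT.and {b b' : γ → Bool} (hb : PT b) (hb' : PT b') : PT fun c => b c && b' c :=
  (hb.cond hb' (PT.const false)).congr_enc fun c => by cases b c <;> rfl

@[fun_prop]
theorem PT.or {b b' : γ → Bool} (hb : PT b) (hb' : PT b') : PT fun c => b c || b' c :=
  (hb.cond (PT.const true) hb').congr_enc fun c => by cases b c <;> rfl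

@[fun_prop]
theorem PT.xor {b b' : γ → Bool} (hb : PT b) (hb' : PT b') : PT fun c => b c ^^ b' c :=
  (hb.cond hb'.not hb').congr_enc fun c => by cases b c <;> simp

@[fun_prop]
theorem PT.tail {l : γ → List α} (hl : PT l) : PT fun c => (l c).tail :=
  (PT.listCases (g := fun _ _ as => as) hl (PT.const []) (by fun_prop)).congr_enc fun c => by
    cases l c <;> rfl

@[fun_prop]
theorem PT.headD {l : γ → List α} {d : γ → α} (hl : PT l) (hd : PT d) :
    PT fun c => (l c).headD (d c) :=
  (PT.listCases (g := fun _ a _ => a) hl hd (by fun_prop)).congr_enc fun c => by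
    cases l c <;> rfl

@[fun_prop]
theorem PT.head? {l : γ → List α} (hl : PT l) : PT fun c => (l c).head? :=
  (PT.listCases (g := fun _ a _ => Option.some a) hl (PT.const none) (by fun_prop)).congr_enc
    fun c => by cases l c <;> rfl

@[fun_prop]
theorem PT.isEmpty {l : γ → List α} (hl : PT l) : PT fun c => (l c).isEmpty :=
  (PT.listCases (g := fun _ _ _ => false) hl (PT.const true) (by fun_prop)).congr_enc
    fun c => by cases l c <;> rfl

theorem size_foldl_flip_cons (l l' : List α) :
    size (l.foldl (fun acc a => a :: acc) l') + 1 = size l + size l' := by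
  induction l generalizing l' with
  | nil => simp; omega
  | cons a l ih => have := ih (a :: l'); simp at *; omega

@[fun_prop]
theorem PT.reverse {l : γ → List α} (hl : PT l) : PT fun c => (l c).reverse := by
  have h := PT.foldl (step := fun (_ : γ) acc (a : α) => a :: acc) (init := fun _ => [])
    (l := l) (by fun_prop) (by fun_prop) hl (F := fun c => size (l c) + 1)
    (hl.bdd_size.add (.const 1)) (fun c l₁ l₂ e => by
      have h1 := size_foldl_flip_cons l₁ []
      have h2 := size_append l₁ l₂
      have h3 := size_pos l₂
      rw [e]; rw [size_nil] at h1; omega)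
  simpa using h

@[fun_prop]
theorem PT.append {l l' : γ → List α} (hl : PT l) (hl' : PT l') : PT fun c => l c ++ l' c := by
  have h := PT.foldr (step := fun (_ : γ) (a : α) acc => a :: acc) (init := l')
    (l := l) (by fun_prop) hl' hl.reverse (F := fun c => size (l c) + size (l' c) + 1)
    ((hl.bdd_size.add hl'.bdd_size).add (.const 1)) (fun c l₁ l₂ e => by
      have h2 := size_append l₁ l₂
      have h3 := size_append l₂ (l' c)
      have h4 := size_pos l₁
      rw [e]; simp; omega)
  simpa using h

/-- Iteration along a list is computable in polynomial time if each step adds only a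
polynomial amount, in terms of the context and the list element, to the accumulator. -/
theorem PT.foldr_of_le {step : γ → α → β → β} {init : γ → β} {l : γ → List α}
    (hl : PT l) (hi : PT init) (hs : PT fun t : γ × α × β => step t.1 t.2.1 t.2.2)
    {F : γ × α → ℕ} (hF : Bdd F) (hb : ∀ c a b, size (step c a b) ≤ size b + F (c, a)) :
    PT fun c => (l c).foldr (step c) (init c) := by
  obtain ⟨q, hq⟩ := hF
  refine PT.foldr hs hi hl.reverse (F := fun c => size (init c) + size (l c) *
    q.eval (size c + size (l c) + 1)) (hi.bdd_size.add (hl.bdd_size.mul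
      (((Bdd.size.add hl.bdd_size).add (.const 1)).eval q))) fun c l₁ l₂ e => ?_
  have key : ∀ l₃ : List α, (∀ x ∈ l₃, x ∈ l c) → size (l₃.foldr (step c) (init c)) ≤
      size (init c) + l₃.length * q.eval (size c + size (l c) + 1) := by
    intro l₃
    induction l₃ with
    | nil => intro _; simp
    | cons x l₃ ih =>
      intro hx
      have h1 := ih fun y hy => hx y (List.mem_cons_of_mem _ hy)
      have h2 := (hq (c, x)).trans (eval_mono q (show size (c, x) ≤ size c + size (l c) + 1 by
        have := size_le_of_mem (hx x List.mem_cons_self)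
        simp; omega))
      have h3 := hb c x (l₃.foldr (step c) (init c))
      simp only [List.foldr_cons, List.length_cons, add_mul]
      simp only at h2
      omega
  refine (key l₂ (fun x hx => by rw [e]; simp [hx])).trans ?_
  gcongr
  have := length_le_size (l c)
  rw [e] at this ⊢
  simp at this; omega

/-- The form of `PT.foldr_of_le` for iteration from the left. -/
theorem PT.foldl_of_le {step : γ → β → α → β} {init : γ → β} {l : γ → List α}
    (hl : PT l) (hi : PT init) (hs : PT fun t : γ × β × α => step t.1 t.2.1 t.2.2)
    {F : γ × α → ℕ} (hF : Bdd F) (hb : ∀ c b a, size (step c b a) ≤ size b + F (c, a)) :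
    PT fun c => (l c).foldl (step c) (init c) := by
  have h := PT.foldr_of_le (step := fun c a b => step c b a) hl.reverse hi
    (by exact hs.comp (f := fun t : γ × α × β => (t.1, t.2.2, t.2.1)) (by fun_prop)) hF
    (fun c a b => hb c b a)
  simpa using h

theorem PT.map {f : γ → α → β} {l : γ → List α} (hl : PT l) (hf : PT fun t : γ × α => f t.1 t.2) :
    PT fun c => (l c).map (f c) := by
  have h := PT.foldr_of_le (step := fun (c : γ) (a : α) acc => f c a :: acc) (init := fun _ => [])
    (l := l) hl (by fun_prop)
    ((hf.comp (f := fun t : γ × α × List β => (t.1, t.2.1)) (by fun_prop)).cons (by fun_prop))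
    (hf.bdd_size.add (.const 1)) (fun c a b => by simp; omega)
  simpa [List.foldr_cons_eq_append] using h

theorem PT.filter {f : γ → α → Bool} {l : γ → List α} (hl : PT l)
    (hf : PT fun t : γ × α => f t.1 t.2) : PT fun c => (l c).filter (f c) := by
  have h := PT.foldr_of_le (step := fun (c : γ) (a : α) acc => bif f c a then a :: acc else acc)
    (init := fun _ => []) (l := l) hl (by fun_prop)
    ((hf.comp (f := fun t : γ × α × List α => (t.1, t.2.1)) (by fun_prop)).cond (by fun_prop)
      (by fun_prop))
    (F := fun t => size t.2 + 1) ((PT.snd'.bdd_size).add (.const 1)) (fun c a b => by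
      show _ ≤ size b + (size a + 1)
      cases f c a <;> simp only [cond_true, cond_false, size_cons] <;> omega)
  refine h.congr_enc fun c => congrArg enc ?_
  induction l c with
  | nil => rfl
  | cons a as ih => cases hfa : f c a <;> simp [hfa, ih]

@[fun_prop]
theorem PT.flatten {l : γ → List (List α)} (hl : PT l) : PT fun c => (l c).flatten := by
  have h := PT.foldr_of_le (step := fun (_ : γ) (a : List α) acc => a ++ acc) (init := fun _ => [])
    (l := l) hl (by fun_prop) (by fun_prop) (F := fun t => size t.2) (PT.snd'.bdd_size)
    (fun c a b => by have := size_append a b; show _ ≤ size b + size a; omega)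
  refine h.congr_enc fun c => congrArg enc ?_
  induction l c with
  | nil => rfl
  | cons a as ih => simp [ih]

theorem PT.flatMap {f : γ → α → List β} {l : γ → List α} (hl : PT l)
    (hf : PT fun t : γ × α => f t.1 t.2) : PT fun c => (l c).flatMap (f c) := by
  simpa [List.flatMap_def] using (PT.map hl hf).flatten

theorem PT.all {f : γ → α → Bool} {l : γ → List α} (hl : PT l)
    (hf : PT fun t : γ × α => f t.1 t.2) : PT fun c => (l c).all (f c) :=
  (PT.filter (f := fun c a => !f c a) hl hf.not).isEmpty.congr_enc fun c => congrArg enc (by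
    rw [Bool.eq_iff_iff]; simp)

theorem PT.any {f : γ → α → Bool} {l : γ → List α} (hl : PT l)
    (hf : PT fun t : γ × α => f t.1 t.2) : PT fun c => (l c).any (f c) :=
  (PT.all (f := fun c a => !f c a) hl hf.not).not.congr_enc fun c => congrArg enc (by
    rw [Bool.eq_iff_iff]; simp)

end

/-! ### Binary numbers -/

instance : Enc ℕ := ⟨fun n => enc n.bits⟩

theorem size_bits (n : ℕ) : size n.bits = size n := rfl

theorem natSize_le_size (n : ℕ) : Nat.size n ≤ size n := by
  rw [← Nat.size_eq_bits_len]
  exact length_le_size n.bits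

theorem size_le_natSize (n : ℕ) : size n ≤ 4 * Nat.size n + 1 := by
  rw [← size_bits, ← Nat.size_eq_bits_len, mul_comm]
  exact size_le_of_forall_mem fun b _ => size_bool_le b

theorem natSize_mul_le (m n : ℕ) : Nat.size (m * n) ≤ Nat.size m + Nat.size n := by
  rw [Nat.size_le, pow_add]
  exact Nat.mul_lt_mul'' (Nat.lt_size_self m) (Nat.lt_size_self n)

theorem natSize_mono {m n : ℕ} (h : m ≤ n) : Nat.size m ≤ Nat.size n := Nat.size_le_size h

section
variable {α β γ : Type} [Enc α] [Enc β] [Enc γ]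

@[fun_prop]
theorem PT.bits {f : γ → ℕ} (hf : PT f) : PT fun c => (f c).bits := hf.congr_enc fun _ => rfl

@[fun_prop]
theorem PT.natBit {b : γ → Bool} {f : γ → ℕ} (hb : PT b) (hf : PT f) :
    PT fun c => Nat.bit (b c) (f c) := by
  have h : PT fun c => bif (f c).bits.isEmpty && !(b c) then [] else b c :: (f c).bits := by
    fun_prop
  refine h.congr_enc fun c => ?_
  change _ = enc (Nat.bit (b c) (f c)).bits
  congr 1
  by_cases h0 : f c = 0
  · cases hbc : b c <;> simp [h0]
  · rw [Nat.bits_append_bit _ _ (fun h => absurd h h0)]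
    have : (f c).bits ≠ [] := fun h => h0 (by
      rw [← Nat.size_eq_zero, ← Nat.size_eq_bits_len, h]; rfl)
    cases hl : (f c).bits with
    | nil => exact absurd hl this
    | cons => simp

theorem size_natBit_le (b : Bool) (n : ℕ) : size (Nat.bit b n) ≤ size n + 4 := by
  by_cases h0 : n = 0
  · subst h0
    have := size_bool_le true
    cases b <;> simp [← size_bits]
    omega
  · rw [← size_bits, Nat.bits_append_bit _ _ (fun h => absurd h h0), size_cons, size_bits]
    have := size_bool_le b
    omega

/-- The number with the given binary digits, the least significant one first. -/
def ofBits (l : List Bool) : ℕ := l.foldr Nat.bit 0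

@[simp] theorem ofBits_nil : ofBits [] = 0 := rfl
@[simp] theorem ofBits_cons (b : Bool) (l : List Bool) :
    ofBits (b :: l) = b.toNat + 2 * ofBits l := by
  simp [ofBits, Nat.bit_val, add_comm]

theorem ofBits_bits (n : ℕ) : ofBits n.bits = n := by
  induction n using Nat.binaryRec' with
  | zero => rfl
  | bit b n h ih => rw [Nat.bits_append_bit _ _ h, ofBits_cons, ih, Nat.bit_val, add_comm]

theorem ofBits_lt (l : List Bool) : ofBits l < 2 ^ l.length := by
  induction l with
  | nil => simp
  | cons b l ih => cases b <;> simp [pow_succ] <;> omega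

/-- The list of pairs of entries of two lists, the shorter one being filled up. -/
def zipD (d : α) (e : β) : List α → List β → List (α × β)
  | [], bs => bs.map fun b => (d, b)
  | a :: as, [] => (a, e) :: zipD d e as []
  | a :: as, b :: bs => (a, b) :: zipD d e as bs

omit [Enc α] [Enc β] in
theorem zipD_eq_foldl (d : α) (e : β) (as : List α) (bs : List β) (out : List (α × β)) :
    (fun s : List β × List (α × β) => s.2.reverse ++ s.1.map fun b => (d, b))
      (as.foldl (fun s a => (s.1.tail, (a, s.1.headD e) :: s.2)) (bs, out)) =
      out.reverse ++ zipD d e as bs := by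
  induction as generalizing bs out with
  | nil => rfl
  | cons a as ih =>
    cases bs with
    | nil => simpa [zipD] using ih [] ((a, e) :: out)
    | cons b bs => simpa [zipD] using ih bs ((a, b) :: out)

theorem size_tail_headD (l : List α) (d : α) :
    size l.tail + size (l.headD d) ≤ size l + size d := by
  cases l <;> simp <;> omega

@[fun_prop]
theorem PT.zipD {d : α} {e : β} {f : γ → List α} {g : γ → List β} (hf : PT f) (hg : PT g) :
    PT fun c => Holant.zipD d e (f c) (g c) := by
  have h := PT.foldl_of_le (init := fun c => (g c, ([] : List (α × β))))
    (step := fun (_ : γ) (s : List β × List (α × β)) (a : α) => (s.1.tail, (a, s.1.headD e) :: s.2))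
    hf (by fun_prop) (by fun_prop) (F := fun t => size t.2 + size e + 2)
    ((PT.snd'.bdd_size.add (.const _)).add (.const 2)) (fun c s a => by
      obtain ⟨s1, s2⟩ := s
      have := size_tail_headD s1 e
      simp only [size_prod, size_cons]; omega)
  have h2 : PT fun c => (fun s : List β × List (α × β) => s.2.reverse ++ s.1.map fun b => (d, b))
      ((f c).foldl (fun s a => (s.1.tail, (a, s.1.headD e) :: s.2)) (g c, [])) := by
    refine PT.comp (g := fun s : List β × List (α × β) => s.2.reverse ++ s.1.map fun b => (d, b))
      ?_ h
    exact (PT.snd PT.id').reverse.append (PT.map (f := fun _ b => (d, b)) (by fun_prop)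
      (by fun_prop))
  simpa only [zipD_eq_foldl, List.reverse_nil, List.nil_append] using h2

/-- Entrywise operation on two lists, the shorter one being filled up with `e`. -/
def zipOp (f : α → α → α) (e : α) (l l' : List α) : List α := (zipD e e l l').map fun p => f p.1 p.2

theorem PT.zipOp {op : α → α → α} {e : α} (hop : PT fun p : α × α => op p.1 p.2)
    {f g : γ → List α} (hf : PT f) (hg : PT g) : PT fun c => Holant.zipOp op e (f c) (g c) := by
  refine PT.map (f := fun _ (p : α × α) => op p.1 p.2) (by fun_prop) ?_
  exact hop.comp (f := fun t : γ × α × α => t.2) (by fun_prop)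

/-- Addition of binary numbers, given by pairs of digits, with a carry. -/
def addPairs : List (Bool × Bool) → Bool → ℕ
  | [], c => c.toNat
  | (x, y) :: l, c => Nat.bit (x ^^ y ^^ c) (addPairs l (x && y || x && c || y && c))

theorem addPairs_eq (l : List (Bool × Bool)) (c : Bool) :
    addPairs l c = ofBits (l.map Prod.fst) + ofBits (l.map Prod.snd) + c.toNat := by
  induction l generalizing c with
  | nil => simp [addPairs]
  | cons p l ih =>
    obtain ⟨x, y⟩ := p
    rw [addPairs, ih, Nat.bit_val]
    cases x <;> cases y <;> cases c <;> simp <;> ring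

theorem addPairs_eq_foldl (l : List (Bool × Bool)) (c : Bool) (out : List Bool) :
    (fun s : Bool × List Bool => s.2.foldl (fun n b => Nat.bit b n) s.1.toNat)
      (l.foldl (fun s p => (p.1 && p.2 || p.1 && s.1 || p.2 && s.1, (p.1 ^^ p.2 ^^ s.1) :: s.2))
        (c, out)) = out.foldl (fun n b => Nat.bit b n) (addPairs l c) := by
  induction l generalizing c out with
  | nil => rfl
  | cons p l ih => exact ih _ _

theorem ofBits_zipD_fst (l l' : List Bool) :
    ofBits ((zipD false false l l').map Prod.fst) = ofBits l := by
  induction l generalizing l' with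
  | nil => induction l' <;> simp_all [zipD]
  | cons b l ih => cases l' <;> simp [zipD, ih]

theorem ofBits_zipD_snd (l l' : List Bool) :
    ofBits ((zipD false false l l').map Prod.snd) = ofBits l' := by
  induction l generalizing l' with
  | nil => simp [zipD, Function.comp_def]
  | cons b l ih => cases l' <;> simp [zipD, ih]

@[fun_prop]
theorem PT.toNat {b : γ → Bool} (hb : PT b) : PT fun c => (b c).toNat :=
  (hb.cond (PT.const 1) (PT.const 0)).congr_enc fun c => by cases b c <;> rfl

@[fun_prop]
theorem PT.add {f g : γ → ℕ} (hf : PT f) (hg : PT g) : PT fun c => f c + g c := by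
  have h1 : PT fun c => Holant.zipD false false (f c).bits (g c).bits := by fun_prop
  have h := PT.foldl_of_le (init := fun c => (false, ([] : List Bool)))
    (step := fun (_ : γ) (s : Bool × List Bool) (p : Bool × Bool) =>
      (p.1 && p.2 || p.1 && s.1 || p.2 && s.1, (p.1 ^^ p.2 ^^ s.1) :: s.2))
    h1 (by fun_prop) (by fun_prop) (F := fun t => 7)
    (.const 7) (fun c s a => by
      obtain ⟨s1, s2⟩ := s
      have h1 := size_bool_le (a.1 && a.2 || a.1 && s1 || a.2 && s1)
      have h2 := size_bool_le (a.1 ^^ a.2 ^^ s1)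
      simp only [size_prod, size_cons]; omega)
  have h2 : PT fun s : Bool × List Bool => s.2.foldl (fun n b => Nat.bit b n) s.1.toNat :=
    PT.foldl_of_le (step := fun _ n b => Nat.bit b n) (by fun_prop) (by fun_prop) (by fun_prop)
      (F := fun _ => 4) (.const 4) fun _ n b => size_natBit_le b n
  refine (h2.comp h).congr_enc fun c => congrArg enc ?_
  refine (addPairs_eq_foldl _ _ _).trans ?_
  simp [addPairs_eq, ofBits_zipD_fst, ofBits_zipD_snd, ofBits_bits]

theorem ofBits_foldr_mul (l : List Bool) (n : ℕ) :
    l.foldr (fun b acc => (bif b then n else 0) + Nat.bit false acc) 0 = ofBits l * n := by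
  induction l with
  | nil => simp
  | cons b l ih => rw [List.foldr_cons, ih, Nat.bit_val]; cases b <;> simp <;> ring

@[fun_prop]
theorem PT.mul {f g : γ → ℕ} (hf : PT f) (hg : PT g) : PT fun c => f c * g c := by
  have h := PT.foldr (step := fun c b acc => (bif b then g c else 0) + Nat.bit false acc)
    (init := fun _ => 0) (l := fun c => (f c).bits)
    (((PT.cond (by fun_prop) (hg.comp (by fun_prop)) (by fun_prop)).add (by fun_prop)))
    (by fun_prop) (by fun_prop) (F := fun c => 4 * (size (f c) + size (g c)) + 1)
    (((Bdd.const 4).mul (hf.bdd_size.add hg.bdd_size)).add (.const 1)) (fun c l₁ l₂ e => by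
      rw [ofBits_foldr_mul]
      refine (size_le_natSize _).trans ?_
      have h1 := natSize_mul_le (Holant.ofBits l₂) (g c)
      have h2 := natSize_le_size (g c)
      have h3 : Nat.size (Holant.ofBits l₂) ≤ l₂.length := Nat.size_le.2 (ofBits_lt l₂)
      have h4 : (f c).bits.length ≤ size (f c) := length_le_size (f c).bits
      rw [e, List.length_append] at h4
      omega)
  refine h.congr_enc fun c => congrArg enc ?_
  rw [ofBits_foldr_mul, ofBits_bits]

/-- Subtraction of binary numbers, given by pairs of digits, with a borrow: the final borrow and
the digits of the result. -/
def subPairs : List (Bool × Bool) → Bool → Bool × ℕ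
  | [], c => (c, 0)
  | (x, y) :: l, c =>
    ((subPairs l (!x && y || !x && c || y && c)).1,
      Nat.bit (x ^^ y ^^ c) (subPairs l (!x && y || !x && c || y && c)).2)

theorem subPairs_spec (l : List (Bool × Bool)) (c : Bool) :
    ofBits (l.map Prod.fst) + 2 ^ l.length * (subPairs l c).1.toNat =
      ofBits (l.map Prod.snd) + c.toNat + (subPairs l c).2 ∧ (subPairs l c).2 < 2 ^ l.length := by
  induction l generalizing c with
  | nil => simp [subPairs]
  | cons p l ih =>
    obtain ⟨x, y⟩ := p
    obtain ⟨h1, h2⟩ := ih (!x && y || !x && c || y && c)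
    simp only [subPairs, Nat.bit_val, List.map_cons, ofBits_cons, List.length_cons, pow_succ]
    generalize (subPairs l (!x && y || !x && c || y && c)).1 = br at *
    generalize (subPairs l (!x && y || !x && c || y && c)).2 = n at *
    cases x <;> cases y <;> cases c <;> cases br <;> simp at * <;> omega

theorem subPairs_eq_foldl (l : List (Bool × Bool)) (c : Bool) (out : List Bool) :
    (fun s : Bool × List Bool => (s.1, s.2.foldl (fun n b => Nat.bit b n) 0))
      (l.foldl (fun s p => (!p.1 && p.2 || !p.1 && s.1 || p.2 && s.1, (p.1 ^^ p.2 ^^ s.1) :: s.2))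
        (c, out)) =
      ((subPairs l c).1, out.foldl (fun n b => Nat.bit b n) (subPairs l c).2) := by
  induction l generalizing c out with
  | nil => rfl
  | cons p l ih => exact ih _ _

/-- Truncated subtraction by means of `subPairs`. -/
def natSub (m n : ℕ) : Bool × ℕ := subPairs (zipD false false m.bits n.bits) false

theorem natSub_fst (m n : ℕ) : (natSub m n).1 = decide (m < n) := by
  have h := subPairs_spec (zipD false false m.bits n.bits) false
  have h3 := ofBits_lt ((zipD false false m.bits n.bits).map Prod.fst)
  rw [List.length_map] at h3
  rw [ofBits_zipD_fst, ofBits_bits] at h3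
  rw [ofBits_zipD_fst, ofBits_zipD_snd, ofBits_bits, ofBits_bits] at h
  change _ + _ * (natSub m n).1.toNat = _ + _ + (natSub m n).2 ∧ (natSub m n).2 < _ at h
  cases hb : (natSub m n).1
  · simp [hb] at h; simp; omega
  · simp [hb] at h; simp; omega

theorem natSub_snd (m n : ℕ) (hmn : n ≤ m) : (natSub m n).2 = m - n := by
  have h := subPairs_spec (zipD false false m.bits n.bits) false
  rw [ofBits_zipD_fst, ofBits_zipD_snd, ofBits_bits, ofBits_bits] at h
  change _ + _ * (natSub m n).1.toNat = _ + _ + (natSub m n).2 ∧ (natSub m n).2 < _ at h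
  have hb : (natSub m n).1 = false := by rw [natSub_fst]; simp [hmn]
  simp [hb] at h; omega

theorem PT.natSub {f g : γ → ℕ} (hf : PT f) (hg : PT g) :
    PT fun c => Holant.natSub (f c) (g c) := by
  have h1 : PT fun c => Holant.zipD false false (f c).bits (g c).bits := by fun_prop
  have h := PT.foldl_of_le (init := fun c => (false, ([] : List Bool)))
    (step := fun (_ : γ) (s : Bool × List Bool) (p : Bool × Bool) =>
      (!p.1 && p.2 || !p.1 && s.1 || p.2 && s.1, (p.1 ^^ p.2 ^^ s.1) :: s.2))
    h1 (by fun_prop) (by fun_prop) (F := fun t => 7)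
    (.const 7) (fun c s a => by
      obtain ⟨s1, s2⟩ := s
      have h1 := size_bool_le (!a.1 && a.2 || !a.1 && s1 || a.2 && s1)
      have h2 := size_bool_le (a.1 ^^ a.2 ^^ s1)
      simp only [size_prod, size_cons]; omega)
  have h2 : PT fun s : Bool × List Bool => (s.1, s.2.foldl (fun n b => Nat.bit b n) 0) :=
    (PT.fst PT.id').prodMk (PT.foldl_of_le (init := fun _ => 0) (step := fun _ n b => Nat.bit b n)
      (by fun_prop) (by fun_prop) (by fun_prop)
      (F := fun _ => 4) (.const 4) fun _ n b => size_natBit_le b n)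
  refine (h2.comp h).congr_enc fun c => congrArg enc ?_
  exact subPairs_eq_foldl _ _ _

@[fun_prop]
theorem PT.decideLt {f g : γ → ℕ} (hf : PT f) (hg : PT g) : PT fun c => decide (f c < g c) :=
  (hf.natSub hg).fst.congr_enc fun c => by rw [natSub_fst]

@[fun_prop]
theorem PT.sub {f g : γ → ℕ} (hf : PT f) (hg : PT g) : PT fun c => f c - g c := by
  have h2 := hf.natSub hg
  have h : PT fun c => bif decide (f c < g c) then 0 else (Holant.natSub (f c) (g c)).2 := by
    fun_prop
  refine h.congr_enc fun c => congrArg enc ?_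
  by_cases h : f c < g c
  · simp [h]; omega
  · simp [h, natSub_snd _ _ (not_lt.1 h)]

/-! ### Decidable equality -/

/-- Equality on the type can be decided in polynomial time. -/
class PTEq (α : Type) [Enc α] [DecidableEq α] : Prop where
  out : PT fun p : α × α => decide (p.1 = p.2)

@[fun_prop]
theorem PT.decideEq [DecidableEq α] [PTEq α] {f g : γ → α} (hf : PT f) (hg : PT g) :
    PT fun c => decide (f c = g c) := PTEq.out.comp (hf.prodMk hg)

instance : PTEq Bool :=
  ⟨(show PT fun p : Bool × Bool => !(p.1 ^^ p.2) by fun_prop).congr_enc fun p => by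
    obtain ⟨a, b⟩ := p; cases a <;> cases b <;> rfl⟩

omit [Enc α] in
theorem foldl_eqTest [DecidableEq α] (l l' : List α) (ok : Bool) :
    (fun s : Bool × List α => s.1 && s.2.isEmpty) (l.foldl (fun s a => match s.2 with
      | [] => (false, [])
      | b :: bs => (s.1 && decide (a = b), bs)) (ok, l')) = (ok && decide (l = l')) := by
  induction l generalizing l' ok with
  | nil => cases l' <;> simp
  | cons a l ih =>
    cases l' with
    | nil =>
      have := ih [] false
      simpa using this
    | cons b l' =>
      have := ih l' (ok && decide (a = b))
      simpa [Bool.and_assoc] using this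

instance [DecidableEq α] [PTEq α] : PTEq (List α) := by
  constructor
  have h := PT.foldl_of_le (γ := List α × List α) (init := fun c => (true, c.2))
    (step := fun _ (s : Bool × List α) a => match s.2 with
      | [] => (false, [])
      | b :: bs => (s.1 && decide (a = b), bs)) (l := fun c => c.1) (by fun_prop) (by fun_prop)
    (PT.listCases (l := fun t : (List α × List α) × (Bool × List α) × α => t.2.1.2)
      (f := fun _ => (false, []))
      (g := fun (t : (List α × List α) × (Bool × List α) × α) b bs =>
        (t.2.1.1 && decide (t.2.2 = b), bs)) (by fun_prop)
      (by fun_prop) (by fun_prop)) (F := fun _ => 3) (.const 3) (by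
      rintro c ⟨ok, l⟩ a
      cases l with
      | nil => have := size_bool_le false; simp; omega
      | cons b l => have := size_bool_le (ok && decide (a = b)); simp; omega)
  have h2 : PT fun s : Bool × List α => s.1 && s.2.isEmpty := by fun_prop
  refine (h2.comp h).congr_enc fun c => congrArg enc ?_
  exact (foldl_eqTest _ _ _).trans (Bool.true_and _)

instance : PTEq ℕ :=
  ⟨(show PT fun p : ℕ × ℕ => decide (p.1.bits = p.2.bits) by fun_prop).congr_enc fun p => by
    congr 2
    exact propext ⟨fun h => by rw [← ofBits_bits p.1, h, ofBits_bits], fun h => by rw [h]⟩⟩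

instance [DecidableEq α] [PTEq α] [DecidableEq β] [PTEq β] : PTEq (α × β) :=
  ⟨(show PT fun p : (α × β) × (α × β) => decide (p.1.1 = p.2.1) && decide (p.1.2 = p.2.2) by
    fun_prop).congr_enc fun p => by
    rw [← Bool.decide_and]
    congr 2
    exact propext Prod.ext_iff.symm⟩

/-- The value at a key in an association list, the first entry being the valid one. -/
def assoc [DecidableEq α] (l : List (α × β)) (k : α) : Option β :=
  l.foldr (fun p o => if p.1 = k then some p.2 else o) none

theorem PT.assoc [DecidableEq α] [PTEq α] {l : γ → List (α × β)} {k : γ → α} (hl : PT l)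
    (hk : PT k) : PT fun c => Holant.assoc (l c) (k c) :=
  PT.foldr_of_le (step := fun c p o => if p.1 = k c then Option.some p.2 else o) hl (PT.const none)
    (PT.ite (p := fun t : γ × (α × β) × Option β => t.2.1.1 = k t.1)
      (PT.decideEq (by fun_prop) (hk.comp (by fun_prop))) (by fun_prop) (by fun_prop))
    (F := fun t => size t.2 + 2) (PT.snd'.bdd_size.add (.const 2)) (by
      rintro c ⟨a, b⟩ o
      simp only
      split_ifs <;> simp <;> omega)

end

/-! ### Polynomials with natural coefficients -/

/-- A type `R` of polynomials with natural coefficients, in some number of variables and without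
normalization. The norm of a polynomial is the sum of its coefficients; it is additive and
multiplicative, and so controls the size of the coefficients of sums and products. `Fits n a`
says that in each variable `a` has at most `n` coefficients. -/
class NAr (R : Type) [Enc R] where
  add : R → R → R
  mul : R → R → R
  zero : R
  norm : R → ℕ
  Fits : ℕ → R → Prop
  norm_add : ∀ a b, norm (add a b) = norm a + norm b
  norm_mul : ∀ a b, norm (mul a b) = norm a * norm b
  norm_zero : norm zero = 0
  fits_add : ∀ n a b, Fits n a → Fits n b → Fits n (add a b)
  fits_mul : ∀ m n a b, Fits m a → Fits n b → Fits (m + n) (mul a b)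
  fits_zero : ∀ n, Fits n zero
  fits_mono : ∀ m n a, m ≤ n → Fits m a → Fits n a
  fits_size : ∀ a, Fits (size a) a
  natSize_norm_le : ∀ a, Nat.size (norm a) ≤ size a
  size_le : ∃ q : Polynomial ℕ, ∀ n a, Fits n a → size a ≤ q.eval (n + Nat.size (norm a))
  pt_add : PT fun p : R × R => add p.1 p.2
  pt_mul : PT fun p : R × R => mul p.1 p.2

open NAr

instance : NAr ℕ where
  add := (· + ·)
  mul := (· * ·)
  zero := 0
  norm := id
  Fits _ _ := True
  norm_add _ _ := rfl
  norm_mul _ _ := rfl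
  norm_zero := rfl
  fits_add _ _ _ _ _ := trivial
  fits_mul _ _ _ _ _ _ := trivial
  fits_zero _ := trivial
  fits_mono _ _ _ _ _ := trivial
  fits_size _ := trivial
  natSize_norm_le := natSize_le_size
  size_le := ⟨Polynomial.C 4 * Polynomial.X + 1, fun n a _ => by
    have := size_le_natSize a
    simp; omega⟩
  pt_add := by fun_prop
  pt_mul := by fun_prop

section
variable {R γ : Type} [Enc R] [NAr R] [Enc γ]

@[fun_prop]
theorem PT.nadd {f g : γ → R} (hf : PT f) (hg : PT g) : PT fun c => NAr.add (f c) (g c) :=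
  NAr.pt_add.comp (hf.prodMk hg)

@[fun_prop]
theorem PT.nmul {f g : γ → R} (hf : PT f) (hg : PT g) : PT fun c => NAr.mul (f c) (g c) :=
  NAr.pt_mul.comp (hf.prodMk hg)

/-- The value of a polynomial at `x`, when its coefficients have the values given by `v`. -/
def pval {S : Type*} [CommSemiring S] (v : R → S) (x : S) (l : List R) : S :=
  l.foldr (fun a s => v a + x * s) 0

/-- Addition of polynomials. -/
def polyAdd (l l' : List R) : List R := zipOp add zero l l'

/-- Multiplication of polynomials. -/
def polyMul (l l' : List R) : List R :=
  l.foldr (fun a acc => polyAdd (l'.map (mul a)) (zero :: acc)) []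

/-- A homomorphism to a commutative semiring. -/
structure IsVal {S : Type*} [CommSemiring S] (v : R → S) : Prop where
  map_add : ∀ a b, v (add a b) = v a + v b
  map_mul : ∀ a b, v (mul a b) = v a * v b
  map_zero : v zero = 0

section
variable {S : Type*} [CommSemiring S] {v : R → S} (x : S)

theorem IsVal.pval_polyAdd (hv : IsVal v) (l l' : List R) :
    pval v x (polyAdd l l') = pval v x l + pval v x l' := by
  induction l generalizing l' with
  | nil =>
    induction l' with
    | nil => simp [polyAdd, zipOp, zipD, pval]
    | cons b l' ih =>
      simp only [polyAdd, zipOp, zipD, List.map_cons, List.map_map, pval, List.foldr_cons,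
        List.foldr_nil, hv.map_add, hv.map_zero, zero_add] at ih ⊢
      rw [ih]
  | cons a l ih =>
    cases l' with
    | nil =>
      have := ih []
      simp only [polyAdd, zipOp, zipD, List.map_cons, pval, List.foldr_cons,
        List.foldr_nil, hv.map_add, hv.map_zero, add_zero] at this ⊢
      rw [this]
    | cons b l' =>
      have := ih l'
      simp only [polyAdd, zipOp, zipD, List.map_cons, pval, List.foldr_cons,
        hv.map_add] at this ⊢
      rw [this]; ring

theorem IsVal.pval_map_mul (hv : IsVal v) (a : R) (l : List R) :
    pval v x (l.map (mul a)) = v a * pval v x l := by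
  induction l with
  | nil => simp [pval]
  | cons b l ih =>
    simp only [pval, List.map_cons, List.foldr_cons, hv.map_mul] at ih ⊢
    rw [ih]; ring

theorem IsVal.pval_polyMul (hv : IsVal v) (l l' : List R) :
    pval v x (polyMul l l') = pval v x l * pval v x l' := by
  induction l with
  | nil => simp [polyMul, pval]
  | cons a l ih =>
    rw [polyMul, List.foldr_cons, hv.pval_polyAdd, hv.pval_map_mul, ← polyMul]
    have : ∀ l'' : List R, pval v x (zero :: l'') = x * pval v x l'' := fun l'' => by
      simp [pval, hv.map_zero]
    rw [this, ih]
    simp [pval]; ring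

end

theorem isVal_norm : IsVal (norm : R → ℕ) := ⟨norm_add, norm_mul, norm_zero⟩

theorem length_zipD {α β : Type} (d : α) (e : β) (l : List α) (l' : List β) :
    (zipD d e l l').length = max l.length l'.length := by
  induction l generalizing l' with
  | nil => simp [zipD]
  | cons a l ih => cases l' <;> simp [zipD, ih]

theorem mem_zipD {α β : Type} {d : α} {e : β} {l : List α} {l' : List β} {p : α × β}
    (h : p ∈ zipD d e l l') : (p.1 ∈ l ∨ p.1 = d) ∧ (p.2 ∈ l' ∨ p.2 = e) := by
  induction l generalizing l' with
  | nil =>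
    obtain ⟨b, hb, rfl⟩ := List.mem_map.1 h
    simp [hb]
  | cons a l ih =>
    cases l' with
    | nil =>
      rcases List.mem_cons.1 h with rfl | h
      · simp
      · have := ih h
        simp at this ⊢; tauto
    | cons b l' =>
      rcases List.mem_cons.1 h with rfl | h
      · simp
      · have := ih h
        simp at this ⊢; tauto

/-- The predicate `Fits` for polynomials in one more variable. -/
def ListFits (n : ℕ) (l : List R) : Prop := l.length ≤ n ∧ ∀ a ∈ l, Fits n a

theorem ListFits.mono {m n : ℕ} {l : List R} (hmn : m ≤ n) (h : ListFits m l) : ListFits n l :=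
  ⟨h.1.trans hmn, fun a ha => fits_mono _ _ _ hmn (h.2 a ha)⟩

theorem ListFits.polyAdd {n : ℕ} {l l' : List R} (h : ListFits n l) (h' : ListFits n l') :
    ListFits n (polyAdd l l') := by
  constructor
  · simp only [Holant.polyAdd, zipOp, List.length_map, length_zipD]
    exact max_le h.1 h'.1
  · intro a ha
    obtain ⟨p, hp, rfl⟩ := List.mem_map.1 ha
    have := mem_zipD hp
    refine fits_add _ _ _ ?_ ?_
    · rcases this.1 with h1 | h1
      · exact h.2 _ h1
      · rw [h1]; exact fits_zero _
    · rcases this.2 with h1 | h1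
      · exact h'.2 _ h1
      · rw [h1]; exact fits_zero _

theorem ListFits.map_mul {m n : ℕ} {a : R} {l : List R} (h : Fits m a) (h' : ListFits n l) :
    ListFits (m + n) (l.map (mul a)) :=
  ⟨by simp; have := h'.1; omega, fun b hb => by
    obtain ⟨c, hc, rfl⟩ := List.mem_map.1 hb
    exact fits_mul _ _ _ _ h (h'.2 c hc)⟩

theorem ListFits.polyMul {m n : ℕ} {l l' : List R} (h : ListFits m l) (h' : ListFits n l') :
    ListFits (m + n) (polyMul l l') := by
  have key : ∀ l : List R, (∀ a ∈ l, Fits m a) →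
      (Holant.polyMul l l').length ≤ l.length + n ∧ ∀ a ∈ Holant.polyMul l l', Fits (m + n) a := by
    intro l
    induction l with
    | nil => intro _; simp [Holant.polyMul]
    | cons a l ih =>
      intro hl
      obtain ⟨h1, h2⟩ := ih fun b hb => hl b (List.mem_cons_of_mem _ hb)
      rw [Holant.polyMul, List.foldr_cons, ← Holant.polyMul]
      have h3 := ListFits.map_mul (hl a List.mem_cons_self) h'
      have h4 := h'.1
      constructor
      · simp only [Holant.polyAdd, zipOp, List.length_map, length_zipD, List.length_cons]
        omega
      · intro b hb
        obtain ⟨p, hp, rfl⟩ := List.mem_map.1 hb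
        have := mem_zipD hp
        refine fits_add _ _ _ ?_ ?_
        · rcases this.1 with h1 | h1
          · exact h3.2 _ h1
          · rw [h1]; exact fits_zero _
        · rcases this.2 with h1 | h1
          · rcases List.mem_cons.1 h1 with h1 | h1
            · rw [h1]; exact fits_zero _
            · exact h2 _ h1
          · rw [h1]; exact fits_zero _
  obtain ⟨h1, h2⟩ := key l h.2
  have := h.1
  exact ⟨by omega, h2⟩

theorem ListFits.size (l : List R) : ListFits (size l) l :=
  ⟨length_le_size l, fun a ha => fits_mono _ _ _ (size_le_of_mem ha) (fits_size a)⟩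

/-- The norm of a polynomial in one more variable. -/
def listNorm (l : List R) : ℕ := pval norm 1 l

@[simp] theorem listNorm_nil : listNorm ([] : List R) = 0 := rfl

@[simp] theorem listNorm_cons (a : R) (l : List R) : listNorm (a :: l) = norm a + listNorm l := by
  simp [listNorm, pval]

theorem listNorm_polyAdd (l l' : List R) : listNorm (polyAdd l l') = listNorm l + listNorm l' :=
  isVal_norm.pval_polyAdd 1 l l'

theorem listNorm_polyMul (l l' : List R) : listNorm (polyMul l l') = listNorm l * listNorm l' :=
  isVal_norm.pval_polyMul 1 l l'

theorem listNorm_append (l l' : List R) : listNorm (l ++ l') = listNorm l + listNorm l' := by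
  induction l with
  | nil => simp
  | cons a l ih => simp [ih, add_assoc]

theorem norm_le_listNorm {a : R} {l : List R} (h : a ∈ l) : norm a ≤ listNorm l := by
  induction l with
  | nil => simp at h
  | cons b l ih =>
    rcases List.mem_cons.1 h with rfl | h
    · simp
    · have := ih h
      simp; omega

theorem natSize_add_le (m n : ℕ) : Nat.size (m + n) ≤ Nat.size m + Nat.size n + 1 := by
  rw [Nat.size_le, pow_succ, pow_add]
  have h1 := Nat.lt_size_self m
  have h2 := Nat.lt_size_self n
  have h3 : 1 ≤ 2 ^ Nat.size m := Nat.one_le_two_pow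
  have h4 : 1 ≤ 2 ^ Nat.size n := Nat.one_le_two_pow
  nlinarith

/-- The norm of a polynomial is not longer, in binary, than the code of the polynomial. -/
theorem natSize_listNorm_le (l : List R) : Nat.size (listNorm l) ≤ size l := by
  induction l with
  | nil => simp
  | cons a l ih =>
    have := natSize_add_le (norm a) (listNorm l)
    have := natSize_norm_le a
    simp; omega

variable (R) in
theorem exists_size_list_le : ∃ q : Polynomial ℕ, ∀ n (l : List R), ListFits n l →
    size l ≤ q.eval (n + Nat.size (listNorm l)) := by
  obtain ⟨q, hq⟩ := size_le (R := R)
  refine ⟨Polynomial.X * (q + 1) + 1, fun n l h => ?_⟩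
  have h1 : ∀ a ∈ l, size a ≤ q.eval (n + Nat.size (listNorm l)) := fun a ha =>
    (hq n a (h.2 a ha)).trans (eval_mono q (by
      have := natSize_mono (norm_le_listNorm ha)
      omega))
  refine (size_le_of_forall_mem h1).trans ?_
  simp only [Polynomial.eval_add, Polynomial.eval_mul, Polynomial.eval_X, Polynomial.eval_one]
  gcongr
  exact h.1.trans (Nat.le_add_right _ _)

@[fun_prop]
theorem PT.polyAdd {f g : γ → List R} (hf : PT f) (hg : PT g) :
    PT fun c => Holant.polyAdd (f c) (g c) := PT.zipOp NAr.pt_add hf hg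

@[fun_prop]
theorem PT.polyMul {f g : γ → List R} (hf : PT f) (hg : PT g) :
    PT fun c => Holant.polyMul (f c) (g c) := by
  obtain ⟨q, hq⟩ := exists_size_list_le R
  refine PT.foldr (step := fun c a acc => Holant.polyAdd ((g c).map (NAr.mul a)) (zero :: acc))
    (init := fun _ => [])
    (PT.polyAdd (PT.map (f := fun (t : γ × R × List R) b => NAr.mul t.2.1 b)
      (hg.comp (by fun_prop)) (by fun_prop)) (by fun_prop)) (by fun_prop) hf.reverse
    (F := fun c => q.eval (2 * (size (f c) + size (g c))))
    (((Bdd.const 2).mul (hf.bdd_size.add hg.bdd_size)).eval q) fun c l₁ l₂ e => ?_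
  have h1 := hq _ _ ((ListFits.size l₂).polyMul (ListFits.size (g c)))
  refine h1.trans (eval_mono q ?_)
  have h2 := natSize_mul_le (listNorm l₂) (listNorm (g c))
  have h3 := natSize_listNorm_le l₂
  have h4 := natSize_listNorm_le (g c)
  have h5 := size_append l₁ l₂
  have h6 := size_pos l₁
  rw [listNorm_polyMul, e]
  omega

instance : NAr (List R) where
  add := polyAdd
  mul := polyMul
  zero := []
  norm := listNorm
  Fits := ListFits
  norm_add := listNorm_polyAdd
  norm_mul := listNorm_polyMul
  norm_zero := rfl
  fits_add _ _ _ h h' := h.polyAdd h'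
  fits_mul _ _ _ _ h h' := h.polyMul h'
  fits_zero _ := ⟨by simp, by simp⟩
  fits_mono _ _ _ h h' := h'.mono h
  fits_size := ListFits.size
  natSize_norm_le := natSize_listNorm_le
  size_le := exists_size_list_le R
  pt_add := by fun_prop
  pt_mul := by fun_prop

theorem IsVal.poly {S : Type*} [CommSemiring S] {v : R → S} (hv : IsVal v) (x : S) :
    IsVal (pval v x) :=
  ⟨hv.pval_polyAdd x, hv.pval_polyMul x, rfl⟩

/-! ### Reduction modulo a monic polynomial -/

/-- One step of Horner's rule modulo `X ^ d - ∑ i < d, mᵢ X ^ i`: the remainder of `a + X * l`. -/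
def redStep (m : List R) (a : R) (l : List R) : List R :=
  polyAdd (a :: l.dropLast) (m.map (mul (l.reverse.headD zero)))

/-- The remainder of a polynomial modulo `X ^ d - ∑ i < d, mᵢ X ^ i`. -/
def red (m l : List R) : List R := l.foldr (redStep m) (m.map fun _ => zero)

theorem length_redStep (m : List R) (a : R) (l : List R) :
    (redStep m a l).length = max (l.length - 1 + 1) m.length := by
  simp [redStep, polyAdd, zipOp, length_zipD]

theorem length_red {m : List R} (hm : m ≠ []) (l : List R) : (red m l).length = m.length := by
  have h0 := List.length_pos_of_ne_nil hm
  induction l with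
  | nil => simp [red]
  | cons a l ih =>
    rw [red, List.foldr_cons, ← red, length_redStep, ih]
    omega

omit [Enc R] [NAr R] in
theorem pval_append {S : Type*} [CommSemiring S] (v : R → S) (x : S) (l l' : List R) :
    pval v x (l ++ l') = pval v x l + x ^ l.length * pval v x l' := by
  induction l with
  | nil => simp [pval]
  | cons a l ih =>
    simp only [pval, List.cons_append, List.foldr_cons, List.length_cons] at ih ⊢
    rw [ih]; ring

theorem pval_map_zero {S : Type*} [CommSemiring S] {v : R → S} (hv : IsVal v) (x : S)
    {α : Type} (l : List α) : pval v x (l.map fun _ => zero) = 0 := by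
  induction l with
  | nil => rfl
  | cons a l ih =>
    simp only [pval, List.map_cons, List.foldr_cons] at ih ⊢
    rw [ih, hv.map_zero]; simp

/-- The remainder has the same value at a root of the modulus. -/
theorem pval_red {S : Type*} [CommSemiring S] {v : R → S} (hv : IsVal v) {x : S} {m : List R}
    (hm : m ≠ []) (hx : x ^ m.length = pval v x m) (l : List R) :
    pval v x (red m l) = pval v x l := by
  induction l with
  | nil => exact pval_map_zero hv x m
  | cons a l ih =>
    have hl : red m l ≠ [] := fun h => hm (by
      have := length_red hm l
      rw [h] at this
      exact List.length_eq_zero_iff.1 this.symm)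
    rw [red, List.foldr_cons, ← red, redStep, hv.pval_polyAdd, hv.pval_map_mul, ← hx,
      ← length_red hm l]
    have h2 : pval v x (a :: l) = v a + x * pval v x l := rfl
    rw [h2, ← ih]
    generalize red m l = r at hl
    obtain ⟨r, b, rfl⟩ := List.eq_nil_or_concat r |>.resolve_left hl
    have h3 : ∀ l', pval v x (a :: l') = v a + x * pval v x l' := fun _ => rfl
    simp only [List.concat_eq_append, List.dropLast_concat, h3, pval_append, List.reverse_append,
      List.reverse_cons, List.reverse_nil, List.nil_append, List.cons_append, List.headD_cons,
      List.length_append, List.length_cons, List.length_nil, zero_add]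
    simp [pval]; ring

theorem listNorm_map_mul (a : R) (l : List R) : listNorm (l.map (mul a)) = norm a * listNorm l :=
  isVal_norm.pval_map_mul 1 a l

/-- A step of Horner's rule multiplies the norm at most by a constant that depends on the modulus,
so that the norm of the remainder grows only exponentially in the number of steps. -/
theorem listNorm_redStep_le (m : List R) (a : R) (l : List R) :
    listNorm (redStep m a l) ≤ norm a + listNorm l * (1 + listNorm m) := by
  rw [redStep, listNorm_polyAdd, listNorm_map_mul, listNorm_cons]
  have h1 : listNorm l.dropLast + norm (l.reverse.headD zero) = listNorm l := by
    rcases List.eq_nil_or_concat l with rfl | ⟨l, b, rfl⟩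
    · simp [NAr.norm_zero]
    · simp [listNorm_append]
  rw [← h1]
  nlinarith [Nat.zero_le (listNorm l.dropLast * listNorm m)]

theorem listNorm_red_le (m l : List R) :
    listNorm (red m l) ≤ listNorm l * (1 + listNorm m) ^ l.length := by
  induction l with
  | nil =>
    have : listNorm (m.map fun _ => (zero : R)) = 0 := pval_map_zero isVal_norm 1 m
    exact (le_of_eq this).trans (Nat.zero_le _)
  | cons a l ih =>
    rw [red, List.foldr_cons, ← red]
    refine (listNorm_redStep_le m a _).trans ?_
    rw [listNorm_cons, add_mul, List.length_cons]
    refine add_le_add (Nat.le_mul_of_pos_right _ (by positivity)) ?_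
    calc _ ≤ listNorm l * (1 + listNorm m) ^ l.length * (1 + listNorm m) := by gcongr
      _ = _ := by ring

theorem listFits_redStep {n k : ℕ} {m : List R} {a : R} {l : List R} (hm : ListFits n m)
    (ha : Fits n a) (hn : 1 ≤ n) (hl : ListFits k l) : ListFits (k + n) (redStep m a l) := by
  have h1 := hl.1
  refine ListFits.polyAdd ⟨?_, fun b hb => ?_⟩ (ListFits.map_mul ?_ hm)
  · simp; omega
  · rcases List.mem_cons.1 hb with rfl | hb
    · exact fits_mono _ _ _ (by omega) ha
    · exact fits_mono _ _ _ (by omega) (hl.2 b (List.mem_of_mem_dropLast hb))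
  · rcases List.eq_nil_or_concat l with rfl | ⟨l, b, rfl⟩
    · exact fits_zero _
    · simpa using hl.2 b (by simp)

theorem listFits_red {n : ℕ} {m l : List R} (hm : ListFits n m) (hl : ∀ a ∈ l, Fits n a)
    (hn : 1 ≤ n) : ListFits ((l.length + 1) * n) (red m l) := by
  induction l with
  | nil =>
    refine ⟨by simpa [red] using hm.1, fun a ha => ?_⟩
    obtain ⟨b, _, rfl⟩ := List.mem_map.1 ha
    exact fits_zero _
  | cons a l ih =>
    rw [red, List.foldr_cons, ← red, List.length_cons, add_mul _ 1, one_mul]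
    exact listFits_redStep hm (hl a List.mem_cons_self) hn
      (ih fun b hb => hl b (List.mem_cons_of_mem _ hb))

theorem natSize_pow_le (m n : ℕ) : Nat.size (m ^ n) ≤ n * Nat.size m + 1 := by
  rw [Nat.size_le, pow_succ, mul_comm n, pow_mul]
  have h1 : m ^ n ≤ (2 ^ Nat.size m) ^ n := Nat.pow_le_pow_left (Nat.lt_size_self m).le n
  have h2 : 0 < (2 ^ Nat.size m) ^ n := by positivity
  omega

@[fun_prop]
theorem PT.dropLast {α : Type} [Enc α] {f : γ → List α} (hf : PT f) :
    PT fun c => (f c).dropLast := by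
  have h : PT fun c => (f c).reverse.tail.reverse := by fun_prop
  simpa [List.tail_reverse] using h

@[fun_prop]
theorem PT.red {f g : γ → List R} (hf : PT f) (hg : PT g) : PT fun c => Holant.red (f c) (g c) := by
  obtain ⟨q, hq⟩ := exists_size_list_le R
  refine PT.foldr (step := fun c a acc => redStep (f c) a acc)
    (init := fun c => (f c).map fun _ => zero)
    (PT.polyAdd (by fun_prop) (PT.map (f := fun (t : γ × R × List R) b =>
      NAr.mul (t.2.2.reverse.headD zero) b) (hf.comp (by fun_prop)) (by fun_prop)))
    (PT.map (f := fun _ _ => zero) hf (by fun_prop)) hg.reverse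
    (F := fun c => q.eval ((size (g c) + 1) * (size (f c) + size (g c)) +
      (size (g c) + (size (g c) * (size (f c) + 2) + 1))))
    (Bdd.eval q (((hg.bdd_size.add (.const 1)).mul (hf.bdd_size.add hg.bdd_size)).add
      (hg.bdd_size.add ((hg.bdd_size.mul (hf.bdd_size.add (.const 2))).add (.const 1)))))
    fun c l₁ l₂ e => ?_
  have h5 := size_append l₁ l₂
  have h6 := size_pos l₁
  have h7 := size_pos l₂
  have h1 := hq _ _ (listFits_red (n := size (f c) + size (g c)) (l := l₂)
    ((ListFits.size (f c)).mono (by omega)) (fun a ha => fits_mono _ _ _ (by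
      have := size_le_of_mem (l := g c) (a := a) (by rw [e]; simp [ha])
      omega) (fits_size a)) (by rw [e]; omega))
  refine h1.trans (eval_mono q ?_)
  have h2 := natSize_mono (listNorm_red_le (f c) l₂)
  have h3 := natSize_mul_le (listNorm l₂) ((1 + listNorm (f c)) ^ l₂.length)
  have h4 := natSize_pow_le (1 + listNorm (f c)) l₂.length
  have h8 := natSize_add_le 1 (listNorm (f c))
  have h9 := natSize_listNorm_le l₂
  have h10 := natSize_listNorm_le (f c)
  have h11 := length_le_size l₂
  have h12 : l₂.length ≤ size (g c) := by rw [e]; omega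
  have h13 : Nat.size 1 = 1 := by simp
  have h14 : l₂.length * Nat.size (1 + listNorm (f c)) ≤ size (g c) * (size (f c) + 2) :=
    Nat.mul_le_mul h12 (by omega)
  have h15 : (l₂.length + 1) * (size (f c) + size (g c)) ≤
      (size (g c) + 1) * (size (f c) + size (g c)) := Nat.mul_le_mul (by omega) le_rfl
  have h16 : size l₂ ≤ size (g c) := by rw [e]; omega
  omega

end

/-! ### Linear algebra over the field with two elements -/

/-- Addition of vectors over `ℤ/2`, of any lengths. -/
def vadd (u v : List Bool) : List Bool := zipOp (fun a b => a ^^ b) false u v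

/-- The scalar product of vectors over `ℤ/2`. -/
def dot (u v : List Bool) : Bool :=
  (zipD false false u v).foldr (fun p s => (p.1 && p.2) ^^ s) false

/-- The unit vectors of the space whose coordinates are the positions of a list. -/
def units {β : Type} (l : List β) : List (List Bool) :=
  l.foldr (fun _ acc => [true] :: acc.map fun v => false :: v) []

/-- Elimination: the entries of a list of vectors `b` come with the values `t` of a linear form.
The result consists of a vector with value `1` (the pivot), if there is one, and of a basis for
the vectors of value `0`. -/
def cutAux {V : Type} (op : V → V → V) (l : List (V × Bool)) : Option V × List V :=
  l.foldr (fun b s => bif b.2 then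
      (match s.1 with
        | none => (some b.1, s.2)
        | some q => (some q, op b.1 q :: s.2))
    else (s.1, b.1 :: s.2)) (none, [])

/-- The part of the affine space through `p` in the directions `l` on which an affine form has a
prescribed value. The entries of `l` come with the values of the linear part of the form, and
`flip` says that the value at `p` is the wrong one. -/
def cut {V : Type} (op : V → V → V) (p : V) (flip : Bool) (l : List (V × Bool)) :
    Option (V × List V) :=
  match (cutAux op l).1 with
  | none => bif flip then none else some (p, (cutAux op l).2)
  | some q => some (bif flip then op p q else p, (cutAux op l).2)

theorem length_vadd (u v : List Bool) : (vadd u v).length = max u.length v.length := by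
  simp [vadd, zipOp, length_zipD]

theorem length_units {β : Type} (l : List β) : (units l).length = l.length := by
  induction l with
  | nil => rfl
  | cons a l ih => simpa [units] using ih

theorem length_le_of_mem_units {β : Type} {l : List β} {v : List Bool} (h : v ∈ units l) :
    v.length ≤ l.length := by
  induction l generalizing v with
  | nil => simp [units] at h
  | cons a l ih =>
    rcases List.mem_cons.1 h with rfl | h
    · simp
    · obtain ⟨u, hu, rfl⟩ := List.mem_map.1 h
      simpa using ih hu

theorem length_cutAux_le {V : Type} (op : V → V → V) (l : List (V × Bool)) :
    (cutAux op l).2.length ≤ l.length := by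
  induction l with
  | nil => simp [cutAux]
  | cons b l ih =>
    obtain ⟨b, t⟩ := b
    simp only [cutAux, List.foldr_cons, List.length_cons] at ih ⊢
    generalize List.foldr _ _ l = s at ih ⊢
    obtain ⟨_ | q, s⟩ := s <;> cases t <;> simp at * <;> omega

/-- What holds for the entries of the list, and is preserved by addition, holds for the vectors
that elimination yields. -/
theorem cutAux_forall {V : Type} {op : V → V → V} {P : V → Prop}
    (hop : ∀ u v, P u → P v → P (op u v)) {l : List (V × Bool)} (h : ∀ b ∈ l, P b.1) :
    (∀ q ∈ (cutAux op l).1, P q) ∧ ∀ b ∈ (cutAux op l).2, P b := by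
  induction l with
  | nil => simp [cutAux]
  | cons b l ih =>
    have h1 := ih fun b hb => h b (List.mem_cons_of_mem _ hb)
    have h2 := h b List.mem_cons_self
    obtain ⟨b, t⟩ := b
    simp only [cutAux, List.foldr_cons] at h1 ⊢
    generalize List.foldr _ _ l = s at h1 ⊢
    obtain ⟨_ | q, s⟩ := s
    · cases t <;> simp at * <;> tauto
    · cases t
      · simp at *; tauto
      · simp at *
        exact ⟨h1.1, hop _ _ h2 h1.1, h1.2⟩

theorem cut_forall {V : Type} {op : V → V → V} {P : V → Prop}
    (hop : ∀ u v, P u → P v → P (op u v)) {p : V} {flip : Bool} {l : List (V × Bool)}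
    (hp : P p) (h : ∀ b ∈ l, P b.1) {s : V × List V} (hs : cut op p flip l = some s) :
    P s.1 ∧ (∀ b ∈ s.2, P b) ∧ s.2.length ≤ l.length := by
  obtain ⟨h1, h2⟩ := cutAux_forall hop h
  have h3 := length_cutAux_le op l
  unfold cut at hs
  cases hq : (cutAux op l).1 with
  | none =>
    rw [hq] at hs
    cases flip
    · simp at hs; subst hs; exact ⟨hp, h2, h3⟩
    · simp at hs
  | some q =>
    rw [hq] at hs h1
    simp at hs
    subst hs
    cases flip
    · exact ⟨hp, h2, h3⟩
    · exact ⟨hop _ _ hp (h1 q rfl), h2, h3⟩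

section
variable {γ V β : Type} [Enc γ] [Enc V] [Enc β]

@[fun_prop]
theorem PT.vadd {f g : γ → List Bool} (hf : PT f) (hg : PT g) : PT fun c => vadd (f c) (g c) :=
  PT.zipOp (by fun_prop) hf hg

@[fun_prop]
theorem PT.dot {f g : γ → List Bool} (hf : PT f) (hg : PT g) : PT fun c => dot (f c) (g c) :=
  PT.foldr_of_le (step := fun _ (p : Bool × Bool) s => (p.1 && p.2) ^^ s) (hf.zipD hg)
    (PT.const false) (by fun_prop) (F := fun _ => 3) (.const 3) fun _ p s =>
    (size_bool_le _).trans (Nat.le_add_left _ _)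

theorem size_vec_le (v : List Bool) : size v ≤ 4 * v.length + 1 := by
  rw [mul_comm]
  exact size_le_of_forall_mem fun b _ => size_bool_le b

theorem size_vecs_le {l : List (List Bool)} {n : ℕ} (h : ∀ v ∈ l, v.length ≤ n) :
    size l ≤ l.length * (4 * n + 2) + 1 :=
  size_le_of_forall_mem fun v hv => (size_vec_le v).trans (by have := h v hv; omega)

@[fun_prop]
theorem PT.units {f : γ → List β} (hf : PT f) : PT fun c => units (f c) := by
  refine PT.foldr (step := fun _ _ acc => [true] :: acc.map fun v => false :: v)
    (init := fun _ => []) (PT.cons (by fun_prop)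
      (PT.map (f := fun _ v => false :: v) (by fun_prop) (by fun_prop))) (by fun_prop) hf.reverse
    (F := fun c => size (f c) * (4 * size (f c) + 2) + 1)
    ((hf.bdd_size.mul (((Bdd.const 4).mul hf.bdd_size).add (.const 2))).add (.const 1)) ?_
  intro c l₁ l₂ e
  change size (Holant.units l₂) ≤ _
  have h1 : l₂.length ≤ size (f c) := by
    have := length_le_size (f c)
    rw [e] at this ⊢
    simp at this; omega
  refine (size_vecs_le (n := l₂.length) fun v hv => length_le_of_mem_units hv).trans ?_
  rw [length_units]
  gcongr

theorem PT.cutAux {op : V → V → V} (hop : PT fun p : V × V => op p.1 p.2)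
    {f : γ → List (V × Bool)} (hf : PT f) : PT fun c => cutAux op (f c) := by
  obtain ⟨q, hq⟩ := hop.bdd_size
  have hstep : PT fun t : γ × (V × Bool) × (Option V × List V) => bif t.2.1.2 then
      (match t.2.2.1 with
        | none => (Option.some t.2.1.1, t.2.2.2)
        | Option.some q => (Option.some q, op t.2.1.1 q :: t.2.2.2))
      else (t.2.2.1, t.2.1.1 :: t.2.2.2) := by
    refine PT.cond (by fun_prop) (PT.optionCases (by fun_prop) (by fun_prop)
      (g := fun (t : γ × (V × Bool) × (Option V × List V)) q =>
        (Option.some q, op t.2.1.1 q :: t.2.2.2)) ?_) (by fun_prop)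
    refine PT.prodMk (by fun_prop) (PT.cons ?_ (by fun_prop))
    exact hop.comp (f := fun t : (γ × (V × Bool) × (Option V × List V)) × V =>
      (t.1.2.1.1, t.2)) (by fun_prop)
  refine PT.foldr (init := fun _ => (none, [])) hstep (by fun_prop) hf.reverse
    (F := fun c => size (f c) + (size (f c) *
      (size (f c) + q.eval (2 * size (f c) + 1) + 1) + 1) + 3)
    (((hf.bdd_size.add ((hf.bdd_size.mul ((hf.bdd_size.add ((((Bdd.const 2).mul
      hf.bdd_size).add (.const 1)).eval q)).add (.const 1))).add (.const 1)))).add (.const 3)) ?_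
  intro c l₁ l₂ e
  change size (Holant.cutAux op l₂) ≤ _
  have hmem : ∀ b ∈ l₂, size b.1 ≤ size (f c) := fun b hb => by
    have := size_le_of_mem (l := f c) (a := b) (by rw [e]; simp [hb])
    have h2 : size b = size b.1 + size b.2 + 1 := rfl
    omega
  have key : ∀ l₃ : List (V × Bool), (∀ b ∈ l₃, size b.1 ≤ size (f c)) →
      (∀ b ∈ (Holant.cutAux op l₃).1, size b ≤ size (f c)) ∧
      ∀ b ∈ (Holant.cutAux op l₃).2, size b ≤ size (f c) + q.eval (2 * size (f c) + 1) := by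
    intro l₃
    induction l₃ with
    | nil => intro _; simp [Holant.cutAux]
    | cons b l₃ ih =>
      intro h
      have h1 := ih fun b hb => h b (List.mem_cons_of_mem _ hb)
      have h2 := h b List.mem_cons_self
      obtain ⟨b, t⟩ := b
      simp only [Holant.cutAux, List.foldr_cons] at h1 ⊢
      generalize List.foldr _ _ l₃ = s at h1 ⊢
      obtain ⟨_ | p, s⟩ := s
      · cases t
        · simp at *
          exact ⟨by omega, h1⟩
        · simp at *
          exact ⟨h2, h1⟩
      · cases t
        · simp at *
          exact ⟨h1.1, by omega, h1.2⟩
        · have h3 := hq (b, p)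
          simp only [cond_true, Option.mem_def, Option.some.injEq, forall_eq', List.mem_cons,
            forall_eq_or_imp, size_prod] at *
          refine ⟨h1.1, h3.trans ((eval_mono q ?_).trans (Nat.le_add_left _ _)), h1.2⟩
          omega
  obtain ⟨h1, h2⟩ := key l₂ hmem
  have h3 := length_cutAux_le op l₂
  have h4 : l₂.length ≤ size (f c) := by
    have := length_le_size (f c)
    rw [e] at this ⊢
    simp at this; omega
  have h5 := size_le_of_forall_mem h2
  generalize Holant.cutAux op l₂ = s at *
  have h6 : s.2.length * (size (f c) + q.eval (2 * size (f c) + 1) + 1) ≤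
    size (f c) * (size (f c) + q.eval (2 * size (f c) + 1) + 1) := by gcongr; omega
  obtain ⟨_ | p, s⟩ := s
  · simp only [size_prod, size_none] at *; omega
  · have := h1 p rfl
    simp only [size_prod, size_some] at *; omega

theorem PT.cut {op : V → V → V} (hop : PT fun p : V × V => op p.1 p.2)
    {p : γ → V} {b : γ → Bool} {f : γ → List (V × Bool)} (hp : PT p) (hb : PT b) (hf : PT f) :
    PT fun c => cut op (p c) (b c) (f c) := by
  have h1 := PT.cutAux hop hf
  refine PT.optionCases (o := fun c => (Holant.cutAux op (f c)).1)
    (f := fun c => bif b c then none else Option.some (p c, (Holant.cutAux op (f c)).2))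
    (g := fun c q => Option.some (bif b c then op (p c) q else p c, (Holant.cutAux op (f c)).2))
    h1.fst (by fun_prop) ?_
  have h2 : PT fun t : γ × V => op (p t.1) t.2 :=
    hop.comp (f := fun t : γ × V => (p t.1, t.2)) (by fun_prop)
  have h3 : PT fun t : γ × V => (Holant.cutAux op (f t.1)).2 :=
    h1.snd.comp (f := fun t : γ × V => t.1) (by fun_prop)
  fun_prop

end

/-! ### The algorithm -/

/-- Coordinates in `ℤ[α]`: signs (`true` for negative numbers) and absolute values. -/
abbrev Cyc : Type := List (Bool × ℕ)

/-- A row of the table of a vertex: an input, and the coordinates and denominator of the value. -/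
abbrev Row : Type := List Bool × (List Cyc × ℕ)

/-- A vertex: the labels of its edges, and its table. -/
abbrev Vtx : Type := List ℕ × List Row

/-- The data of a signature grid: the modulus and the vertices. -/
abbrev Data : Type := List Cyc × List Vtx

/-- Polynomials in `θ` whose coefficients are polynomials in `α` with natural coefficients. Since
`-1 = α ^ 4`, they represent all elements of `ℤ[α, θ]`. -/
abbrev Num : Type := List (List ℕ)

/-- Vectors in the main loop: auxiliary coordinates and edge coordinates. -/
abbrev Vec : Type := List Bool × List Bool

/-- What the main loop reads: the modulus, the edge labels and the vertices. -/
abbrev Ctx : Type := List (List ℕ) × List ℕ × List Vtx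

/-- What the main loop changes: a factor in `ℕ[α]`, the weights of the auxiliary coordinates, a
base point and directions. -/
abbrev LState : Type := List ℕ × List (List ℕ) × Vec × List Vec

/-- A polynomial in `α` for an element of `ℤ[α]`, with `α ^ 4 = -1`. -/
def cycPoly (c : Cyc) : List ℕ :=
  (c.map fun p => bif p.1 then 0 else p.2) ++ c.map fun p => bif p.1 then p.2 else 0

/-- A polynomial in `α` for `i ^ k`, where `k < 4`. -/
def ipow (k : ℕ) : List ℕ :=
  if k = 0 then [1] else if k = 1 then [0, 0, 1] else if k = 2 then [0, 0, 0, 0, 1]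
  else [0, 0, 0, 0, 0, 0, 1]

/-- The difference of two numbers as a sign and an absolute value. -/
def canonInt (a b : ℕ) : Bool × ℕ := (decide (a < b), bif decide (a < b) then b - a else a - b)

/-- The coordinates of `∑ i < 8, lᵢ α ^ i`, by `α ^ 4 = -1`. -/
def canon (l : List ℕ) : Cyc :=
  [canonInt (l.headD 0) (l.tail.tail.tail.tail.headD 0),
    canonInt (l.tail.headD 0) (l.tail.tail.tail.tail.tail.headD 0),
    canonInt (l.tail.tail.headD 0) (l.tail.tail.tail.tail.tail.tail.headD 0),
    canonInt (l.tail.tail.tail.headD 0) (l.tail.tail.tail.tail.tail.tail.tail.headD 0)]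

/-- The normal form of a number: its coordinates with respect to powers of `θ` and `α`. -/
def nf (m : List (List ℕ)) (x : Num) : List Cyc :=
  (red m x).map fun c => canon (red [1, 0, 0, 0, 0, 0, 0, 0] c)

/-- Does the row have a nonzero value? -/
def rowNonzero (r : Row) : Bool := r.2.1.any fun c => c.any fun p => !decide (p.2 = 0)

/-- The value of a row. -/
def rowNum (q : List Cyc × ℕ) : Num × ℕ := (q.1.map cycPoly, q.2)

/-- The labels of the edges that occur, without repetitions. The number of edges in the input is not
used. -/
def labels (vs : List Vtx) : List ℕ :=
  (vs.flatMap Prod.fst).foldr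
    (fun e acc => bif acc.any (fun e' => decide (e' = e)) then acc else e :: acc) []

/-- The coordinate of the vector `v` at the edge `e`. -/
def bitAt (E : List ℕ) (e : ℕ) (v : List Bool) : Bool := dot (E.map fun e' => decide (e' = e)) v

/-- The coordinates of the vector `v` at the given edges. -/
def inputs (E es : List ℕ) (v : List Bool) : List Bool := es.map fun e => bitAt E e v

/-- The value of the function at a vertex, as a numerator and a denominator. -/
def vtxNum (E : List ℕ) (v : List Bool) (w : Vtx) : Num × ℕ :=
  (assoc w.2 (inputs E w.1 v)).elim ([], 1) rowNum

/-- Products of polynomials. -/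
def nprod {R : Type} [Enc R] [NAr R] (one : R) (l : List R) : R := l.foldr mul one

/-- The product of the functions at all vertices. -/
def evalNum (E : List ℕ) (vs : List Vtx) (v : List Bool) : Num × ℕ :=
  (nprod [[1]] (vs.map fun w => (vtxNum E v w).1), nprod 1 (vs.map fun w => (vtxNum E v w).2))

/-- A basis for the affine forms on the inputs of a vertex that vanish on the support. The first
coefficient is the constant one. -/
def annih (w : Vtx) : List (List Bool) :=
  ((w.2.filter rowNonzero).map Prod.fst).foldr
    (fun x B => (cutAux vadd (B.map fun a => (a, dot a (true :: x)))).2) (units (0 :: w.1))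

/-- The affine forms that define the common support. -/
def constraints (vs : List Vtx) : List (List ℕ × List Bool) :=
  vs.flatMap fun w => (annih w).map fun a => (w.1, a)

/-- A point and directions for the solutions of a system of linear equations. -/
def solve (E : List ℕ) (cs : List (List ℕ × List Bool)) : Option (List Bool × List (List Bool)) :=
  cs.foldr (fun c s => s.elim none fun s =>
    cut vadd s.1 (dot c.2 (true :: inputs E c.1 s.1))
      (s.2.map fun b => (b, dot c.2 (false :: inputs E c.1 b)))) (some ([], units E))

/-- The product of the weights of those auxiliary coordinates that are `1`. -/
def weight (w : List (List ℕ)) (ext : List Bool) : List ℕ :=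
  nprod [1] ((zipD [1] false w ext).map fun p => bif p.2 then p.1 else [1])

/-- The function that is summed up in the main loop. -/
def hval (c : Ctx) (w : List (List ℕ)) (y : Vec) : Num × ℕ :=
  (mul [weight w y.1] (evalNum c.2.1 c.2.2 y.2).1, (evalNum c.2.1 c.2.2 y.2).2)

/-- Is `x` equal to `i ^ k * y`? -/
def isMul (m : List (List ℕ)) (k : ℕ) (x y : Num × ℕ) : Bool :=
  decide (nf m (mul x.1 [[y.2]]) = nf m (mul [ipow k] (mul y.1 [[x.2]])))

/-- The exponent `k < 4` such that `x = i ^ k * y`, if there is one. -/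
def phase (m : List (List ℕ)) (x y : Num × ℕ) : ℕ :=
  bif isMul m 0 x y then 0 else bif isMul m 1 x y then 1 else bif isMul m 2 x y then 2 else 3

/-- Addition of vectors in the main loop. -/
def vadd2 (u v : Vec) : Vec := (vadd u.1 v.1, vadd u.2 v.2)

/-- Add an auxiliary coordinate. -/
def tagged (v : Vec) (t : Bool) : Vec := (t :: v.1, v.2)

/-- The change of phase in the direction `b` at the point `p`. -/
def phaseAt (c : Ctx) (w : List (List ℕ)) (b p : Vec) : ℕ :=
  phase c.1 (hval c w (vadd2 p b)) (hval c w p)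

/-- The remaining directions, with the change of sign that they cause for the phase. -/
def tags (c : Ctx) (w : List (List ℕ)) (p b : Vec) (B : List Vec) : List (Vec × Bool) :=
  B.map fun b' => (b', !decide (phaseAt c w b (vadd2 p b') = phaseAt c w b p))

/-- Summation over the multiples of the first direction `b`. If the function changes in this
direction by an odd power of `i`, the sum is again such a function, with one more auxiliary
coordinate, since `1 - i ^ k = i ^ (4 - k) * (1 + i ^ k)` for odd `k`. Otherwise, the sum vanishes
outside of an affine subspace. If this subspace is empty, the factor becomes `0`. -/
def loopStep (c : Ctx) (s : LState) : LState :=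
  match s.2.2.2 with
  | [] => s
  | b :: B =>
    bif decide (phaseAt c s.2.1 b s.2.2.1 = 1) || decide (phaseAt c s.2.1 b s.2.2.1 = 3) then
      (mul s.1 (add [1] (ipow (phaseAt c s.2.1 b s.2.2.1))),
        ipow (4 - phaseAt c s.2.1 b s.2.2.1) :: s.2.1, tagged s.2.2.1 false,
        (tags c s.2.1 s.2.2.1 b B).map fun t => tagged t.1 t.2)
    else
      (cut vadd2 s.2.2.1 (decide (phaseAt c s.2.1 b s.2.2.1 = 2))
        (tags c s.2.1 s.2.2.1 b B)).elim ([], s.2.1, s.2.2.1, [])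
          fun t => (mul s.1 [2], s.2.1, t.1, t.2)

/-- The main loop, for the sum over the affine space given by a point and directions. -/
def gauss (c : Ctx) (s : List Bool × List (List Bool)) : LState :=
  s.2.foldl (fun t _ => loopStep c t) ([1], [], ([], s.1), s.2.map fun b => ([], b))

/-- The modulus in the form that `red` uses: the coefficients of the polynomial for `θ ^ d`. -/
def negModulus (m : List Cyc) : List (List ℕ) := m.map fun c => mul [0, 0, 0, 0, 1] (cycPoly c)

/-- The Holant value: coordinates and denominator. -/
def answer (d : Data) : List Cyc × ℕ :=
  (solve (labels d.2) (constraints d.2)).elim (nf (negModulus d.1) [], 1) fun s =>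
    (nf (negModulus d.1) (mul [(gauss (negModulus d.1, labels d.2, d.2) s).1]
      (hval (negModulus d.1, labels d.2, d.2) (gauss (negModulus d.1, labels d.2, d.2) s).2.1
        (gauss (negModulus d.1, labels d.2, d.2) s).2.2.1).1),
      (hval (negModulus d.1, labels d.2, d.2) (gauss (negModulus d.1, labels d.2, d.2) s).2.1
        (gauss (negModulus d.1, labels d.2, d.2) s).2.2.1).2)

/-! ### Its running time -/

section
variable {γ : Type} [Enc γ]

theorem PT.elim {α β : Type} [Enc α] [Enc β] {o : γ → Option α} {f : γ → β} {g : γ → α → β}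
    (ho : PT o) (hf : PT f) (hg : PT fun t : γ × α => g t.1 t.2) :
    PT fun c => (o c).elim (f c) (g c) :=
  (PT.optionCases ho hf hg).congr_enc fun c => by cases o c <;> rfl

@[fun_prop]
theorem PT.cycPoly {f : γ → Cyc} (hf : PT f) : PT fun c => cycPoly (f c) :=
  (PT.map (f := fun (_ : γ) (p : Bool × ℕ) => bif p.1 then 0 else p.2) hf (by fun_prop)).append
    (PT.map (f := fun (_ : γ) (p : Bool × ℕ) => bif p.1 then p.2 else 0) hf (by fun_prop))

@[fun_prop]
theorem PT.ipow {f : γ → ℕ} (hf : PT f) : PT fun c => ipow (f c) := by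
  unfold Holant.ipow
  fun_prop

@[fun_prop]
theorem PT.canonInt {f g : γ → ℕ} (hf : PT f) (hg : PT g) : PT fun c => canonInt (f c) (g c) := by
  unfold Holant.canonInt
  fun_prop

@[fun_prop]
theorem PT.canon {f : γ → List ℕ} (hf : PT f) : PT fun c => canon (f c) := by
  unfold Holant.canon
  fun_prop

@[fun_prop]
theorem PT.nf {f : γ → List (List ℕ)} {g : γ → Num} (hf : PT f) (hg : PT g) :
    PT fun c => nf (f c) (g c) :=
  PT.map (f := fun _ c => Holant.canon (Holant.red [1, 0, 0, 0, 0, 0, 0, 0] c)) (by fun_prop)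
    (by fun_prop)

@[fun_prop]
theorem PT.rowNonzero {f : γ → Row} (hf : PT f) : PT fun c => rowNonzero (f c) :=
  PT.any (f := fun (_ : γ) (c : Cyc) => c.any fun p => !decide (p.2 = 0)) (by fun_prop)
    (PT.any (f := fun (_ : γ × Cyc) (p : Bool × ℕ) => !decide (p.2 = 0)) (by fun_prop)
      (by fun_prop))

@[fun_prop]
theorem PT.rowNum {f : γ → List Cyc × ℕ} (hf : PT f) : PT fun c => rowNum (f c) :=
  (PT.map (f := fun _ c => Holant.cycPoly c) (by fun_prop) (by fun_prop)).prodMk (by fun_prop)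

@[fun_prop]
theorem PT.labels {f : γ → List Vtx} (hf : PT f) : PT fun c => labels (f c) := by
  have h : PT fun c => (f c).flatMap Prod.fst :=
    PT.flatMap (f := fun _ w => w.1) hf (by fun_prop)
  refine PT.foldr_of_le
    (step := fun _ e acc => bif acc.any (fun e' => decide (e' = e)) then acc else e :: acc)
    (init := fun _ => []) h (by fun_prop) ?_ (F := fun t => size t.2 + 1)
    (PT.snd'.bdd_size.add (.const 1)) ?_
  · refine PT.cond (PT.any (f := fun (t : γ × ℕ × List ℕ) e' => decide (e' = t.2.1))
      (by fun_prop) (by fun_prop)) (by fun_prop) (by fun_prop)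
  · intro c a b
    show _ ≤ size b + (size a + 1)
    cases b.any (fun e' => decide (e' = a)) <;>
      simp only [cond_true, cond_false, size_cons] <;> omega

@[fun_prop]
theorem PT.bitAt {f : γ → List ℕ} {g : γ → ℕ} {h : γ → List Bool} (hf : PT f) (hg : PT g)
    (hh : PT h) : PT fun c => bitAt (f c) (g c) (h c) :=
  PT.dot (PT.map (f := fun c e' => decide (e' = g c)) hf
    (PT.decideEq (by fun_prop) (hg.comp (by fun_prop)))) hh

@[fun_prop]
theorem PT.inputs {f g : γ → List ℕ} {h : γ → List Bool} (hf : PT f) (hg : PT g)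
    (hh : PT h) : PT fun c => inputs (f c) (g c) (h c) :=
  PT.map (f := fun c e => Holant.bitAt (f c) e (h c)) hg
    (PT.bitAt (hf.comp (by fun_prop)) (by fun_prop) (hh.comp (by fun_prop)))

@[fun_prop]
theorem PT.vtxNum {f : γ → List ℕ} {g : γ → List Bool} {h : γ → Vtx} (hf : PT f) (hg : PT g)
    (hh : PT h) : PT fun c => vtxNum (f c) (g c) (h c) :=
  PT.elim (o := fun c => Holant.assoc (h c).2 (Holant.inputs (f c) (h c).1 (g c)))
    (f := fun _ => ([], 1)) (g := fun _ q => Holant.rowNum q)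
    (PT.assoc (by fun_prop) (by fun_prop)) (by fun_prop) (by fun_prop)

theorem fits_nprod {R : Type} [Enc R] [NAr R] (one : R) (l : List R) :
    Fits (size one + size l) (nprod one l) ∧
      Nat.size (norm (nprod one l)) ≤ size one + size l := by
  induction l with
  | nil =>
    have := natSize_norm_le one
    exact ⟨fits_mono _ _ _ (by omega) (fits_size one), by simp [nprod]; omega⟩
  | cons a l ih =>
    rw [nprod, List.foldr_cons, ← nprod]
    constructor
    · exact fits_mono _ _ _ (by simp; omega) (fits_mul _ _ _ _ (fits_size a) ih.1)
    · rw [NAr.norm_mul]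
      have := natSize_mul_le (norm a) (norm (nprod one l))
      have := natSize_norm_le a
      simp; omega

@[fun_prop]
theorem PT.nprod {R : Type} [Enc R] [NAr R] {one : R} {f : γ → List R} (hf : PT f) :
    PT fun c => nprod one (f c) := by
  obtain ⟨q, hq⟩ := size_le (R := R)
  refine PT.foldr (step := fun _ a acc => NAr.mul a acc) (init := fun _ => one)
    (by fun_prop) (by fun_prop) hf.reverse
    (F := fun c => q.eval (2 * (size one + size (f c))))
    (((Bdd.const 2).mul ((Bdd.const _).add hf.bdd_size)).eval q) fun c l₁ l₂ e => ?_
  obtain ⟨h1, h2⟩ := fits_nprod one l₂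
  refine (hq _ _ h1).trans (eval_mono q ?_)
  have h5 := size_append l₁ l₂
  have h6 := size_pos l₁
  change _ ≤ 2 * (size one + size (f c))
  rw [e]
  have h7 : Nat.size (NAr.norm (List.foldr NAr.mul one l₂)) ≤ size one + size l₂ := h2
  omega

@[fun_prop]
theorem PT.evalNum {f : γ → List ℕ} {g : γ → List Vtx} {h : γ → List Bool} (hf : PT f)
    (hg : PT g) (hh : PT h) : PT fun c => evalNum (f c) (g c) (h c) := by
  have h1 : PT fun t : γ × Vtx => Holant.vtxNum (f t.1) (h t.1) t.2 :=
    PT.vtxNum (hf.comp (by fun_prop)) (hh.comp (by fun_prop)) (by fun_prop)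
  exact (PT.nprod (PT.map (f := fun c w => (Holant.vtxNum (f c) (h c) w).1) hg h1.fst)).prodMk
    (PT.nprod (PT.map (f := fun c w => (Holant.vtxNum (f c) (h c) w).2) hg h1.snd))

@[fun_prop]
theorem PT.annih {f : γ → Vtx} (hf : PT f) : PT fun c => annih (f c) := by
  have h1 : PT fun c => (((f c).2.filter Holant.rowNonzero).map Prod.fst) :=
    PT.map (f := fun _ p => p.1) (PT.filter (f := fun _ r => Holant.rowNonzero r) (by fun_prop)
      (by fun_prop)) (by fun_prop)
  refine PT.foldr
    (step := fun _ x B =>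
      (Holant.cutAux Holant.vadd (B.map fun a => (a, Holant.dot a (true :: x)))).2)
    (init := fun c => Holant.units (0 :: (f c).1))
    (PT.snd (PT.cutAux (by fun_prop) (PT.map (f := fun (t : γ × List Bool × List (List Bool)) a =>
      (a, Holant.dot a (true :: t.2.1))) (by fun_prop) (by fun_prop)))) (by fun_prop) h1.reverse
    (F := fun c => (size (f c) + 1) * (4 * (size (f c) + 1) + 2) + 1)
    (((Bdd.add hf.bdd_size (.const 1)).mul (((Bdd.const 4).mul
      (Bdd.add hf.bdd_size (.const 1))).add (.const 2))).add (.const 1)) ?_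
  intro c l₁ l₂ _
  have key : ∀ (l₃ : List (List Bool)) (B : List (List Bool)), B = l₃.foldr (fun x B =>
      (Holant.cutAux Holant.vadd (B.map fun a => (a, Holant.dot a (true :: x)))).2)
        (Holant.units (0 :: (f c).1)) →
      B.length ≤ (f c).1.length + 1 ∧ ∀ v ∈ B, v.length ≤ (f c).1.length + 1 := by
    intro l₃
    induction l₃ with
    | nil =>
      rintro B rfl
      exact ⟨by simp [length_units], fun v hv => length_le_of_mem_units hv⟩
    | cons x l₃ ih =>
      rintro B rfl
      obtain ⟨h2, h3⟩ := ih _ rfl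
      rw [List.foldr_cons]
      generalize List.foldr _ _ l₃ = B at h2 h3
      constructor
      · refine (length_cutAux_le _ _).trans ?_
        simpa using h2
      · refine (cutAux_forall (P := fun v : List Bool => v.length ≤ (f c).1.length + 1) ?_ ?_).2
        · intro u v hu hv
          rw [length_vadd]; omega
        · intro b hb
          obtain ⟨a, ha, rfl⟩ := List.mem_map.1 hb
          exact h3 a ha
  obtain ⟨h2, h3⟩ := key l₂ _ rfl
  refine (size_vecs_le h3).trans ?_
  have h4 : (f c).1.length + 1 ≤ size (f c) + 1 := by
    have := length_le_size (f c).1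
    have h5 : size (f c) = size (f c).1 + size (f c).2 + 1 := rfl
    omega
  gcongr
  · omega

@[fun_prop]
theorem PT.constraints {f : γ → List Vtx} (hf : PT f) : PT fun c => constraints (f c) :=
  PT.flatMap (f := fun _ w => (Holant.annih w).map fun a => (w.1, a)) hf
    (PT.map (f := fun (t : γ × Vtx) a => (t.2.1, a)) (by fun_prop) (by fun_prop))

theorem solve_forall (E : List ℕ) (cs : List (List ℕ × List Bool)) :
    ∀ s ∈ solve E cs, s.1.length ≤ E.length ∧ (∀ b ∈ s.2, b.length ≤ E.length) ∧
      s.2.length ≤ E.length := by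
  induction cs with
  | nil =>
    intro s hs
    simp [solve] at hs
    subst hs
    exact ⟨by simp, fun v hv => length_le_of_mem_units hv, by rw [length_units]⟩
  | cons c cs ih =>
    intro s hs
    rw [solve, List.foldr_cons, ← solve] at hs
    cases h : solve E cs with
    | none => simp [h] at hs
    | some s' =>
      obtain ⟨h1, h2, h3⟩ := ih s' h
      rw [h] at hs
      have := cut_forall (P := fun v => v.length ≤ E.length) (fun u v hu hv => by
        rw [length_vadd]; omega) h1 (fun b hb => by
          obtain ⟨a, ha, rfl⟩ := List.mem_map.1 hb
          exact h2 a ha) hs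
      refine ⟨this.1, this.2.1, this.2.2.trans ?_⟩
      simpa using h3

@[fun_prop]
theorem PT.solve {f : γ → List ℕ} {g : γ → List (List ℕ × List Bool)} (hf : PT f) (hg : PT g) :
    PT fun c => solve (f c) (g c) := by
  have h1 : PT fun t : γ × (List ℕ × List Bool) × Option (List Bool × List (List Bool)) => f t.1 :=
    hf.comp (by fun_prop)
  refine PT.foldr (step := fun x (c : List ℕ × List Bool)
      (s : Option (List Bool × List (List Bool))) =>
      s.elim none fun s => Holant.cut Holant.vadd s.1
        (Holant.dot c.2 (true :: Holant.inputs (f x) c.1 s.1))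
        (s.2.map fun b => (b, Holant.dot c.2 (false :: Holant.inputs (f x) c.1 b))))
    (init := fun x => Option.some ([], Holant.units (f x)))
    (PT.elim (by fun_prop) (by fun_prop)
      (g := fun (t : γ × (List ℕ × List Bool) × Option (List Bool × List (List Bool)))
        (s : List Bool × List (List Bool)) =>
        Holant.cut Holant.vadd s.1 (Holant.dot t.2.1.2 (true :: Holant.inputs (f t.1) t.2.1.1 s.1))
        (s.2.map fun b => (b, Holant.dot t.2.1.2 (false :: Holant.inputs (f t.1) t.2.1.1 b))))
      (PT.cut (by fun_prop) (by fun_prop) ?_ (PT.map (f := fun (t : (γ × (List ℕ × List Bool) ×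
        Option (List Bool × List (List Bool))) × (List Bool × List (List Bool))) b =>
        (b, Holant.dot t.1.2.1.2 (false :: Holant.inputs (f t.1.1) t.1.2.1.1 b)))
        (by fun_prop) ?_)))
    (by fun_prop) hg.reverse
    (F := fun c => (4 * size (f c) + 1) + (size (f c) * (4 * size (f c) + 2) + 1) + 3)
    ((((((Bdd.const 4).mul hf.bdd_size).add (.const 1)).add ((hf.bdd_size.mul (((Bdd.const 4).mul
      hf.bdd_size).add (.const 2))).add (.const 1)))).add (.const 3)) ?_
  · fun_prop
  · have h2 : PT fun t : ((γ × (List ℕ × List Bool) × Option (List Bool × List (List Bool))) ×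
        (List Bool × List (List Bool))) × List Bool => f t.1.1.1 := hf.comp (by fun_prop)
    fun_prop
  · intro c l₁ l₂ _
    change size (Holant.solve (f c) l₂) ≤ _
    have h2 := solve_forall (f c) l₂
    cases h : Holant.solve (f c) l₂ with
    | none => simp
    | some s =>
      obtain ⟨h3, h4, h5⟩ := h2 s h
      obtain ⟨s1, s2⟩ := s
      have h6 := size_vec_le s1
      have h7 := size_vecs_le h4
      have h8 := length_le_size (f c)
      have h9 : s2.length * (4 * (f c).length + 2) ≤ size (f c) * (4 * size (f c) + 2) := by
        dsimp only at h5
        gcongr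
        omega
      dsimp only at h3 h7
      simp only [size_some, size_prod]
      omega

@[fun_prop]
theorem PT.weight {f : γ → List (List ℕ)} {g : γ → List Bool} (hf : PT f) (hg : PT g) :
    PT fun c => weight (f c) (g c) :=
  PT.nprod (PT.map (f := fun (_ : γ) (p : List ℕ × Bool) => bif p.2 then p.1 else [1])
    (by fun_prop) (by fun_prop))

@[fun_prop]
theorem PT.hval {f : γ → Ctx} {g : γ → List (List ℕ)} {h : γ → Vec} (hf : PT f) (hg : PT g)
    (hh : PT h) : PT fun c => hval (f c) (g c) (h c) := by
  have h1 : PT fun c => Holant.evalNum (f c).2.1 (f c).2.2 (h c).2 :=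
    PT.evalNum (by fun_prop) (by fun_prop) (by fun_prop)
  exact (PT.nmul (by fun_prop) h1.fst).prodMk h1.snd

@[fun_prop]
theorem PT.isMul {k : ℕ} {f : γ → List (List ℕ)} {g h : γ → Num × ℕ} (hf : PT f) (hg : PT g)
    (hh : PT h) : PT fun c => isMul (f c) k (g c) (h c) := by
  unfold Holant.isMul
  fun_prop

@[fun_prop]
theorem PT.phase {f : γ → List (List ℕ)} {g h : γ → Num × ℕ} (hf : PT f) (hg : PT g)
    (hh : PT h) : PT fun c => phase (f c) (g c) (h c) := by
  unfold Holant.phase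
  fun_prop

@[fun_prop]
theorem PT.vadd2 {f g : γ → Vec} (hf : PT f) (hg : PT g) : PT fun c => vadd2 (f c) (g c) := by
  unfold Holant.vadd2
  fun_prop

@[fun_prop]
theorem PT.tagged {f : γ → Vec} {g : γ → Bool} (hf : PT f) (hg : PT g) :
    PT fun c => tagged (f c) (g c) := by
  unfold Holant.tagged
  fun_prop

@[fun_prop]
theorem PT.phaseAt {f : γ → Ctx} {g : γ → List (List ℕ)} {h k : γ → Vec} (hf : PT f) (hg : PT g)
    (hh : PT h) (hk : PT k) : PT fun c => phaseAt (f c) (g c) (h c) (k c) := by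
  unfold Holant.phaseAt
  fun_prop

@[fun_prop]
theorem PT.tags {f : γ → Ctx} {g : γ → List (List ℕ)} {h k : γ → Vec} {l : γ → List Vec}
    (hf : PT f) (hg : PT g) (hh : PT h) (hk : PT k) (hl : PT l) :
    PT fun c => tags (f c) (g c) (h c) (k c) (l c) := by
  have hf' : PT fun t : γ × Vec => f t.1 := hf.comp (by fun_prop)
  have hg' : PT fun t : γ × Vec => g t.1 := hg.comp (by fun_prop)
  have hh' : PT fun t : γ × Vec => h t.1 := hh.comp (by fun_prop)
  have hk' : PT fun t : γ × Vec => k t.1 := hk.comp (by fun_prop)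
  exact PT.map (f := fun c b' => (b', !decide (Holant.phaseAt (f c) (g c) (k c)
    (Holant.vadd2 (h c) b') = Holant.phaseAt (f c) (g c) (k c) (h c)))) hl (by fun_prop)

theorem PT.vadd2' : PT fun p : Vec × Vec => Holant.vadd2 p.1 p.2 := by fun_prop

theorem PT.loopStep {f : γ → Ctx} {g : γ → LState} (hf : PT f) (hg : PT g) :
    PT fun c => loopStep (f c) (g c) := by
  have hf' : PT fun t : γ × Vec × List Vec => f t.1 := hf.comp (by fun_prop)
  have hg' : PT fun t : γ × Vec × List Vec => g t.1 := hg.comp (by fun_prop)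
  have h1 : PT fun t : γ × Vec × List Vec =>
      Holant.phaseAt (f t.1) (g t.1).2.1 t.2.1 (g t.1).2.2.1 := by fun_prop
  have h2 : PT fun t : γ × Vec × List Vec =>
      Holant.tags (f t.1) (g t.1).2.1 (g t.1).2.2.1 t.2.1 t.2.2 := by fun_prop
  refine (PT.listCases (l := fun c => (g c).2.2.2) (f := g) (g := fun c b B =>
    bif decide (Holant.phaseAt (f c) (g c).2.1 b (g c).2.2.1 = 1) ||
        decide (Holant.phaseAt (f c) (g c).2.1 b (g c).2.2.1 = 3) then
      (NAr.mul (g c).1 (NAr.add [1] (Holant.ipow (Holant.phaseAt (f c) (g c).2.1 b (g c).2.2.1))),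
        Holant.ipow (4 - Holant.phaseAt (f c) (g c).2.1 b (g c).2.2.1) :: (g c).2.1,
        Holant.tagged (g c).2.2.1 false,
        (Holant.tags (f c) (g c).2.1 (g c).2.2.1 b B).map fun t => Holant.tagged t.1 t.2)
    else
      (Holant.cut Holant.vadd2 (g c).2.2.1
        (decide (Holant.phaseAt (f c) (g c).2.1 b (g c).2.2.1 = 2))
        (Holant.tags (f c) (g c).2.1 (g c).2.2.1 b B)).elim ([], (g c).2.1, (g c).2.2.1, [])
          fun t => (NAr.mul (g c).1 [2], (g c).2.1, t.1, t.2)) (by fun_prop) (by fun_prop)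
    (PT.cond (PT.or (PT.decideEq h1 (by fun_prop)) (PT.decideEq h1 (by fun_prop))) ?_
      (PT.elim (PT.cut PT.vadd2' (by fun_prop) (PT.decideEq h1 (by fun_prop)) h2) (by fun_prop)
        ?_))).congr_enc fun c => ?_
  · exact (PT.nmul (by fun_prop) (PT.nadd (by fun_prop) (PT.ipow h1))).prodMk
      ((PT.cons (PT.ipow (by fun_prop)) (by fun_prop)).prodMk ((by fun_prop : PT _).prodMk
        (PT.map (f := fun _ t => Holant.tagged t.1 t.2) h2 (by fun_prop))))
  · have hg'' : PT fun t : (γ × Vec × List Vec) × (Vec × List Vec) => g t.1.1 :=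
      hg.comp (by fun_prop)
    fun_prop
  · unfold Holant.loopStep
    cases (g c).2.2.2 <;> rfl

theorem size_ipow_le (k : ℕ) : size (ipow k) ≤ 30 := by
  unfold ipow
  split_ifs <;> simp [size, enc, encTreeList, Tree.size]

theorem norm_ipow (k : ℕ) : NAr.norm (ipow k) = 1 := by
  unfold ipow
  split_ifs <;> simp [NAr.norm, listNorm, pval]

theorem fits_ipow (k : ℕ) : NAr.Fits 8 (ipow k) := by
  unfold ipow
  split_ifs <;> simp [NAr.Fits, ListFits]

/-- What holds after `n` steps of the main loop for vectors of length at most `N`, so that the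
state is of polynomial size. -/
structure LoopBound (N n : ℕ) (s : LState) : Prop where
  fits : NAr.Fits (8 * n + 1) s.1
  norm : NAr.norm s.1 ≤ 2 ^ n
  length : s.2.1.length ≤ n
  weights : ∀ x ∈ s.2.1, size x ≤ 30
  base : s.2.2.1.1.length ≤ n ∧ s.2.2.1.2.length ≤ N
  dirs : ∀ b ∈ s.2.2.2, b.1.length ≤ n ∧ b.2.length ≤ N
  count : s.2.2.2.length ≤ N

theorem LoopBound.loopStep {N n : ℕ} {c : Ctx} {s : LState} (h : LoopBound N n s) :
    LoopBound N (n + 1) (loopStep c s) := by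
  have mono : ∀ {m : ℕ}, m ≤ n → m ≤ n + 1 := fun h => h.trans (Nat.le_succ _)
  unfold Holant.loopStep
  obtain ⟨fac, w, p, _ | ⟨b, B⟩⟩ := s
  · exact ⟨fits_mono _ _ _ (by omega) h.fits, h.norm.trans (Nat.pow_le_pow_right (by omega)
      (by omega)), mono h.length, h.weights, ⟨mono h.base.1, h.base.2⟩, by simp, by simp⟩
  · have hp := h.base
    have hB : ∀ t ∈ tags c w p b B, t.1.1.length ≤ n ∧ t.1.2.length ≤ N := fun t ht => by
      obtain ⟨b', hb', rfl⟩ := List.mem_map.1 ht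
      exact h.dirs b' (List.mem_cons_of_mem _ hb')
    have hc : (tags c w p b B).length + 1 ≤ N := by
      have := h.count
      simpa [tags] using this
    dsimp only at hp ⊢
    generalize phaseAt c w b p = k
    cases hk : decide (k = 1) || decide (k = 3)
    · rw [cond_false]
      cases hs : cut vadd2 p (decide (k = 2)) (tags c w p b B) with
      | none =>
        refine ⟨fits_zero _, ?_, mono h.length, h.weights, ⟨mono hp.1, hp.2⟩, by simp, by simp⟩
        exact (NAr.norm_zero (R := List ℕ)).le.trans (Nat.zero_le _)
      | some t =>
        have := cut_forall (P := fun v : Vec => v.1.length ≤ n ∧ v.2.length ≤ N)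
          (fun u v hu hv => by
            simp only [vadd2, length_vadd]
            exact ⟨max_le hu.1 hv.1, max_le hu.2 hv.2⟩) hp hB hs
        refine ⟨fits_mono _ _ _ ?_ (fits_mul _ 8 _ _ h.fits ?_), ?_, mono h.length, h.weights,
          ⟨mono this.1.1, this.1.2⟩, fun b hb => ⟨mono (this.2.1 b hb).1, (this.2.1 b hb).2⟩, ?_⟩
        · omega
        · simp [NAr.Fits, ListFits]
        · have h2 : NAr.norm [2] = 2 := by simp [NAr.norm, listNorm, pval]
          show NAr.norm (NAr.mul fac [2]) ≤ _
          rw [NAr.norm_mul, h2, pow_succ]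
          have := h.norm
          dsimp only at this
          gcongr
        · show t.2.length ≤ N
          omega
    · rw [cond_true]
      refine ⟨fits_mono _ _ _ ?_ (fits_mul _ 8 _ _ h.fits (fits_add _ _ _ ?_ (fits_ipow _))), ?_,
        ?_, ?_, ?_, ?_, ?_⟩
      · omega
      · simp [NAr.Fits, ListFits]
      · have h1 : NAr.norm [1] = 1 := by simp [NAr.norm, listNorm, pval]
        show NAr.norm (NAr.mul fac (NAr.add [1] (ipow k))) ≤ _
        rw [NAr.norm_mul, NAr.norm_add, norm_ipow, h1, pow_succ]
        have := h.norm
        dsimp only at this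
        gcongr
      · simpa using h.length
      · intro x hx
        rcases List.mem_cons.1 hx with rfl | hx
        · exact size_ipow_le _
        · exact h.weights x hx
      · simpa [tagged] using hp
      · intro v hv
        obtain ⟨t, ht, rfl⟩ := List.mem_map.1 hv
        simpa [tagged] using hB t ht
      · simp only [List.length_map]
        omega

/-- As there are at most `N` steps, the invariant bounds the state by a polynomial in `N`. -/
theorem LoopBound.exists_size_le : ∃ q : Polynomial ℕ, ∀ N n s, LoopBound N n s → n ≤ N →
    size s ≤ q.eval N := by
  obtain ⟨q, hq⟩ := size_le (R := List ℕ)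
  refine ⟨q.comp (11 * Polynomial.X + 3) + (31 * Polynomial.X + 1) + (8 * Polynomial.X + 3) +
    (Polynomial.X * (8 * Polynomial.X + 4) + 1) + 3, fun N n s h hn => ?_⟩
  have h1 := (hq _ _ h.fits).trans (eval_mono q (b := 11 * N + 3) (by
    have := natSize_mono h.norm
    have h3 := natSize_pow_le 2 n
    have h4 : Nat.size 2 = 2 := by decide
    rw [h4] at h3
    omega))
  have h2 := size_le_of_forall_mem h.weights
  have h3 := h.length
  have key : ∀ v : Vec, v.1.length ≤ n ∧ v.2.length ≤ N → size v ≤ 8 * N + 3 := fun v hv => by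
    have h4 := size_vec_le v.1
    have h5 := size_vec_le v.2
    have h6 : size v = size v.1 + size v.2 + 1 := rfl
    omega
  have h4 := key _ h.base
  have h5 := size_le_of_forall_mem fun b hb => key b (h.dirs b hb)
  have h6 : s.2.2.2.length * (8 * N + 3 + 1) ≤ N * (8 * N + 4) := by
    have := h.count
    gcongr
  have h7 : size s = size s.1 + (size s.2.1 + (size s.2.2.1 + size s.2.2.2 + 1) + 1) + 1 := rfl
  have h8 : (q.comp (11 * Polynomial.X + 3) + (31 * Polynomial.X + 1) + (8 * Polynomial.X + 3) +
    (Polynomial.X * (8 * Polynomial.X + 4) + 1) + 3).eval N = q.eval (11 * N + 3) + (31 * N + 1) +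
    (8 * N + 3) + (N * (8 * N + 4) + 1) + 3 := by simp
  dsimp only at h1
  omega

theorem PT.gauss {f : γ → Ctx} {g : γ → List Bool × List (List Bool)} (hf : PT f) (hg : PT g) :
    PT fun c => gauss (f c) (g c) := by
  obtain ⟨q, hq⟩ := LoopBound.exists_size_le
  refine PT.foldl (step := fun c t _ => Holant.loopStep (f c) t)
    (init := fun c => ([1], [], ([], (g c).1), (g c).2.map fun b => ([], b)))
    (PT.loopStep (hf.comp (by fun_prop)) (by fun_prop)) ?_ hg.snd
    (F := fun c => q.eval (size (g c))) (hg.bdd_size.eval q) fun c l₁ l₂ e => ?_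
  · exact (by fun_prop : PT _).prodMk ((by fun_prop : PT _).prodMk ((by fun_prop : PT _).prodMk
      (PT.map (f := fun _ b => ([], b)) (by fun_prop) (by fun_prop))))
  · have h1 : size (g c) = size (g c).1 + size (g c).2 + 1 := rfl
    have h2 := length_le_size (g c).2
    have key : ∀ (l : List (List Bool)) (n : ℕ) (s : LState), LoopBound (size (g c)) n s →
        LoopBound (size (g c)) (n + l.length)
          (l.foldl (fun t _ => Holant.loopStep (f c) t) s) := by
      intro l
      induction l with
      | nil => exact fun n s h => h
      | cons a l ih =>
        intro n s h
        have := ih (n + 1) _ (h.loopStep (c := f c))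
        rw [List.foldl_cons, List.length_cons, add_comm l.length, ← add_assoc]
        exact this
    refine hq _ _ _ (key l₁ 0 _ ⟨?_, ?_, by simp, by simp, ?_, ?_, ?_⟩) ?_
    · simp [NAr.Fits, ListFits]
    · simp [NAr.norm, listNorm, pval]
    · have := length_le_size (g c).1
      exact ⟨by simp, by dsimp only; omega⟩
    · intro b hb
      obtain ⟨v, hv, rfl⟩ := List.mem_map.1 hb
      have h3 := size_le_of_mem hv
      have h4 := length_le_size v
      exact ⟨by simp, by dsimp only; omega⟩
    · simp only [List.length_map]; omega
    · rw [e] at h2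
      simp only [List.length_append] at h2
      rw [e] at h1
      omega

@[fun_prop]
theorem PT.negModulus {f : γ → List Cyc} (hf : PT f) : PT fun c => negModulus (f c) :=
  PT.map (f := fun _ c => NAr.mul [0, 0, 0, 0, 1] (Holant.cycPoly c)) hf (by fun_prop)

theorem PT.answer : PT answer := by
  have hm : PT fun t : Data × List Bool × List (List Bool) =>
    (Holant.negModulus t.1.1, Holant.labels t.1.2, t.1.2) := by fun_prop
  have hg := PT.gauss hm PT.snd'
  refine PT.elim (o := fun d : Data => Holant.solve (Holant.labels d.2) (Holant.constraints d.2))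
    (by fun_prop) (by fun_prop) ?_
  have hh := PT.hval hm hg.snd.fst hg.snd.snd.fst
  exact (PT.nf (by fun_prop) (PT.nmul (PT.cons hg.fst (by fun_prop)) hh.fst)).prodMk hh.snd

end

/-! ### Reading and writing words -/

/-- The position of a symbol in a list of all symbols. -/
def Sym.index : Sym → ℕ
  | .bit false => 0
  | .bit true => 1
  | .neg => 2
  | .left => 3
  | .right => 4

theorem Sym.index_injective : Function.Injective Sym.index := by
  rintro (⟨_ | _⟩ | _ | _ | _) (⟨_ | _⟩ | _ | _ | _) h <;> simp_all [Sym.index]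

instance : Enc Sym := ⟨fun s => enc (List.replicate s.index false)⟩

instance : PTEq Sym :=
  ⟨by
    have h : ∀ {f : Sym × Sym → Sym}, PT f → PT fun p => List.replicate (f p).index false :=
      fun hf => hf.congr_enc fun _ => rfl
    refine (PT.decideEq (h PT.fst') (h PT.snd')).congr_enc fun p => ?_
    congr 1
    rw [decide_eq_decide, List.replicate_inj]
    exact ⟨fun h => Sym.index_injective h.1, fun h => by rw [h]; simp⟩⟩

/-- Write the code of the symbol in front of the code of a list on the stack `d`. -/
def pushSym (s : Option Sym) : Prog :=
  s.elim .skip fun s => .seq (pushTree (enc s)) (.push .d (.bit true))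

/-- Read the word on the stack `r`, and write the code of this list of symbols on `d`. -/
def readWord : Prog :=
  .seq (emptyTo .z) (.seq (.push .d (.bit false)) (.loop .z Option.isSome pushSym))

theorem size_sym_le (s : Sym) : size s ≤ 9 := by
  rcases s with (_ | _) | _ | _ | _ <;> decide

theorem exec_pushSym_loop (l : List Sym) : ∀ l' : List Sym,
    Exec (.loop .z Option.isSome pushSym) (mem (enc l').code l [] [])
      (mem (enc (l.reverse ++ l')).code [] [] []) (11 * l.length + 1) := by
  induction l with
  | nil =>
    exact fun l' => ⟨1, le_rfl, by
      simpa using Run.loopStop (k := .z) (go := Option.isSome) (f := pushSym)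
        (m := mem (enc l').code [] [] []) rfl⟩
  | cons s l ih =>
    intro l'
    obtain ⟨t', ht', hr'⟩ := ih (s :: l')
    obtain ⟨t, ht, hr⟩ := (exec_pushTree (enc s) (enc l').code l).seq
      (Exec.pushD (.bit true) _ _ _ _)
    have h1 := size_sym_le s
    simp only [size] at h1
    refine ⟨t + t' + 1, by simp; omega, .loopGo (by simp) (by simpa [pushSym] using hr) ?_⟩
    rw [List.reverse_cons, List.append_assoc]
    rw [enc_cons] at hr'
    exact hr'

theorem exec_readWord (w : List Sym) :
    Exec readWord (mem [] [] w []) (mem (enc w).code [] [] []) (13 * w.length + 3) := by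
  have h := (exec_emptyTo_z w [] [] []).seq ((Exec.pushD (.bit false) _ _ _ _).seq
    (exec_pushSym_loop (w.reverse ++ []) []))
  simp only [List.append_nil, List.reverse_reverse, List.length_reverse] at h
  exact h.mono (by omega)

/-- Remove the code of a symbol from `d`, and put the symbol on `z`. The argument lists the
symbols that are still possible. -/
def writeSym : List Sym → Prog
  | [] => .skip
  | s :: l => .sw .d fun b =>
      if b = some (.bit true) then .sw .d fun _ => writeSym l else .push .z s

/-- Write the word whose reverse is the list of symbols on `d` on the stack `z`. -/
def writeWord : Prog :=
  .loop .d (fun b => decide (b = some (.bit true))) fun _ =>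
    writeSym [.bit false, .bit true, .neg, .left, .right]

theorem exec_writeSym (l : List Sym) : ∀ (n : ℕ) (s : Sym), l[n]? = some s → ∀ D Z,
    Exec (writeSym l) (mem ((enc (List.replicate n false)).code ++ D) Z [] [])
      (mem D (s :: Z) [] [])
      (2 * n + 2) := by
  induction l with
  | nil => intro n s h; simp at h
  | cons s' l ih =>
    intro n s h D Z
    cases n with
    | zero =>
      simp only [List.getElem?_cons_zero, Option.some.injEq] at h
      subst h
      refine Exec.swD ?_
      rw [if_neg (by simp)]
      exact ⟨1, le_rfl, by simpa using Run.push .z s' (mem D Z [] [])⟩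
    | succ n =>
      rw [List.replicate_succ, enc_cons, Tree.code_node_append]
      refine Exec.mono (Exec.swD (T := 2 * n + 2 + 1) ?_) (by omega)
      rw [if_pos rfl]
      exact Exec.swD (ih n s (by simpa using h) D Z)

theorem exec_writeWord (l : List Sym) : ∀ Z : List Sym,
    Exec writeWord (mem (enc l).code Z [] []) (mem [] (l.reverse ++ Z) [] [])
      (11 * l.length + 1) := by
  induction l with
  | nil =>
    exact fun Z => ⟨1, le_rfl, by
      simpa [writeWord, enc_nil, Tree.code] using Run.loopStop (k := .d)
        (go := fun b => decide (b = some (.bit true)))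
        (f := fun _ => writeSym [.bit false, .bit true, .neg, .left, .right])
        (m := mem [.bit false] Z [] []) (by simp)⟩
  | cons s l ih =>
    intro Z
    obtain ⟨t', ht', hr'⟩ := ih (s :: Z)
    have h1 : s.index ≤ 4 ∧ [.bit false, .bit true, .neg, .left, .right][s.index]? = some s := by
      rcases s with (_ | _) | _ | _ | _ <;> simp [Sym.index]
    obtain ⟨t, ht, hr⟩ := exec_writeSym _ _ s h1.2 (enc l).code Z
    refine ⟨t + t' + 1, by simp; omega, ?_⟩
    change Run _ (mem ((enc s).code ++ _) _ _ _) _ _ at hr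
    rw [enc_cons, List.reverse_cons, List.append_assoc]
    exact .loopGo (m' := mem (enc l).code (s :: Z) [] []) (by simp [Tree.code])
      (by simpa [Tree.code] using hr) hr'

/-- A program on codes yields a Turing machine on words. -/
theorem PT.computableInPolyTime {α β : Type} {ea : α → List Sym} {eb : β → List Sym} {f : α → β}
    [Enc α] (he : ∀ a : α, enc a = enc (ea a)) (h : PT fun a => eb (f a)) :
    Nonempty (Turing.TM2ComputableInPolyTime ea eb f) := by
  obtain ⟨p, T, hT, hp⟩ := h.reverse
  have hT' : ∃ q : Polynomial ℕ, ∀ a, T a + 11 * (eb (f a)).length ≤ q.eval (size a) := by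
    refine (hT.add ((Bdd.const 11).mul h.bdd_size)).mono fun a => ?_
    have := length_le_size (eb (f a))
    omega
  obtain ⟨q, hq⟩ := hT'
  refine Prog.computableInPolyTime (.seq readWord (.seq p writeWord))
    (q.comp (10 * Polynomial.X + 1) + 13 * Polynomial.X + 4) fun a => ?_
  have h1 := exec_readWord (ea a)
  rw [← he] at h1
  have h2 := hp a [] []
  simp only [List.append_nil] at h2
  have h3 := exec_writeWord (eb (f a)).reverse []
  simp only [List.append_nil, List.reverse_reverse, List.length_reverse] at h3
  refine (h1.seq (h2.seq h3)).mono ?_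
  have h4 : size a ≤ 10 * (ea a).length + 1 := by
    have : size a = size (ea a) := congrArg Tree.size (he a)
    rw [this, mul_comm]
    exact size_le_of_forall_mem fun s _ => size_sym_le s
  have h5 := hq a
  have h6 := eval_mono q h4
  simp only [Polynomial.eval_add, Polynomial.eval_comp, Polynomial.eval_mul, Polynomial.eval_X,
    Polynomial.eval_one, Polynomial.eval_ofNat] at *
  omega

/-! ### Parsing -/

/-- The list whose code is a given tree. -/
def Tree.toList : Tree → List Tree
  | .nil => []
  | .node a b => a :: b.toList

theorem Tree.enc_toList (t : Tree) : enc t.toList = t := by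
  induction t with
  | nil => rfl
  | node a b _ ih => rw [toList, enc_cons, ih]; rfl

theorem Tree.toList_enc {α : Type} [Enc α] (l : List α) : (enc l).toList = l.map enc := by
  induction l with
  | nil => rfl
  | cons a l ih => rw [enc_cons, toList, ih]; rfl

/-- The tree that stands for a minus sign: it is not the code of a natural number. -/
def negTree : Tree := enc [[true]]

/-- One step of the parser. The state is a stack, whose entries contain the items inside of the
brackets that are open, in reverse order. -/
def parseStep (st : List (List Tree)) (s : Sym) : List (List Tree) :=
  bif decide (s = .left) then [] :: st
  else bif decide (s = .right) then
    (enc (st.headD []).reverse :: st.tail.headD []) :: st.tail.tail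
  else bif decide (s = .neg) then (negTree :: st.headD []) :: st.tail
  else (enc (decide (s = .bit true)) :: st.headD []) :: st.tail

/-- The parser. It yields the list of the items in a word. -/
def parse (w : List Sym) : List Tree := ((w.foldl parseStep [[]]).headD []).reverse

/-- The word `w` consists of the items `l`. -/
def Parses (w : List Sym) (l : List Tree) : Prop :=
  ∀ a st, w.foldl parseStep (a :: st) = (l.reverse ++ a) :: st

theorem Parses.parse {w : List Sym} {l : List Tree} (h : Parses w l) : parse w = l := by
  simp [Holant.parse, h [] []]

theorem Parses.nil : Parses [] [] := fun _ _ => rfl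

theorem Parses.append {w w' : List Sym} {l l' : List Tree} (h : Parses w l) (h' : Parses w' l') :
    Parses (w ++ w') (l ++ l') := fun a st => by
  rw [List.foldl_append, h, h', List.reverse_append, List.append_assoc]

theorem Parses.flatMap {X : Type} {e : X → List Sym} {g : X → List Tree} {l : List X}
    (h : ∀ x ∈ l, Parses (e x) (g x)) : Parses (l.flatMap e) (l.flatMap g) := by
  induction l with
  | nil => exact .nil
  | cons x l ih =>
    exact (h x List.mem_cons_self).append (ih fun y hy => h y (List.mem_cons_of_mem _ hy))

theorem Parses.encList {X : Type} {e : X → List Sym} {g : X → List Tree} {l : List X}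
    (h : ∀ x ∈ l, Parses (e x) (g x)) : Parses (encList e l) [enc (l.flatMap g)] := fun a st => by
  rw [Holant.encList, List.foldl_cons, List.foldl_append]
  have h1 : parseStep (a :: st) .left = [] :: a :: st := by simp [parseStep]
  rw [h1, Parses.flatMap h]
  simp [parseStep]

theorem Parses.bit (b : Bool) : Parses [.bit b] [enc b] := fun a st => by
  simp [parseStep]

theorem Parses.encNat (n : ℕ) : Parses (encNat n) [enc n] := by
  have h := Parses.encList (e := fun b => [Sym.bit b]) (g := fun b => [enc b]) (l := n.bits)
    fun b _ => .bit b
  have h2 : enc (n.bits.flatMap fun b => [enc b]) = enc n := by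
    rw [← List.map_eq_flatMap, ← Tree.toList_enc, Tree.enc_toList]; rfl
  rwa [h2] at h

theorem size_parseStep (st : List (List Tree)) (s : Sym) :
    size (parseStep st s) ≤ size st + 20 := by
  have h1 : size (st.headD []) + size st.tail ≤ size st + 1 := by
    cases st <;> simp
    omega
  have h2 : size (st.tail.headD []) + size st.tail.tail ≤ size st.tail + 1 := by
    cases st.tail <;> simp
    omega
  have h3 : size (enc (st.headD []).reverse) = size (st.headD []) := size_reverse _
  have h4 : size negTree ≤ 12 := by decide
  have h5 : size (enc (decide (s = .bit true))) ≤ 3 := size_bool_le _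
  unfold parseStep
  rcases s with b | _ | _ | _ <;> simp at * <;> omega

section
variable {γ : Type} [Enc γ]

@[fun_prop]
theorem PT.toList {f : γ → Tree} (hf : PT f) : PT fun c => (f c).toList :=
  hf.congr_enc fun _ => (Tree.enc_toList _).symm

@[fun_prop]
theorem PT.enc {α : Type} [Enc α] {f : γ → α} (hf : PT f) : PT fun c => enc (f c) :=
  hf.congr_enc fun _ => rfl

@[fun_prop]
theorem PT.parse {f : γ → List Sym} (hf : PT f) : PT fun c => parse (f c) := by
  have h1 : PT fun t : γ × List (List Tree) × Sym => parseStep t.2.1 t.2.2 := by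
    unfold parseStep
    fun_prop
  have h2 := PT.foldl_of_le (step := fun _ st s => parseStep st s) (init := fun _ => [[]]) hf
    (by fun_prop) h1 (F := fun _ => 20) (.const 20) fun _ st s => size_parseStep st s
  unfold Holant.parse
  fun_prop

end

/-! ### The data of a signature grid -/

/-- Is the tree the one for a minus sign? The test is correct for codes of natural numbers. -/
def isNeg (t : Tree) : Bool := !((t.toList.headD .nil).toList.headD .nil).toList.isEmpty

/-- Combine each minus sign with the item that follows it. -/
def signs (l : List Tree) : List (Bool × Tree) :=
  l.foldr (fun t acc => bif isNeg t then
    acc.head?.elim [] (fun p => (true, p.2) :: acc.tail) else (false, t) :: acc) []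

/-- Cut a list, starting from its end, into pieces that are complete according to `full`. -/
def group (full : List Tree → Bool) (l : List Tree) : List (List Tree) :=
  (l.foldr (fun t s => bif full (t :: s.1) then ([], (t :: s.1) :: s.2) else (t :: s.1, s.2))
    (([] : List Tree), ([] : List (List Tree)))).2

/-- The data of a row, from its three items. -/
def rawRow (l : List Tree) : Tree × (List (List (Bool × Tree)) × Tree) :=
  (l.headD .nil, ((l.tail.headD .nil).toList.map fun t => signs t.toList, l.tail.tail.headD .nil))

/-- The data of a vertex, from its two items. -/
def rawVtx (l : List Tree) : Tree × List (Tree × (List (List (Bool × Tree)) × Tree)) :=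
  (l.headD .nil,
    (group (fun l => !l.tail.tail.isEmpty) (l.tail.headD .nil).toList).map rawRow)

/-- The data of a signature grid, from its three items. -/
def rawData (l : List Tree) : List (List (Bool × Tree)) ×
    List (Tree × List (Tree × (List (List (Bool × Tree)) × Tree))) :=
  ((l.headD .nil).toList.map fun t => signs t.toList,
    (group (fun l => !l.tail.isEmpty) (l.tail.tail.headD .nil).toList).map rawVtx)

section
variable {γ : Type} [Enc γ]

@[fun_prop]
theorem PT.isNeg {f : γ → Tree} (hf : PT f) : PT fun c => isNeg (f c) := by
  unfold Holant.isNeg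
  fun_prop

@[fun_prop]
theorem PT.signs {f : γ → List Tree} (hf : PT f) : PT fun c => signs (f c) := by
  refine PT.foldr_of_le (step := fun _ t (acc : List (Bool × Tree)) => bif Holant.isNeg t then
    acc.head?.elim [] (fun p => (true, p.2) :: acc.tail) else (false, t) :: acc) hf (by fun_prop)
    (PT.cond (by fun_prop) (PT.elim (by fun_prop) (by fun_prop) (by fun_prop)) (by fun_prop))
    (F := fun t => size t.2 + 10) (PT.snd'.bdd_size.add (.const 10)) fun _ t acc => ?_
  have h1 : size true = 3 := rfl
  have h2 : size false = 1 := rfl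
  cases Holant.isNeg t
  · simp; omega
  · rcases acc with _ | ⟨p, acc⟩
    · simp
    · obtain ⟨b, p⟩ := p
      have := size_pos b
      simp; omega

theorem PT.group {full : List Tree → Bool} (hfull : PT full) {f : γ → List Tree} (hf : PT f) :
    PT fun c => group full (f c) := by
  have h : PT fun t : γ × Tree × (List Tree × List (List Tree)) => full (t.2.1 :: t.2.2.1) :=
    hfull.comp (f := fun t : γ × Tree × (List Tree × List (List Tree)) => t.2.1 :: t.2.2.1)
      (by fun_prop)
  refine PT.snd (PT.foldr_of_le (step := fun _ t (s : List Tree × List (List Tree)) =>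
    bif full (t :: s.1) then ([], (t :: s.1) :: s.2) else (t :: s.1, s.2)) hf (by fun_prop)
    (PT.cond h (by fun_prop) (by fun_prop)) (F := fun t => size t.2 + 10)
    (PT.snd'.bdd_size.add (.const 10)) fun _ t s => ?_)
  obtain ⟨p, out⟩ := s
  cases full (t :: p) <;> simp <;> omega

@[fun_prop]
theorem PT.rawRow {f : γ → List Tree} (hf : PT f) : PT fun c => rawRow (f c) :=
  (by fun_prop : PT _).prodMk ((PT.map (f := fun _ (t : Tree) => Holant.signs t.toList)
    (by fun_prop)
    (by fun_prop)).prodMk (by fun_prop))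

@[fun_prop]
theorem PT.rawVtx {f : γ → List Tree} (hf : PT f) : PT fun c => rawVtx (f c) :=
  (by fun_prop : PT _).prodMk (PT.map (f := fun _ t => Holant.rawRow t)
    (PT.group (by fun_prop) (by fun_prop)) (by fun_prop))

@[fun_prop]
theorem PT.rawData {f : γ → List Tree} (hf : PT f) : PT fun c => rawData (f c) :=
  (PT.map (f := fun _ (t : Tree) => Holant.signs t.toList) (by fun_prop) (by fun_prop)).prodMk
    (PT.map (f := fun _ t => Holant.rawVtx t) (PT.group (by fun_prop) (by fun_prop)) (by fun_prop))

end

/-- The items in the code of an integer. -/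
def intItems (z : ℤ) : List Tree :=
  if z < 0 then [negTree, enc z.natAbs] else [enc z.natAbs]

/-- The item for an element of `ℤ[α]`. -/
def cycTree (c : CycInt) : Tree := enc ((List.ofFn c).flatMap intItems)

/-- The items for a row. -/
def rowItems (r : List (ZMod 2) × AlgNum) : List Tree :=
  [enc (r.1.map fun b => decide (b = 1)), enc (r.2.coeffs.map cycTree), enc r.2.den]

/-- The items for a vertex. -/
def vtxItems {m : ℕ} (v : Vertex m) : List Tree :=
  [enc (v.edges.map fun e : Fin m => (e : ℕ)), enc (v.table.flatMap rowItems)]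

/-- Signs and absolute values of the coordinates. -/
def cycOf (c : CycInt) : Cyc := (List.ofFn c).map fun z => (decide (z < 0), z.natAbs)

/-- The data of a row. -/
def rowOf (r : List (ZMod 2) × AlgNum) : Row :=
  (r.1.map fun b => decide (b = 1), (r.2.coeffs.map cycOf, r.2.den))

/-- The data of a vertex. -/
def vtxOf {m : ℕ} (v : Vertex m) : Vtx := (v.edges.map fun e : Fin m => (e : ℕ), v.table.map rowOf)

/-- The data of a signature grid. -/
def dataOf (Ω : Grid) : Data := (Ω.modulus.map cycOf, Ω.vertices.map vtxOf)

theorem Parses.encInt (z : ℤ) : Parses (encInt z) (intItems z) := by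
  unfold Holant.encInt intItems
  split_ifs
  · exact Parses.append (w := [.neg]) (l := [negTree]) (fun a st => by simp [parseStep]) (.encNat _)
  · exact .encNat _

theorem Parses.encCycInt (c : CycInt) : Parses (encCycInt c) [cycTree c] :=
  .encList fun z _ => .encInt z

/-- A list of things that are single items is a single item. -/
theorem Parses.encList_single {X Y : Type} [Enc Y] {e : X → List Sym} {g : X → Y} {l : List X}
    (h : ∀ x ∈ l, Parses (e x) [enc (g x)]) : Parses (Holant.encList e l) [enc (l.map g)] := by
  have h1 := Parses.encList h
  have h2 : enc (l.flatMap fun x => [enc (g x)]) = enc (l.map g) := by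
    rw [← List.map_eq_flatMap, ← Tree.enc_toList (enc (l.map g)), Tree.toList_enc, List.map_map]
    rfl
  rwa [h2] at h1

theorem Parses.encRow (r : List (ZMod 2) × AlgNum) : Parses (encRow r) (rowItems r) :=
  (Parses.encList_single fun _ _ => .bit _).append
    ((Parses.encList_single (g := cycTree) fun c _ => .encCycInt c).append (.encNat _))

theorem Parses.encVertex {m : ℕ} (v : Vertex m) : Parses (encVertex v) (vtxItems v) :=
  Parses.append (l := [enc (v.edges.map fun e : Fin m => (e : ℕ))])
    (Parses.encList_single fun _ _ => .encNat _)
    (Parses.encList (l := v.table) fun r _ => .encRow r)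

theorem Parses.encGrid (Ω : Grid) : Parses (encGrid Ω) [enc (Ω.modulus.map cycTree),
    enc Ω.numEdges, enc (Ω.vertices.flatMap vtxItems)] :=
  ((Parses.encList_single (g := cycTree) fun c _ => .encCycInt c).append (.encNat _)).append
    (.encList fun v _ => .encVertex v)

theorem isNeg_enc_nat (n : ℕ) : isNeg (enc n) = false := by
  have h : (enc n).toList = n.bits.map enc := Tree.toList_enc n.bits
  rw [isNeg, h]
  rcases n.bits with _ | ⟨_ | _, l⟩ <;> rfl

theorem isNeg_negTree : isNeg negTree = true := rfl

theorem Tree.toList_enc_tree (l : List Tree) : (enc l).toList = l := by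
  rw [toList_enc]; exact List.map_id l

theorem signs_cycTree (c : CycInt) : signs (cycTree c).toList =
    (List.ofFn c).map fun z => (decide (z < 0), enc z.natAbs) := by
  rw [cycTree, Tree.toList_enc_tree]
  induction List.ofFn c with
  | nil => rfl
  | cons z l ih =>
    rw [List.flatMap_cons, signs, List.foldr_append, ← signs, ih, intItems]
    split_ifs with h
    · simp [isNeg_enc_nat, isNeg_negTree, h]
    · simp [isNeg_enc_nat, h]

theorem group_flatMap {X : Type} {full : List Tree → Bool} {g : X → List Tree} (l : List X)
    (h : ∀ x out, (g x).foldr (fun t s => bif full (t :: s.1) then ([], (t :: s.1) :: s.2)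
      else (t :: s.1, s.2)) (([] : List Tree), (out : List (List Tree))) = ([], g x :: out)) :
    group full (l.flatMap g) = l.map g := by
  have key : (l.flatMap g).foldr (fun t s => bif full (t :: s.1) then ([], (t :: s.1) :: s.2)
      else (t :: s.1, s.2)) (([] : List Tree), ([] : List (List Tree))) = ([], l.map g) := by
    induction l with
    | nil => rfl
    | cons x l ih => rw [List.flatMap_cons, List.foldr_append, ih, h, List.map_cons]
  rw [group, key]

theorem enc_map_congr {X α β : Type} [Enc α] [Enc β] {f : X → α} {g : X → β} {l : List X}
    (h : ∀ x ∈ l, enc (f x) = enc (g x)) : enc (l.map f) = enc (l.map g) := by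
  induction l with
  | nil => rfl
  | cons x l ih =>
    rw [List.map_cons, List.map_cons, enc_cons, enc_cons, h x List.mem_cons_self,
      ih fun y hy => h y (List.mem_cons_of_mem _ hy)]

theorem enc_signs_cycTree (c : CycInt) : enc (signs (cycTree c).toList) = enc (cycOf c) := by
  rw [signs_cycTree]
  exact enc_map_congr fun z _ => rfl

theorem enc_rawRow (r : List (ZMod 2) × AlgNum) : enc (rawRow (rowItems r)) = enc (rowOf r) := by
  have h : enc ((enc (r.2.coeffs.map cycTree)).toList.map fun t => signs t.toList) =
      enc (r.2.coeffs.map cycOf) := by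
    rw [Tree.toList_enc_tree, List.map_map]
    exact enc_map_congr fun c _ => enc_signs_cycTree c
  exact congrArg (fun t => Tree.node _ (Tree.node t _)) h

theorem enc_rawVtx {m : ℕ} (v : Vertex m) : enc (rawVtx (vtxItems v)) = enc (vtxOf v) := by
  have h : enc ((group (fun l => !l.tail.tail.isEmpty) (enc (v.table.flatMap rowItems)).toList).map
      rawRow) = enc (v.table.map rowOf) := by
    rw [Tree.toList_enc_tree, group_flatMap _ fun r out => rfl, List.map_map]
    exact enc_map_congr fun r _ => enc_rawRow r
  exact congrArg (fun t => Tree.node _ t) h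

theorem enc_rawData (Ω : Grid) : enc (rawData (parse (encGrid Ω))) = enc (dataOf Ω) := by
  rw [(Parses.encGrid Ω).parse]
  have h1 : enc ((enc (Ω.modulus.map cycTree)).toList.map fun t => signs t.toList) =
      enc (Ω.modulus.map cycOf) := by
    rw [Tree.toList_enc_tree, List.map_map]
    exact enc_map_congr fun c _ => enc_signs_cycTree c
  have h2 : enc ((group (fun l => !l.tail.isEmpty)
      (enc (Ω.vertices.flatMap vtxItems)).toList).map rawVtx) = enc (Ω.vertices.map vtxOf) := by
    rw [Tree.toList_enc_tree, group_flatMap _ fun v out => rfl, List.map_map]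
    exact enc_map_congr fun v _ => enc_rawVtx v
  exact congrArg₂ Tree.node h1 h2

/-! ### The word for the result -/

/-- The word for an integer given by sign and absolute value. -/
def signedWord (p : Bool × ℕ) : List Sym := bif p.1 then .neg :: encNat p.2 else encNat p.2

/-- The word for a number. -/
def numWord (a : List Cyc × ℕ) : List Sym := encList (encList signedWord) a.1 ++ encNat a.2

/-- The integer with a given sign and absolute value. -/
def signedInt (p : Bool × ℕ) : ℤ := bif p.1 then -p.2 else p.2

/-- The element of `ℤ[α]` with given coordinates. -/
def cycIntOf (c : Cyc) : CycInt := fun j => signedInt (c.getD j (false, 0))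

/-- The coordinates and denominator, as a structure. -/
def algNumOf (a : List Cyc × ℕ) : AlgNum := ⟨a.1.map cycIntOf, a.2⟩

/-- Four coordinates, with a minus sign only for negative numbers. -/
def IsCanon (c : Cyc) : Prop := c.length = 4 ∧ ∀ p ∈ c, p.1 = true → p.2 ≠ 0

theorem encInt_signedInt {p : Bool × ℕ} (h : p.1 = true → p.2 ≠ 0) :
    encInt (signedInt p) = signedWord p := by
  obtain ⟨_ | _, n⟩ := p
  · simp [signedInt, signedWord, encInt, (Int.natCast_nonneg n).not_gt]
  · have : 0 < n := Nat.pos_of_ne_zero (h rfl)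
    simp [signedInt, signedWord, encInt, this]

theorem encList_map {X Y : Type} (e : Y → List Sym) (g : X → Y) (l : List X) :
    encList e (l.map g) = encList (fun x => e (g x)) l := by
  rw [encList, encList, List.flatMap_map]

theorem encList_congr {X : Type} {e e' : X → List Sym} {l : List X} (h : ∀ x ∈ l, e x = e' x) :
    encList e l = encList e' l := by
  rw [encList, encList, List.flatMap_congr h]

theorem ofFn_cycIntOf {c : Cyc} (h : c.length = 4) : List.ofFn (cycIntOf c) = c.map signedInt := by
  refine List.ext_getElem (by simp [h]) fun j h1 h2 => ?_
  rw [List.getElem_ofFn, List.getElem_map, cycIntOf, List.getD_eq_getElem]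

theorem encAlgNum_algNumOf {a : List Cyc × ℕ} (h : ∀ c ∈ a.1, IsCanon c) :
    encAlgNum (algNumOf a) = numWord a := by
  rw [encAlgNum, algNumOf, numWord, encList_map]
  congr 1
  refine encList_congr fun c hc => ?_
  rw [encCycInt, ofFn_cycIntOf (h c hc).1, encList_map]
  exact encList_congr fun p hp => encInt_signedInt ((h c hc).2 p hp)

theorem isCanon_canon (l : List ℕ) : IsCanon (canon l) := by
  refine ⟨rfl, fun p hp => ?_⟩
  simp only [canon, canonInt, List.mem_cons, List.not_mem_nil, or_false] at hp
  rcases hp with rfl | rfl | rfl | rfl <;> intro h <;> simp at h ⊢ <;> simp [h] <;> omega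

section
variable {γ : Type} [Enc γ]

theorem PT.encList {X : Type} [Enc X] {e : X → List Sym} (he : PT e) {f : γ → List X} (hf : PT f) :
    PT fun c => encList e (f c) := by
  have h1 : PT fun c => (f c).flatMap e := PT.flatMap (f := fun _ x => e x) hf (by fun_prop)
  unfold Holant.encList
  fun_prop

@[fun_prop]
theorem PT.encNat {f : γ → ℕ} (hf : PT f) : PT fun c => encNat (f c) := by
  have h : PT fun b : Bool => [Sym.bit b] :=
    (PT.cons (PT.cond (f := fun _ : Bool => Sym.bit true) (g := fun _ => Sym.bit false) PT.id'
      (by fun_prop) (by fun_prop)) (PT.const [])).congr_enc fun b => by cases b <;> rfl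
  exact PT.encList h (by fun_prop)

@[fun_prop]
theorem PT.numWord {f : γ → List Cyc × ℕ} (hf : PT f) : PT fun c => numWord (f c) := by
  have h : PT signedWord := by
    unfold signedWord
    fun_prop
  exact (PT.encList (PT.encList h PT.id') (by fun_prop)).append (by fun_prop)

end

theorem isCanon_nf {m : List (List ℕ)} {x : Num} {c : Cyc} (h : c ∈ nf m x) : IsCanon c := by
  obtain ⟨l, _, rfl⟩ := List.mem_map.1 h
  exact isCanon_canon _

theorem isCanon_answer (d : Data) : ∀ c ∈ (answer d).1, IsCanon c := by
  unfold answer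
  cases solve (labels d.2) (constraints d.2) with
  | none => exact fun c hc => isCanon_nf hc
  | some s => exact fun c hc => isCanon_nf hc

/-- The algorithm runs in polynomial time, whatever the family of functions. -/
theorem computableInPolyTime_answer (𝓕 : ∀ n : ℕ, Set (CFun n)) :
    Nonempty (Turing.TM2ComputableInPolyTime (fun Ω : Input 𝓕 => encGrid Ω.1) encAlgNum
      fun Ω => algNumOf (answer (dataOf Ω.1))) := by
  let _ : Enc (Input 𝓕) := ⟨fun Ω => enc (encGrid Ω.1)⟩
  refine PT.computableInPolyTime (fun _ => rfl) ?_
  have h1 : PT fun Ω : Input 𝓕 => encGrid Ω.1 := PT.of_enc_eq fun _ => rfl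
  have h2 : PT fun Ω : Input 𝓕 => dataOf Ω.1 :=
    (PT.rawData (PT.parse h1)).congr_enc fun Ω => enc_rawData Ω.1
  exact (PT.numWord (PT.answer.comp h2)).congr_enc fun Ω =>
    congrArg enc (encAlgNum_algNumOf (isCanon_answer _)).symm

/-! ### The numbers that are represented -/

section
open Complex Polynomial
open scoped IntermediateField

theorem alpha_primitive : IsPrimitiveRoot alpha 8 := by
  have h := Complex.isPrimitiveRoot_exp 8 (by norm_num)
  have e : alpha = Complex.exp (2 * Real.pi * I / (8 : ℕ)) := by
    rw [alpha]; congr 1; push_cast; ring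
  rwa [e]

theorem alpha_sq : alpha ^ 2 = I := by
  have h : ((2 : ℕ) : ℂ) * (Real.pi / 4 * I) = Real.pi / 2 * I := by push_cast; ring
  rw [alpha, ← Complex.exp_nat_mul, h, Complex.exp_pi_div_two_mul_I]

theorem alpha_pow_four : alpha ^ 4 = -1 := by
  rw [show (4 : ℕ) = 2 * 2 from rfl, pow_mul, alpha_sq, I_sq]

theorem natDegree_minpoly_alpha : (minpoly ℚ alpha).natDegree = 4 := by
  rw [← cyclotomic_eq_minpoly_rat alpha_primitive (by norm_num), natDegree_cyclotomic]
  decide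

section
variable {R S : Type*}

theorem pval_cons {R : Type} [CommSemiring S] (v : R → S) (x : S) (a : R) (l : List R) :
    pval v x (a :: l) = v a + x * pval v x l := rfl

theorem pval_eq_sum {R : Type} [CommSemiring S] (v : R → S) (x : S) (l : List R) :
    pval v x l = ∑ i : Fin l.length, v (l.get i) * x ^ (i : ℕ) := by
  induction l with
  | nil => rfl
  | cons a l ih =>
    rw [pval_cons, ih]
    simp only [List.length_cons, Fin.sum_univ_succ, Finset.mul_sum]
    simp only [List.get_eq_getElem, Fin.val_zero, pow_zero, mul_one, List.getElem_cons_zero,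
      Fin.val_succ, List.getElem_cons_succ]
    exact congrArg _ (Finset.sum_congr rfl fun i _ => by ring)

theorem pval_map {R R' : Type} [CommSemiring S] (v : R → S) (x : S) (f : R' → R) (l : List R') :
    pval v x (l.map f) = pval (fun a => v (f a)) x l := by
  simp [pval, List.foldr_map]

theorem pval_congr {R : Type} [CommSemiring S] {v v' : R → S} (x : S) {l : List R}
    (h : ∀ a ∈ l, v a = v' a) : pval v x l = pval v' x l := by
  induction l with
  | nil => rfl
  | cons a l ih =>
    rw [pval_cons, pval_cons, h a List.mem_cons_self,
      ih fun b hb => h b (List.mem_cons_of_mem _ hb)]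

end

/-- The value of a polynomial in `α`. -/
def aval (l : List ℕ) : ℂ := pval (fun n : ℕ => (n : ℂ)) alpha l

/-- The value of a polynomial in `α` and `θ`. -/
def nval (θ : ℂ) (x : Num) : ℂ := pval aval θ x

/-- The value of a fraction. -/
def qval (θ : ℂ) (x : Num × ℕ) : ℂ := nval θ x.1 / (x.2 : ℂ)

/-- The element of `ℤ[α]` with the given coordinates. -/
def cval (c : Cyc) : ℂ := pval (fun p => (signedInt p : ℂ)) alpha c

theorem isVal_aval : IsVal aval :=
  IsVal.poly (v := fun n : ℕ => (n : ℂ)) ⟨Nat.cast_add, Nat.cast_mul, Nat.cast_zero⟩ alpha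

theorem isVal_nval (θ : ℂ) : IsVal (nval θ) := isVal_aval.poly θ

theorem aval_nil : aval [] = 0 := rfl

theorem aval_singleton (n : ℕ) : aval [n] = n := by simp [aval, pval]

theorem nval_nil (θ : ℂ) : nval θ [] = 0 := rfl

theorem nval_singleton (θ : ℂ) (l : List ℕ) : nval θ [l] = aval l := by simp [nval, pval]

theorem aval_nprod (l : List (List ℕ)) : aval (nprod [1] l) = (l.map aval).prod := by
  induction l with
  | nil => simp [nprod, aval_singleton]
  | cons a l ih => rw [nprod, List.foldr_cons, ← nprod, isVal_aval.map_mul, ih]; simp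

theorem nval_nprod (θ : ℂ) (l : List Num) : nval θ (nprod [[1]] l) = (l.map (nval θ)).prod := by
  induction l with
  | nil => simp [nprod, nval_singleton, aval_singleton]
  | cons a l ih => rw [nprod, List.foldr_cons, ← nprod, (isVal_nval θ).map_mul, ih]; simp

theorem nprod_nat (l : List ℕ) : nprod 1 l = l.prod := by
  induction l with
  | nil => rfl
  | cons a l ih => rw [nprod, List.foldr_cons, ← nprod, ih, List.prod_cons]; rfl

theorem aval_ipow {k : ℕ} (hk : k < 4) : aval (ipow k) = I ^ k := by
  have h4 := alpha_pow_four
  rw [← alpha_sq]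
  interval_cases k <;> simp [ipow, aval, pval] <;> ring

theorem signedInt_canonInt (a b : ℕ) : signedInt (canonInt a b) = (a : ℤ) - b := by
  by_cases h : a < b
  · simp [canonInt, signedInt, h, Nat.cast_sub h.le]
  · simp [canonInt, signedInt, h, Nat.cast_sub (not_lt.1 h)]

theorem cval_canon {l : List ℕ} (hl : l.length = 8) : cval (canon l) = aval l := by
  match l, hl with
  | [a0, a1, a2, a3, a4, a5, a6, a7], _ =>
    simp only [cval, canon, pval_cons, List.headD_cons, List.tail_cons, signedInt_canonInt, aval]
    simp only [pval, List.foldr_nil]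
    push_cast
    linear_combination
      (-(a4 : ℂ) - a5 * alpha - a6 * alpha ^ 2 - a7 * alpha ^ 3) * alpha_pow_four

theorem aval_cycPoly {c : Cyc} (hc : c.length = 4) : aval (cycPoly c) = cval c := by
  rw [cycPoly, aval, pval_append, List.length_map, hc, alpha_pow_four, pval_map, pval_map]
  clear hc
  induction c with
  | nil => simp [cval, pval]
  | cons p c ih =>
    rw [cval, pval_cons, pval_cons, pval_cons, ← cval, ← ih]
    obtain ⟨_ | _, n⟩ := p <;> simp [signedInt] <;> ring

theorem nval_nf {θ : ℂ} {m : List (List ℕ)} (hm : m ≠ []) (hθ : θ ^ m.length = nval θ m) (x : Num) :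
    pval cval θ (nf m x) = nval θ x := by
  have h8 : alpha ^ 8 = 1 := alpha_primitive.pow_eq_one
  rw [nf, pval_map, nval, ← pval_red isVal_aval hm hθ x]
  refine pval_congr _ fun l _ => ?_
  rw [cval_canon (length_red (by simp) l)]
  refine pval_red (v := fun n : ℕ => (n : ℂ)) ⟨Nat.cast_add, Nat.cast_mul, Nat.cast_zero⟩
    (by simp) ?_ l
  simp [pval, h8]

theorem length_nf {m : List (List ℕ)} (hm : m ≠ []) (x : Num) : (nf m x).length = m.length := by
  rw [nf, List.length_map, length_red hm]

theorem signedInt_injOn {p p' : Bool × ℕ} (hp : p.1 = true → p.2 ≠ 0) (hp' : p'.1 = true → p'.2 ≠ 0)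
    (h : signedInt p = signedInt p') : p = p' := by
  obtain ⟨_ | _, n⟩ := p <;> obtain ⟨_ | _, n'⟩ := p' <;> simp [signedInt] at * <;> omega

/-- Elements of `ℤ[α]` are equal only if they have the same coordinates. -/
theorem cval_injOn {c c' : Cyc} (hc : IsCanon c) (hc' : IsCanon c') (h : cval c = cval c') :
    c = c' := by
  have hli := linearIndependent_pow (K := ℚ) alpha
  rw [natDegree_minpoly_alpha] at hli
  have hl : c.length = c'.length := hc.1.trans hc'.1.symm
  rw [Fintype.linearIndependent_iff] at hli
  have h0 : ∀ (c : Cyc) (h4 : c.length = 4), cval c =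
      ∑ i : Fin 4, ((signedInt (c.get (i.cast h4.symm)) : ℤ) : ℂ) * alpha ^ (i : ℕ) := by
    intro c h4
    rw [cval, pval_eq_sum]
    exact (Equiv.sum_comp (finCongr h4.symm) _).symm
  have h1 := hli (fun i => (signedInt (c.get (i.cast hc.1.symm)) : ℚ) -
    signedInt (c'.get (i.cast hc'.1.symm))) (by
      rw [h0 c hc.1, h0 c' hc'.1, ← sub_eq_zero, ← Finset.sum_sub_distrib] at h
      rw [← h]
      refine Finset.sum_congr rfl fun i _ => ?_
      rw [Algebra.smul_def]
      simp
      ring)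
  refine List.ext_getElem hl fun i h2 h3 => ?_
  refine signedInt_injOn (hc.2 _ (List.getElem_mem _)) (hc'.2 _ (List.getElem_mem _)) ?_
  have := h1 ⟨i, hc.1 ▸ h2⟩
  rw [sub_eq_zero] at this
  exact_mod_cast this

theorem signedInt_natAbs (z : ℤ) : signedInt (decide (z < 0), z.natAbs) = z := by
  by_cases hz : z < 0
  · simp [signedInt, hz, abs_of_neg hz]
  · simp [signedInt, hz, abs_of_nonneg (not_lt.1 hz)]

theorem cval_cycOf (c : CycInt) : cval (cycOf c) = c.value := by
  rw [cval, cycOf, pval_map, CycInt.value, pval_eq_sum]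
  simp only [signedInt_natAbs]
  rw [← Equiv.sum_comp (finCongr (List.length_ofFn (f := c)).symm)]
  exact Finset.sum_congr rfl fun j _ => by rw [List.get_ofFn]; rfl

theorem length_cycOf (c : CycInt) : (cycOf c).length = 4 := by simp [cycOf]

theorem isCanon_cycOf (c : CycInt) : IsCanon (cycOf c) := by
  refine ⟨length_cycOf c, fun p hp => ?_⟩
  obtain ⟨z, _, rfl⟩ := List.mem_map.1 hp
  simp; omega

/-! ### The field generated by `α` and `θ` -/

/-- The elements of `ℤ[α]` lie in `ℚ(α)`. -/
theorem exists_algebraMap_eq_cval (c : Cyc) : ∃ k : ℚ⟮alpha⟯, algebraMap ℚ⟮alpha⟯ ℂ k = cval c := by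
  refine ⟨pval (fun p => ((signedInt p : ℤ) : ℚ⟮alpha⟯))
    (IntermediateField.AdjoinSimple.gen ℚ alpha) c,
    ?_⟩
  induction c with
  | nil => simp [cval, pval]
  | cons p c ih =>
    rw [cval, pval_cons, pval_cons, ← cval, ← ih, map_add, map_mul,
      IntermediateField.AdjoinSimple.algebraMap_gen]
    simp

section
variable {m : List CycInt} {θ : ℂ}

theorem Describes.natDegree (h : Describes m θ) : (minpoly ℚ⟮alpha⟯ θ).natDegree = m.length := by
  rw [← natDegree_map (algebraMap ℚ⟮alpha⟯ ℂ), h, modulusPoly]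
  have h1 := degree_sum_fin_lt fun i => (m.get i).value
  refine natDegree_eq_of_degree_eq_some ?_
  rw [degree_add_eq_left_of_degree_lt (by rwa [degree_X_pow]), degree_X_pow]

theorem Describes.pow_eq (h : Describes m θ) : θ ^ m.length = -pval CycInt.value θ m := by
  have h1 : (modulusPoly m).eval θ = 0 := by
    rw [← h, eval_map_algebraMap, minpoly.aeval]
  rw [modulusPoly, eval_add, eval_pow, eval_X, eval_finsetSum] at h1
  rw [pval_eq_sum, eq_neg_iff_add_eq_zero, ← h1]
  simp

theorem Describes.ne_nil (h : Describes m θ) : m ≠ [] := by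
  rintro rfl
  have := h.pow_eq
  simp [pval] at this

theorem nval_negModulus (m : List CycInt) (θ : ℂ) :
    nval θ (negModulus (m.map cycOf)) = -pval CycInt.value θ m := by
  rw [nval, negModulus, List.map_map, pval_map]
  induction m with
  | nil => simp [pval]
  | cons c m ih =>
    rw [pval_cons, pval_cons, ih, Function.comp, isVal_aval.map_mul, aval_cycPoly (length_cycOf c),
      cval_cycOf]
    have : aval [0, 0, 0, 0, 1] = -1 := by
      rw [← alpha_pow_four]
      simp [aval, pval]; ring
    rw [this]; ring

theorem Describes.negModulus_ne (h : Describes m θ) : negModulus (m.map cycOf) ≠ [] := by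
  simpa [negModulus] using h.ne_nil

theorem Describes.pow_eq_nval (h : Describes m θ) :
    θ ^ (negModulus (m.map cycOf)).length = nval θ (negModulus (m.map cycOf)) := by
  rw [nval_negModulus, ← h.pow_eq]
  simp [negModulus]

theorem Describes.nval_nf (h : Describes m θ) (x : Num) :
    pval cval θ (nf (negModulus (m.map cycOf)) x) = nval θ x :=
  Holant.nval_nf h.negModulus_ne h.pow_eq_nval x

theorem Describes.length_nf (h : Describes m θ) (x : Num) :
    (nf (negModulus (m.map cycOf)) x).length = m.length := by
  rw [Holant.length_nf h.negModulus_ne]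
  simp [negModulus]

/-- Numbers are equal only if they have the same coordinates. -/
theorem Describes.eq_of_pval_eq (h : Describes m θ) {l l' : List Cyc} (hl : l.length = m.length)
    (hl' : l'.length = m.length) (hc : ∀ c ∈ l, IsCanon c) (hc' : ∀ c ∈ l', IsCanon c)
    (he : pval cval θ l = pval cval θ l') : l = l' := by
  have hli := linearIndependent_pow (K := ℚ⟮alpha⟯) θ
  rw [h.natDegree, Fintype.linearIndependent_iff] at hli
  choose k hk using exists_algebraMap_eq_cval
  have h0 : ∀ (l : List Cyc) (h4 : l.length = m.length), pval cval θ l =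
      ∑ i : Fin m.length, k (l.get (i.cast h4.symm)) • θ ^ (i : ℕ) := by
    intro l h4
    rw [pval_eq_sum, ← Equiv.sum_comp (finCongr h4.symm)]
    refine Finset.sum_congr rfl fun i _ => ?_
    rw [Algebra.smul_def, hk]
    rfl
  have h1 := hli (fun i => k (l.get (i.cast hl.symm)) - k (l'.get (i.cast hl'.symm))) (by
    rw [h0 l hl, h0 l' hl', ← sub_eq_zero, ← Finset.sum_sub_distrib] at he
    rw [← he]
    exact Finset.sum_congr rfl fun i _ => sub_smul _ _ _)
  refine List.ext_getElem (hl.trans hl'.symm) fun i h2 h3 => ?_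
  refine cval_injOn (hc _ (List.getElem_mem _)) (hc' _ (List.getElem_mem _)) ?_
  have := h1 ⟨i, hl ▸ h2⟩
  rw [sub_eq_zero] at this
  have := congrArg (algebraMap ℚ⟮alpha⟯ ℂ) this
  rwa [hk, hk] at this

theorem Describes.nf_eq_iff (h : Describes m θ) (x y : Num) : nf (negModulus (m.map cycOf)) x =
    nf (negModulus (m.map cycOf)) y ↔ nval θ x = nval θ y := by
  refine ⟨fun e => by rw [← h.nval_nf x, e, h.nval_nf], fun e => ?_⟩
  exact h.eq_of_pval_eq (h.length_nf x) (h.length_nf y) (fun c => isCanon_nf) (fun c => isCanon_nf)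
    (by rw [h.nval_nf, h.nval_nf, e])

/-- The test compares `x` and `i ^ k * y` after multiplication with both denominators. -/
theorem Describes.isMul_iff (h : Describes m θ) {k : ℕ} (hk : k < 4) {x y : Num × ℕ} (hx : x.2 ≠ 0)
    (hy : y.2 ≠ 0) :
    isMul (negModulus (m.map cycOf)) k x y = true ↔ qval θ x = I ^ k * qval θ y := by
  rw [isMul, decide_eq_true_iff, h.nf_eq_iff]
  have hx' : (x.2 : ℂ) ≠ 0 := Nat.cast_ne_zero.2 hx
  have hy' : (y.2 : ℂ) ≠ 0 := Nat.cast_ne_zero.2 hy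
  simp only [(isVal_nval θ).map_mul, nval_singleton, aval_singleton, aval_ipow hk, qval]
  rw [← mul_div_assoc, div_eq_div_iff hx' hy', mul_assoc]

theorem Describes.phase_spec (h : Describes m θ) {k : ℕ} (hk : k < 4) {x y : Num × ℕ}
    (hx : x.2 ≠ 0) (hy : y.2 ≠ 0)
    (e : qval θ x = I ^ k * qval θ y) : phase (negModulus (m.map cycOf)) x y < 4 ∧
      qval θ x = I ^ phase (negModulus (m.map cycOf)) x y * qval θ y := by
  have h0 := h.isMul_iff (k := 0) (by norm_num) hx hy
  have h1 := h.isMul_iff (k := 1) (by norm_num) hx hy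
  have h2 := h.isMul_iff (k := 2) (by norm_num) hx hy
  unfold phase
  cases e0 : isMul (negModulus (m.map cycOf)) 0 x y
  · cases e1 : isMul (negModulus (m.map cycOf)) 1 x y
    · cases e2 : isMul (negModulus (m.map cycOf)) 2 x y
      · rw [e0] at h0; rw [e1] at h1; rw [e2] at h2
        interval_cases k
        · simp [e] at h0
        · simp [e] at h1
        · simp [e] at h2
        · exact ⟨by simp, by simpa using e⟩
      · exact ⟨by simp, by simpa using h2.1 e2⟩
    · exact ⟨by simp, by simpa using h1.1 e1⟩
  · exact ⟨by simp, by simpa using h0.1 e0⟩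

/-- The value of the output of the algorithm. -/
theorem Describes.value_algNumOf (h : Describes m θ) (x : Num) (q : ℕ) :
    (algNumOf (nf (negModulus (m.map cycOf)) x, q)).value θ = qval θ (x, q) := by
  rw [AlgNum.value, qval, ← h.nval_nf x]
  congr 1
  have h1 : ∀ c : Cyc, IsCanon c → (cycIntOf c).value = cval c := fun c hc => by
    rw [← cval_cycOf, cval, cval, cycOf, ofFn_cycIntOf hc.1, List.map_map, pval_map]
    refine pval_congr _ fun p hp => ?_
    rw [Function.comp, signedInt_natAbs]
  rw [← pval_congr θ (fun c hc => h1 c (isCanon_nf hc)), ← pval_map CycInt.value θ cycIntOf,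
    pval_eq_sum]
  rfl

theorem Describes.wellFormed_algNumOf (h : Describes m θ) (x : Num) {q : ℕ} (hq : 0 < q) :
    (algNumOf (nf (negModulus (m.map cycOf)) x, q)).WellFormed m.length :=
  ⟨by simp [algNumOf, h.length_nf], hq⟩

/-- By linear independence, a number vanishes only if all its coordinates do, so that the test
`rowNonzero` is correct. -/
theorem Describes.rowNonzero_iff (h : Describes m θ) {r : List (ZMod 2) × AlgNum}
    (hr : r.2.WellFormed m.length) :
    rowNonzero (rowOf r) = true ↔ r.2.value θ ≠ 0 := by
  have hq : (r.2.den : ℂ) ≠ 0 := Nat.cast_ne_zero.2 hr.2.ne'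
  have h1 : r.2.value θ = pval cval θ (r.2.coeffs.map cycOf) / r.2.den := by
    rw [AlgNum.value, pval_map, pval_eq_sum]
    simp only [cval_cycOf]
  have h3 : rowNonzero (rowOf r) = false ↔
      r.2.coeffs.map cycOf = (r.2.coeffs.map cycOf).map fun _ => List.replicate 4 (false, 0) := by
    have hz : ∀ c ∈ r.2.coeffs.map cycOf, ((c.any fun p => !decide (p.2 = 0)) = false ↔
        c = List.replicate 4 (false, 0)) := fun c hc => by
      obtain ⟨c', _, rfl⟩ := List.mem_map.1 hc
      have hcc := isCanon_cycOf c'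
      constructor
      · intro h5
        rw [List.eq_replicate_iff]
        refine ⟨hcc.1, fun p hp => ?_⟩
        have h6 := List.any_eq_false.1 h5 p hp
        have h7 := hcc.2 p hp
        obtain ⟨_ | _, n⟩ := p <;> simp_all
      · intro h5; rw [h5]; simp
    rw [rowNonzero, List.any_eq_false, rowOf]
    constructor
    · intro h4
      conv_lhs => rw [← List.map_id (r.2.coeffs.map cycOf)]
      refine List.map_congr_left fun c hc => ?_
      exact (hz c hc).1 (by simpa using h4 c hc)
    · intro h4 c hc
      have : c = List.replicate 4 (false, 0) := by
        rw [h4] at hc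
        obtain ⟨_, _, rfl⟩ := List.mem_map.1 hc
        rfl
      simp [this]
  have h2 : rowNonzero (rowOf r) = false ↔ r.2.value θ = 0 := by
    rw [h3, h1, div_eq_zero_iff, or_iff_left hq]
    have h4 : pval cval θ ((r.2.coeffs.map cycOf).map fun _ => List.replicate 4 (false, 0)) =
        0 := by
      rw [pval_map]
      induction r.2.coeffs.map cycOf with
      | nil => rfl
      | cons c l ih => rw [pval_cons, ih]; simp [cval, pval, signedInt]
    constructor
    · intro h5; rw [h5]; exact h4
    · intro h5
      refine h.eq_of_pval_eq (by simp [hr.1]) (by simp [hr.1]) ?_ ?_ (h5.trans h4.symm)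
      · intro c hc
        obtain ⟨c', _, rfl⟩ := List.mem_map.1 hc
        exact isCanon_cycOf c'
      · intro c hc
        obtain ⟨c', _, rfl⟩ := List.mem_map.1 hc
        exact ⟨rfl, by simp⟩
  rw [← not_iff_not, not_not, ← h2, Bool.not_eq_true]

end

/-- The value of a row. -/
theorem qval_rowNum (θ : ℂ) (q : AlgNum) :
    qval θ (rowNum (q.coeffs.map cycOf, q.den)) = q.value θ := by
  rw [qval, rowNum, AlgNum.value, nval, List.map_map, pval_map]
  congr 1
  rw [pval_eq_sum]
  refine Finset.sum_congr rfl fun i _ => ?_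
  rw [Function.comp, aval_cycPoly (length_cycOf _), cval_cycOf]

end

/-! ### Affine spaces over the field with two elements -/

theorem cutAux_cons {V : Type} (op : V → V → V) (b : V) (t : Bool) (l : List (V × Bool)) :
    cutAux op ((b, t) :: l) = bif t then
        (match (cutAux op l).1 with
          | none => (some b, (cutAux op l).2)
          | some q => (some q, op b q :: (cutAux op l).2))
        else ((cutAux op l).1, b :: (cutAux op l).2) := rfl

section
variable {W : Type} [AddCommGroup W]

/-- The points of the affine space through `p` in the directions `B`, with multiplicities. -/
def points : List W → W → Multiset W
  | [], p => {p}
  | b :: B, p => points B p + points B (p + b)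

theorem points_add (B : List W) (p b : W) : points B (p + b) = (points B p).map (· + b) := by
  induction B generalizing p with
  | nil => simp [points]
  | cons c B ih => rw [points, points, ih, Multiset.map_add, ← ih, ← ih, add_right_comm]

theorem points_cons (b : W) (B : List W) (p : W) :
    points (b :: B) p = points B p + (points B p).map (· + b) := by
  rw [points, points_add]

theorem mem_points_self (B : List W) (p : W) : p ∈ points B p := by
  induction B with
  | nil => simp [points]
  | cons b B ih => exact Multiset.mem_add.2 (.inl ih)

/-- A set that contains the base point and is closed under addition of the directions contains the
whole affine space. -/
theorem points_induction {B : List W} {p : W} {T : W → Prop} (hp : T p)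
    (h : ∀ y ∈ points B p, ∀ b ∈ B, T y → T (y + b)) : ∀ y ∈ points B p, T y := by
  induction B generalizing p with
  | nil => simpa [points] using hp
  | cons c B ih =>
    intro y hy
    rcases Multiset.mem_add.1 hy with hy | hy
    · exact ih hp (fun z hz b hb => h z (Multiset.mem_add.2 (.inl hz)) b
        (List.mem_cons_of_mem _ hb)) y hy
    · exact ih (h p (mem_points_self _ _) c List.mem_cons_self hp) (fun z hz b hb =>
        h z (Multiset.mem_add.2 (.inr hz)) b (List.mem_cons_of_mem _ hb)) y hy

theorem points_swap (b c : W) (B : List W) (p : W) :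
    points (b :: c :: B) p = points (c :: b :: B) p := by
  simp only [points, add_right_comm p b c]
  abel

/-- Replacing a direction by its sum with another one does not change the affine space. -/
theorem points_transvection (h2 : ∀ x : W, x + x = 0) (b c : W) (B : List W) (p : W) :
    points (b :: c :: B) p = points (c :: (b + c) :: B) p := by
  have h3 : p + c + (b + c) = p + b := by
    rw [show p + c + (b + c) = p + b + (c + c) by abel, h2, add_zero]
  simp only [points, h3, ← add_assoc p b c]
  abel

theorem add_mem_points (h2 : ∀ x : W, x + x = 0) {B : List W} {p y b : W} (hb : b ∈ B)
    (hy : y ∈ points B p) : y + b ∈ points B p := by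
  induction B generalizing p with
  | nil => simp at hb
  | cons c B ih =>
    rcases List.mem_cons.1 hb with rfl | hb
    · rw [points_cons] at hy ⊢
      rw [Multiset.mem_add, Multiset.mem_map] at hy ⊢
      rcases hy with hy | ⟨z, hz, rfl⟩
      · exact .inr ⟨y, hy, rfl⟩
      · left; rwa [add_assoc, h2, add_zero]
    · rcases Multiset.mem_add.1 hy with hy | hy
      · exact Multiset.mem_add.2 (.inl (ih hb hy))
      · exact Multiset.mem_add.2 (.inr (ih hb hy))

/-- A map that sends directions to directions sends affine spaces to affine spaces. -/
theorem points_map {W' : Type} [AddCommGroup W'] (g : W → W') (l : List (W × W')) (p : W)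
    (h : ∀ y ∈ points (l.map Prod.fst) p, ∀ b ∈ l, g (y + b.1) = g y + b.2) :
    points (l.map Prod.snd) (g p) = (points (l.map Prod.fst) p).map g := by
  induction l generalizing p with
  | nil => simp [points]
  | cons b l ih =>
    rw [List.map_cons, List.map_cons, points, points, Multiset.map_add,
      ih p fun y hy c hc => h y (Multiset.mem_add.2 (.inl hy)) c (List.mem_cons_of_mem _ hc),
      ← h p (mem_points_self _ _) b List.mem_cons_self,
      ih _ fun y hy c hc => h y (Multiset.mem_add.2 (.inr hy)) c (List.mem_cons_of_mem _ hc)]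

/-- Elimination does not change the affine spaces. The form has value `0` on the kernel part, and
`1` on the pivot. -/
theorem cutAux_spec (h2 : ∀ x : W, x + x = 0) (l : List (W × Bool)) :
    (∀ p, points (l.map Prod.fst) p =
      points ((cutAux (· + ·) l).1.toList ++ (cutAux (· + ·) l).2) p) ∧
    ∀ (p : W) (φ : W → Bool),
      (∀ y ∈ points (l.map Prod.fst) p, ∀ b ∈ l, φ (y + b.1) = (φ y ^^ b.2)) →
      (∀ y ∈ points (l.map Prod.fst) p, ∀ b ∈ (cutAux (· + ·) l).2, φ (y + b) = φ y) ∧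
      ∀ y ∈ points (l.map Prod.fst) p, ∀ q ∈ (cutAux (· + ·) l).1, φ (y + q) = !φ y := by
  induction l with
  | nil => simp [cutAux]
  | cons b l ih =>
    obtain ⟨b, t⟩ := b
    obtain ⟨ih1, ih2⟩ := ih
    have hrec : ∀ (p : W) (φ : W → Bool),
        (∀ y ∈ points (((b, t) :: l).map Prod.fst) p, ∀ b' ∈ (b, t) :: l,
          φ (y + b'.1) = (φ y ^^ b'.2)) →
        ∀ y ∈ points (((b, t) :: l).map Prod.fst) p, φ (y + b) = (φ y ^^ t) ∧
          (∀ b' ∈ (cutAux (· + ·) l).2, φ (y + b') = φ y) ∧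
          ∀ q ∈ (cutAux (· + ·) l).1, φ (y + q) = !φ y := by
      intro p φ hφ y hy
      refine ⟨hφ y hy _ List.mem_cons_self, ?_⟩
      have h3 := ih2 p φ fun y hy b' hb' =>
        hφ y (Multiset.mem_add.2 (.inl hy)) b' (List.mem_cons_of_mem _ hb')
      have h4 := ih2 (p + b) φ fun y hy b' hb' =>
        hφ y (Multiset.mem_add.2 (.inr hy)) b' (List.mem_cons_of_mem _ hb')
      rcases Multiset.mem_add.1 hy with hy | hy
      · exact ⟨h3.1 y hy, h3.2 y hy⟩
      · exact ⟨h4.1 y hy, h4.2 y hy⟩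
    have hq : ∀ q ∈ (cutAux (· + ·) l).1, ∀ p, ∀ y ∈ points (((b, t) :: l).map Prod.fst) p,
        y + q ∈ points (((b, t) :: l).map Prod.fst) p := by
      intro q hq p y hy
      have h3 : ∀ p', ∀ z ∈ points (l.map Prod.fst) p', z + q ∈ points (l.map Prod.fst) p' := by
        intro p' z hz
        rw [ih1] at hz ⊢
        refine add_mem_points h2 (List.mem_append_left _ ?_) hz
        simpa using hq
      rcases Multiset.mem_add.1 hy with hy | hy
      · exact Multiset.mem_add.2 (.inl (h3 _ _ hy))
      · exact Multiset.mem_add.2 (.inr (h3 _ _ hy))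
    have hp : ∀ p, points (((b, t) :: l).map Prod.fst) p =
        points (b :: ((cutAux (· + ·) l).1.toList ++ (cutAux (· + ·) l).2)) p := fun p => by
      rw [List.map_cons, points, points, ih1, ih1]
    rw [cutAux_cons]
    cases t with
    | false =>
      rw [cond_false]
      refine ⟨fun p => ?_, fun p φ hφ => ⟨?_, ?_⟩⟩
      · rw [hp]
        cases (cutAux (· + ·) l).1 with
        | none => rfl
        | some q => exact points_swap _ _ _ _
      · intro y hy b' hb'
        have h5 := hrec p φ hφ y hy
        rcases List.mem_cons.1 hb' with rfl | hb'
        · simpa using h5.1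
        · exact h5.2.1 b' hb'
      · exact fun y hy q hq => (hrec p φ hφ y hy).2.2 q hq
    | true =>
      rw [cond_true]
      cases e : (cutAux (· + ·) l).1 with
      | none =>
        refine ⟨fun p => ?_, fun p φ hφ => ⟨?_, ?_⟩⟩
        · rw [hp, e]; rfl
        · exact fun y hy b' hb' => (hrec p φ hφ y hy).2.1 b' hb'
        · intro y hy q hq
          obtain rfl : b = q := by simpa using hq
          simpa using (hrec p φ hφ y hy).1
      | some q =>
        rw [e] at hq
        refine ⟨fun p => ?_, fun p φ hφ => ⟨?_, ?_⟩⟩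
        · rw [hp, e]
          exact points_transvection h2 _ _ _ _
        · intro y hy b' hb'
          rcases List.mem_cons.1 hb' with rfl | hb'
          · have h5 := hrec p φ hφ y hy
            have h6 := (hrec p φ hφ _ (hq q rfl p y hy)).1
            have h7 := h5.2.2 q e
            rw [add_comm b, ← add_assoc, h6, h7]
            simp
          · exact (hrec p φ hφ y hy).2.1 b' hb'
        · intro y hy q' hq'
          exact (hrec p φ hφ y hy).2.2 q' (by rw [e]; exact hq')

/-- The points that `cut` selects are those on which the form vanishes. -/
theorem cut_spec (h2 : ∀ x : W, x + x = 0) (l : List (W × Bool)) (p : W) (φ : W → Bool)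
    (hφ : ∀ y ∈ points (l.map Prod.fst) p, ∀ b ∈ l, φ (y + b.1) = (φ y ^^ b.2)) :
    (points (l.map Prod.fst) p).filter (fun y => φ y = false) =
      (cut (· + ·) p (φ p) l).elim 0 fun s => points s.2 s.1 := by
  obtain ⟨h3, h4⟩ := cutAux_spec h2 l
  obtain ⟨h5, h6⟩ := h4 p φ hφ
  have hK : ∀ p', (∀ y ∈ points (cutAux (· + ·) l).2 p', y ∈ points (l.map Prod.fst) p) →
      ∀ y ∈ points (cutAux (· + ·) l).2 p', φ y = φ p' := by
    intro p' hsub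
    refine points_induction rfl fun y hy b hb e => ?_
    rw [h5 y (hsub y hy) b hb, e]
  unfold cut
  cases e : (cutAux (· + ·) l).1 with
  | none =>
    rw [e] at h3
    have h7 := h3 p
    rw [Option.toList_none, List.nil_append] at h7
    rw [h7] at hK ⊢
    have h8 := hK p (fun y hy => by exact hy)
    cases hp : φ p
    · rw [Multiset.filter_eq_self.2 fun y hy => (h8 y hy).trans hp]; rfl
    · rw [Multiset.filter_eq_nil.2 fun y hy => by rw [h8 y hy, hp]; simp]; rfl
  | some q =>
    rw [e] at h3 h6
    have h7 := h3 p
    rw [Option.toList_some, List.singleton_append, points] at h7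
    have h8 := hK p fun y hy => by rw [h7]; exact Multiset.mem_add.2 (.inl hy)
    have h9 := hK (p + q) fun y hy => by rw [h7]; exact Multiset.mem_add.2 (.inr hy)
    rw [h6 p (mem_points_self _ _) q rfl] at h9
    rw [h7, Multiset.filter_add]
    cases hp : φ p
    · rw [Multiset.filter_eq_self.2 fun y hy => (h8 y hy).trans hp,
        Multiset.filter_eq_nil.2 fun y hy => by rw [h9 y hy, hp]; simp, add_zero]; rfl
    · rw [Multiset.filter_eq_nil.2 fun y hy => by rw [h8 y hy, hp]; simp,
        Multiset.filter_eq_self.2 fun y hy => by rw [h9 y hy, hp]; rfl, zero_add]; rfl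

end

/-- Elimination commutes with homomorphisms. -/
theorem cutAux_map {V W : Type} {op : V → V → V} {op' : W → W → W} (ρ : V → W)
    (h : ∀ u v, ρ (op u v) = op' (ρ u) (ρ v)) (l : List (V × Bool)) :
    cutAux op' (l.map fun b => (ρ b.1, b.2)) =
      ((cutAux op l).1.map ρ, (cutAux op l).2.map ρ) := by
  induction l with
  | nil => rfl
  | cons b l ih =>
    obtain ⟨b, t⟩ := b
    rw [List.map_cons, cutAux_cons, ih, cutAux_cons]
    rcases cutAux op l with ⟨_ | q, K⟩ <;> cases t <;> simp [h]

theorem cut_map {V W : Type} {op : V → V → V} {op' : W → W → W} (ρ : V → W)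
    (h : ∀ u v, ρ (op u v) = op' (ρ u) (ρ v)) (p : V) (flip : Bool) (l : List (V × Bool)) :
    cut op' (ρ p) flip (l.map fun b => (ρ b.1, b.2)) =
      (cut op p flip l).map fun s => (ρ s.1, s.2.map ρ) := by
  unfold cut
  rw [cutAux_map ρ h]
  rcases cutAux op l with ⟨_ | q, K⟩ <;> cases flip <;> simp [h]

/-! ### Vectors as functions -/

/-- The space of infinite vectors over `ℤ/2`. -/
abbrev Sp : Type := ℕ → ZMod 2

/-- An element of `ℤ/2` as a number. -/
def bz (b : Bool) : ZMod 2 := if b then 1 else 0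

@[simp] theorem bz_true : bz true = 1 := rfl
@[simp] theorem bz_false : bz false = 0 := rfl

theorem bz_xor (a b : Bool) : bz (a ^^ b) = bz a + bz b := by
  cases a <;> cases b <;> decide

theorem bz_and (a b : Bool) : bz (a && b) = bz a * bz b := by
  cases a <;> cases b <;> decide

theorem bz_injective : Function.Injective bz := by
  intro a b; cases a <;> cases b <;> decide

theorem bz_decide (x : ZMod 2) : bz (decide (x = 1)) = x := by
  revert x; decide

theorem sp_add_self (x : Sp) : x + x = 0 := by
  funext i; exact CharTwo.add_self_eq_zero (x i)

theorem sp2_add_self (x : Sp × Sp) : x + x = 0 := by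
  ext i
  · exact CharTwo.add_self_eq_zero (x.1 i)
  · exact CharTwo.add_self_eq_zero (x.2 i)

/-- The vector given by a list, followed by zeros. -/
def vec (v : List Bool) : Sp := fun i => bz (v.getD i false)

@[simp] theorem vec_nil : vec [] = 0 := by funext i; simp [vec]

@[simp] theorem vec_cons_zero (b : Bool) (v : List Bool) : vec (b :: v) 0 = bz b := rfl

@[simp] theorem vec_cons_succ (b : Bool) (v : List Bool) (i : ℕ) :
    vec (b :: v) (i + 1) = vec v i := rfl

theorem getD_zipD {α β : Type} (d : α) (e : β) (l : List α) (l' : List β) (i : ℕ) :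
    (zipD d e l l').getD i (d, e) = (l.getD i d, l'.getD i e) := by
  induction l generalizing l' i with
  | nil =>
    induction l' generalizing i with
    | nil => simp [zipD]
    | cons b l' ih => cases i <;> simp_all [zipD]
  | cons a l ih =>
    cases l' with
    | nil =>
      cases i with
      | zero => simp [zipD]
      | succ i => simpa [zipD] using ih [] i
    | cons b l' =>
      cases i with
      | zero => simp [zipD]
      | succ i => simpa [zipD] using ih l' i

theorem vec_vadd (u v : List Bool) : vec (vadd u v) = vec u + vec v := by
  funext i
  rw [Pi.add_apply, vec, vec, vec, ← bz_xor]
  congr 1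
  have h := getD_zipD false false u v i
  have h3 := List.getD_map (l := zipD false false u v) (d := (false, false)) (n := i)
    (fun p : Bool × Bool => p.1 ^^ p.2)
  rw [h] at h3
  exact h3

/-- The scalar product as a finite sum. -/
theorem bz_dot (u v : List Bool) (n : ℕ) (hn : u.length ≤ n) :
    bz (dot u v) = ∑ i ∈ Finset.range n, vec u i * vec v i := by
  induction u generalizing v n with
  | nil =>
    have : dot [] v = false := by
      induction v with
      | nil => simp [dot, zipD]
      | cons b v ih => simpa [dot, zipD] using ih
    simp [this]
  | cons a u ih =>
    obtain ⟨n, rfl⟩ : ∃ k, n = k + 1 := ⟨n - 1, by simp at hn; omega⟩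
    have hn' : u.length ≤ n := by simpa using hn
    cases v with
    | nil =>
      have h1 : dot (a :: u) [] = dot u [] := by simp [dot, zipD]
      rw [h1, ih [] n hn']
      simp
    | cons b v =>
      have h1 : dot (a :: u) (b :: v) = ((a && b) ^^ dot u v) := by simp [dot, zipD]
      rw [h1, bz_xor, bz_and, ih v n hn', Finset.sum_range_succ']
      simp [add_comm]

/-- Coordinate vectors generate all vectors of a given length. -/
theorem points_units {β : Type} {M : Type*} [AddCommMonoid M] (l : List β) (f : Sp → M) :
    ((points ((units l).map vec) 0).map f).sum =
      ∑ x : Fin l.length → ZMod 2, f fun i => if h : i < l.length then x ⟨i, h⟩ else 0 := by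
  induction l generalizing f with
  | nil =>
    simp [units, points]
    rfl
  | cons a l ih =>
    have h1 : units (a :: l) = [true] :: (units l).map fun v => false :: v := rfl
    have h2 : ∀ t : ZMod 2, points (((units l).map fun v => false :: v).map vec)
        (fun i => Nat.casesOn i t (fun j => (0 : Sp) j)) =
        (points ((units l).map vec) 0).map fun y : Sp =>
          (fun i => Nat.casesOn i t (fun j => y j) : Sp) := by
      intro t
      have := points_map (fun y : Sp => (fun i => Nat.casesOn i t (fun j => y j) : Sp))
        ((units l).map fun v => (vec v, vec (false :: v))) 0 (by
          intro y _ b hb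
          obtain ⟨v, _, rfl⟩ := List.mem_map.1 hb
          funext i
          cases i <;> simp)
      simpa [List.map_map, Function.comp_def] using this
    have h3 : (0 : Sp) = fun i => Nat.casesOn i 0 (fun j => (0 : Sp) j) := by
      funext i; cases i <;> rfl
    have h4 : (0 : Sp) + vec [true] = fun i => Nat.casesOn i 1 (fun j => (0 : Sp) j) := by
      funext i; cases i <;> simp [vec]
    have h5 := h2 0
    rw [← h3] at h5
    rw [h1, List.map_cons, points, h4, h2, h5]
    rw [Multiset.map_add, Multiset.sum_add, Multiset.map_map, Multiset.map_map]
    rw [show (f ∘ fun y : Sp => (fun i => Nat.casesOn i 0 (fun j => y j) : Sp)) = fun y =>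
      f (fun i => Nat.casesOn i 0 (fun j => y j) : Sp) from rfl,
      show (f ∘ fun y : Sp => (fun i => Nat.casesOn i 1 (fun j => y j) : Sp)) = fun y =>
      f (fun i => Nat.casesOn i 1 (fun j => y j) : Sp) from rfl, ih, ih]
    refine Eq.trans ?_ (Equiv.sum_comp (Fin.consEquiv fun _ : Fin (l.length + 1) => ZMod 2) _)
    rw [Fintype.sum_prod_type,
      show (Finset.univ : Finset (ZMod 2)) = {0, 1} from rfl, Finset.sum_pair (by decide)]
    congr 1 <;> refine Finset.sum_congr rfl fun x _ => congrArg f ?_ <;> funext i <;> cases i <;>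
      simp [Fin.consEquiv] <;> rfl

/-! ### Functions with quadratic phase -/

open Complex

/-- On the set `A` the function `h` is nonzero, and its second differences are signs that only
depend on the directions. Affine functions have this property, and it is all that is needed to
sum them up. -/
def Quad {W : Type*} [AddCommGroup W] (h : W → ℂ) (A : Set W) : Prop :=
  (∀ y ∈ A, h y ≠ 0) ∧ ∀ b b' : W, ∃ s : ℂ, (s = 1 ∨ s = -1) ∧
    ∀ y, y ∈ A → y + b ∈ A → y + b' ∈ A → y + b + b' ∈ A →
      h (y + b + b') * h y = s * (h (y + b) * h (y + b'))

section
variable {W W' : Type*} [AddCommGroup W] [AddCommGroup W'] {h k : W → ℂ} {A A' : Set W}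

theorem Quad.mono (hh : Quad h A) (hA : A' ⊆ A) : Quad h A' := by
  refine ⟨fun y hy => hh.1 y (hA hy), fun b b' => ?_⟩
  obtain ⟨s, hs, e⟩ := hh.2 b b'
  exact ⟨s, hs, fun y h1 h2 h3 h4 => e y (hA h1) (hA h2) (hA h3) (hA h4)⟩

theorem Quad.congr (hh : Quad h A) (e : ∀ y ∈ A, k y = h y) : Quad k A := by
  refine ⟨fun y hy => e y hy ▸ hh.1 y hy, fun b b' => ?_⟩
  obtain ⟨s, hs, e'⟩ := hh.2 b b'
  refine ⟨s, hs, fun y h1 h2 h3 h4 => ?_⟩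
  rw [e _ h1, e _ h2, e _ h3, e _ h4, e' y h1 h2 h3 h4]

theorem Quad.const {c : ℂ} (hc : c ≠ 0) : Quad (fun _ : W => c) A :=
  ⟨fun _ _ => hc, fun _ _ => ⟨1, .inl rfl, fun _ _ _ _ _ => by rw [one_mul]⟩⟩

theorem Quad.mul (hh : Quad h A) (hk : Quad k A) : Quad (fun y => h y * k y) A := by
  refine ⟨fun y hy => mul_ne_zero (hh.1 y hy) (hk.1 y hy), fun b b' => ?_⟩
  obtain ⟨s, hs, e⟩ := hh.2 b b'
  obtain ⟨t, ht, e'⟩ := hk.2 b b'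
  refine ⟨s * t, ?_, fun y h1 h2 h3 h4 => ?_⟩
  · rcases hs with rfl | rfl <;> rcases ht with rfl | rfl <;> simp
  · linear_combination (k (y + b + b') * k y) * e y h1 h2 h3 h4 +
      (s * (h (y + b) * h (y + b'))) * e' y h1 h2 h3 h4

theorem Quad.comp (hh : Quad h A) (g : W' →+ W) : Quad (fun y => h (g y)) (g ⁻¹' A) := by
  refine ⟨fun y hy => hh.1 _ hy, fun b b' => ?_⟩
  obtain ⟨s, hs, e⟩ := hh.2 (g b) (g b')
  refine ⟨s, hs, fun y h1 h2 h3 h4 => ?_⟩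
  simp only [Set.mem_preimage, map_add] at *
  exact e _ h1 h2 h3 h4

theorem Quad.prod {ι : Type*} (s : Finset ι) {f : ι → W → ℂ} (hf : ∀ i ∈ s, Quad (f i) A) :
    Quad (fun y => ∏ i ∈ s, f i y) A := by
  classical
  induction s using Finset.induction_on with
  | empty => simpa using Quad.const one_ne_zero
  | insert i s hi ih =>
    simp only [Finset.prod_insert hi]
    exact (hf i (Finset.mem_insert_self _ _)).mul
      (ih fun j hj => hf j (Finset.mem_insert_of_mem hj))

theorem Quad.list_prod {ι : Type*} (l : List ι) {f : ι → W → ℂ} (hf : ∀ i ∈ l, Quad (f i) A) :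
    Quad (fun y => (l.map fun i => f i y).prod) A := by
  induction l with
  | nil => simpa using Quad.const one_ne_zero
  | cons i l ih =>
    simp only [List.map_cons, List.prod_cons]
    exact (hf i List.mem_cons_self).mul (ih fun j hj => hf j (List.mem_cons_of_mem _ hj))

end

/-- Fourth roots of unity in one coordinate: the linear terms of the exponent. -/
theorem quad_bit {c : ℂ} (hc : c ^ 4 = 1) :
    Quad (fun t : ZMod 2 => if t = 0 then 1 else c) .univ := by
  have hc0 : c ≠ 0 := by rintro rfl; simp at hc
  refine ⟨fun t _ => by dsimp only; split_ifs <;> simp [hc0], fun b b' => ?_⟩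
  have hs : c ^ 2 = 1 ∨ c ^ 2 = -1 := by
    rw [← sq_eq_one_iff]; rw [← hc]; ring
  refine ⟨if b = 0 ∨ b' = 0 then 1 else c ^ 2, ?_, fun y _ _ _ _ => ?_⟩
  · split_ifs
    exacts [.inl rfl, hs]
  have h0 : ∀ x : ZMod 2, x = 0 ∨ x = 1 := by decide
  have h11 : (1 : ZMod 2) + 1 = 0 := by decide
  rcases h0 b with rfl | rfl <;> rcases h0 b' with rfl | rfl <;> rcases h0 y with rfl | rfl <;>
    simp [h11]
  · linear_combination -hc
  · ring

/-- Signs in the product of two coordinates: the quadratic terms of the exponent. -/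
theorem quad_pair {d : ℂ} (hd : d ^ 2 = 1) :
    Quad (fun p : ZMod 2 × ZMod 2 => if p.1 * p.2 = 0 then 1 else d) .univ := by
  have hd0 : d ≠ 0 := by rintro rfl; simp at hd
  refine ⟨fun t _ => by dsimp only; split_ifs <;> simp [hd0], fun b b' => ?_⟩
  have hmul : ∀ x y : ZMod 2, (if x = 0 then 1 else d) * (if y = 0 then 1 else d) =
      if x + y = 0 then 1 else d := by
    have h0 : ∀ x : ZMod 2, x = 0 ∨ x = 1 := by decide
    have h11 : (1 : ZMod 2) + 1 = 0 := by decide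
    intro x y
    rcases h0 x with rfl | rfl <;> rcases h0 y with rfl | rfl <;> simp [h11]
    rw [← hd]; ring
  have hring : ∀ y1 y2 b1 b2 c1 c2 : ZMod 2, (y1 + b1 + c1) * (y2 + b2 + c2) + y1 * y2 =
      (b1 * c2 + c1 * b2) + ((y1 + b1) * (y2 + b2) + (y1 + c1) * (y2 + c2)) := by decide
  refine ⟨if b.1 * b'.2 + b'.1 * b.2 = 0 then 1 else d, ?_, fun y _ _ _ _ => ?_⟩
  · split_ifs
    · exact .inl rfl
    · exact sq_eq_one_iff.1 hd
  · rw [hmul, hmul, hmul]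
    simp only [Prod.fst_add, Prod.snd_add, hring]

/-- In each direction, a function with quadratic phase changes by powers of `i`. -/
theorem Quad.exists_phase {W : Type*} [AddCommGroup W] {h : W → ℂ} {A : Set W} (hh : Quad h A)
    (h2 : ∀ x : W, x + x = 0) {y b : W} (hy : y ∈ A) (hb : y + b ∈ A) :
    ∃ k < 4, h (y + b) = I ^ k * h y := by
  obtain ⟨s, hs, e⟩ := hh.2 b b
  have e1 : y + b + b = y := by rw [add_assoc, h2, add_zero]
  have := e y hy hb hb (by rwa [e1])
  rw [e1] at this
  have h0 := hh.1 y hy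
  have h1 := hh.1 _ hb
  rcases hs with rfl | rfl
  · have h3 : (h (y + b) - h y) * (h (y + b) + h y) = 0 := by linear_combination -this
    rcases mul_eq_zero.1 h3 with h3 | h3
    · exact ⟨0, by norm_num, by linear_combination h3⟩
    · exact ⟨2, by norm_num, by rw [I_sq]; linear_combination h3⟩
  · have h3 : (h (y + b) - I * h y) * (h (y + b) + I * h y) = 0 := by
      linear_combination this - (h y) ^ 2 * I_sq
    rcases mul_eq_zero.1 h3 with h3 | h3
    · exact ⟨1, by norm_num, by linear_combination h3⟩
    · exact ⟨3, by norm_num, by rw [I_pow_three]; linear_combination h3⟩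

theorem I_zpow_sum {ι : Type*} (s : Finset ι) (f : ι → ℤ) :
    I ^ (∑ i ∈ s, f i) = ∏ i ∈ s, I ^ f i := by
  classical
  induction s using Finset.induction_on with
  | empty => simp
  | insert i s hi ih => rw [Finset.sum_insert hi, Finset.prod_insert hi, zpow_add₀ I_ne_zero, ih]

/-- Affine functions have quadratic phase. -/
theorem quad_of_mem_affineFun {n : ℕ} {f : CFun n} (hf : f ∈ affineFun n) : Quad f (supp f) := by
  obtain ⟨-, J, lam, L, Q, -, hlam, h⟩ := hf
  have hI4 : ∀ z : ℤ, (I ^ z) ^ 4 = 1 := fun z => by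
    rw [← zpow_natCast, ← zpow_mul, mul_comm, zpow_mul]; simp
  have hI2 : ∀ z : ℤ, (I ^ (2 * z)) ^ 2 = 1 := fun z => by
    rw [← hI4 z, ← zpow_natCast, ← zpow_natCast, ← zpow_mul, ← zpow_mul]
    congr 1; push_cast; ring
  have h01 : ∀ x : ZMod 2, x = 0 ∨ x = 1 := by decide
  have hq : Quad (fun x : Cube n => lam * ((∏ j ∈ J, if x j = 0 then 1 else I ^ L j) *
      ∏ j ∈ J, ∏ k ∈ J with j < k, if x j * x k = 0 then 1 else I ^ (2 * Q j k))) (supp f) := by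
    refine (Quad.const hlam).mul (.mul (.prod _ fun j _ => ?_)
      (.prod _ fun j _ => .prod _ fun k _ => ?_))
    · exact ((quad_bit (hI4 (L j))).comp (Pi.evalAddMonoidHom (fun _ => ZMod 2) j)).mono
        fun _ _ => trivial
    · exact ((quad_pair (hI2 (Q j k))).comp ((Pi.evalAddMonoidHom (fun _ => ZMod 2) j).prod
        (Pi.evalAddMonoidHom (fun _ => ZMod 2) k))).mono fun _ _ => trivial
  refine hq.congr fun x hx => ?_
  rw [h x hx, zpow_add₀ I_ne_zero, I_zpow_sum, Finset.mul_sum, I_zpow_sum]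
  simp only [Finset.mul_sum, I_zpow_sum]
  congr 2
  · refine Finset.prod_congr rfl fun j _ => ?_
    rcases h01 (x j) with e | e <;> simp [e, ZMod.val_one]
  · refine Finset.prod_congr rfl fun j _ => Finset.prod_congr rfl fun k _ => ?_
    rcases h01 (x j) with e | e <;> rcases h01 (x k) with e' | e' <;> simp [e, e', ZMod.val_one]

/-! ### Products of local affine functions -/

theorem transform_diag {n : ℕ} (f : CFun n) (s x : Cube n) :
    transform (fun i => transM (alpha ^ (s i).val)) f x =
      (∏ i, if x i = 0 then 1 else alpha ^ (s i).val) * f x := by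
  rw [transform, Finset.sum_eq_single x]
  · simp [transM]
  · intro y _ hy
    obtain ⟨i, hi⟩ := Function.ne_iff.1 hy
    rw [Finset.prod_eq_zero (Finset.mem_univ i), zero_mul]
    rw [transM, Matrix.diagonal_apply_ne _ hi.symm]
  · simp

/-- The product of the functions at all vertices. -/
def Grid.weight (θ : ℂ) (Ω : Grid) (σ : Fin Ω.numEdges → ZMod 2) : ℂ :=
  (Ω.vertices.map fun v => v.fn θ fun i => σ (v.edges.get i)).prod

/-- For the product of local affine functions, the twists at the two ends of each edge combine to
powers of `i`, so that the product has quadratic phase. -/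
theorem quad_weight {Ω : Grid} {θ : ℂ} (h : Ω.IsInstance localAffine θ) :
    Quad (Ω.weight θ) {σ | Ω.weight θ σ ≠ 0} := by
  by_cases hne : ∃ σ₀, Ω.weight θ σ₀ ≠ 0
  swap
  · push Not at hne
    exact ⟨fun y hy => hy, fun b b' => ⟨1, .inl rfl, fun y h1 => absurd (hne y) h1⟩⟩
  obtain ⟨σ₀, hσ₀⟩ := hne
  have hfac : ∀ {σ}, Ω.weight θ σ ≠ 0 → ∀ v ∈ Ω.vertices,
      v.fn θ (fun i => σ (v.edges.get i)) ≠ 0 := fun hσ v hv e =>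
    hσ (List.prod_eq_zero (List.mem_map.2 ⟨v, hv, e⟩))
  -- each function is twisted by one and the same point `σ₀` of the common support
  set u : (Fin Ω.numEdges → ZMod 2) → Fin Ω.numEdges → ℂ := fun σ e =>
    if σ e = 0 then 1 else alpha ^ (σ₀ e).val with hu
  have halpha : alpha ≠ 0 := by rw [alpha]; exact Complex.exp_ne_zero _
  have hu0 : ∀ σ e, u σ e ≠ 0 := fun σ e => by
    rw [hu]; dsimp only; split_ifs <;> simp [halpha]
  have h1 : ∀ v ∈ Ω.vertices, ∀ σ : Fin Ω.numEdges → ZMod 2,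
      transform (fun i => transM (alpha ^ (σ₀ (v.edges.get i)).val)) (v.fn θ)
        (fun i => σ (v.edges.get i)) =
      (v.edges.map (u σ)).prod * v.fn θ fun i => σ (v.edges.get i) := by
    intro v _ σ
    rw [transform_diag (v.fn θ) (fun i => σ₀ (v.edges.get i))]
    congr 1
    rw [← List.prod_ofFn]
    congr 1
    refine List.ext_getElem (by simp) fun i h1 h2 => ?_
    simp [hu]
  -- each edge is twisted at both ends, by `α ^ 2 = i` in total
  have h2 : ∀ σ, (Ω.vertices.map fun v => (v.edges.map (u σ)).prod).prod =
      ∏ e, if σ e = 0 then 1 else I ^ (σ₀ e).val := by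
    intro σ
    have h3 : (Ω.vertices.map fun v => (v.edges.map (u σ)).prod).prod =
        ((Ω.vertices.flatMap Vertex.edges).map (u σ)).prod := by
      induction Ω.vertices with
      | nil => simp
      | cons v l ih => simp [ih]
    rw [h3, Finset.prod_list_map_count]
    have h4 : (Ω.vertices.flatMap Vertex.edges).toFinset = Finset.univ := by
      refine Finset.eq_univ_of_forall fun e => List.mem_toFinset.2 (List.count_pos_iff.1 ?_)
      rw [h.2.1 e]; norm_num
    rw [h4]
    refine Finset.prod_congr rfl fun e _ => ?_
    rw [h.2.1 e, hu]
    dsimp only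
    split_ifs
    · simp
    · rw [← pow_mul, mul_comm, pow_mul, alpha_sq]
  have h3 : Quad (fun σ => (Ω.vertices.map fun v =>
      transform (fun i => transM (alpha ^ (σ₀ (v.edges.get i)).val)) (v.fn θ)
        (fun i => σ (v.edges.get i))).prod * ∏ e, if σ e = 0 then 1 else (I ^ (σ₀ e).val)⁻¹)
      {σ | Ω.weight θ σ ≠ 0} := by
    refine Quad.mul (.list_prod _ fun v hv => ?_) (.prod _ fun e _ => ?_)
    · have h4 := (h.2.2 v hv).2 (fun i => σ₀ (v.edges.get i)) (hfac hσ₀ v hv)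
      refine ((quad_of_mem_affineFun h4).comp (W' := Fin Ω.numEdges → ZMod 2)
        (AddMonoidHom.mk' (fun σ i => σ (v.edges.get i)) fun _ _ => rfl)).mono fun σ hσ => ?_
      change transform _ _ _ ≠ 0
      erw [h1 v hv σ]
      refine mul_ne_zero ?_ (hfac hσ v hv)
      refine List.prod_ne_zero fun h5 => ?_
      obtain ⟨e, _, he⟩ := List.mem_map.1 h5
      exact hu0 σ e he
    · have h4 : ((I ^ (σ₀ e).val)⁻¹) ^ 4 = 1 := by
        rw [inv_pow, ← pow_mul, mul_comm, pow_mul, I_pow_four, one_pow, inv_one]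
      exact ((quad_bit h4).comp (Pi.evalAddMonoidHom (fun _ => ZMod 2) e)).mono fun _ _ => trivial
  refine h3.congr fun σ _ => ?_
  rw [List.map_congr_left fun v hv => h1 v hv σ, List.prod_map_mul, h2]
  have h5 : (∏ e, if σ e = 0 then 1 else I ^ (σ₀ e).val) *
      ∏ e, (if σ e = 0 then 1 else (I ^ (σ₀ e).val)⁻¹) = 1 := by
    rw [← Finset.prod_mul_distrib]
    refine Finset.prod_eq_one fun e _ => ?_
    split_ifs <;> simp [I_ne_zero]
  change Ω.weight θ σ = _ * Ω.weight θ σ * _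
  rw [mul_right_comm, h5, one_mul]

/-! ### Evaluation of the functions -/

theorem mem_labels (vs : List Vtx) (e : ℕ) : e ∈ labels vs ↔ e ∈ vs.flatMap Prod.fst := by
  rw [labels]
  induction vs.flatMap Prod.fst with
  | nil => simp
  | cons a l ih =>
    rw [List.foldr_cons]
    generalize List.foldr _ _ l = L at ih ⊢
    cases h : L.any fun e' => decide (e' = a)
    · simp [ih]
    · rw [cond_true, ih, List.mem_cons]
      refine ⟨Or.inr, ?_⟩
      rintro (rfl | h')
      · obtain ⟨e', h1, h2⟩ := List.any_eq_true.1 h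
        rw [← ih]
        rwa [← of_decide_eq_true h2]
      · exact h'

theorem nodup_labels (vs : List Vtx) : (labels vs).Nodup := by
  rw [labels]
  induction vs.flatMap Prod.fst with
  | nil => simp
  | cons a l ih =>
    rw [List.foldr_cons]
    generalize List.foldr _ _ l = L at ih ⊢
    cases h : L.any fun e' => decide (e' = a)
    · rw [cond_false, List.nodup_cons]
      refine ⟨fun h1 => ?_, ih⟩
      have := List.any_eq_false.1 h a h1
      simp at this
    · exact ih

theorem dot_comm (u v : List Bool) : dot u v = dot v u := by
  induction u generalizing v with
  | nil =>
    induction v with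
    | nil => rfl
    | cons b v ih => simpa [dot, zipD] using ih
  | cons a u ih =>
    cases v with
    | nil => simpa [dot, zipD] using ih []
    | cons b v =>
      have := ih v
      simp only [dot, zipD, List.foldr_cons] at this ⊢
      rw [this, Bool.and_comm]

theorem bz_dot' (u v : List Bool) (n : ℕ) (hn : v.length ≤ n) :
    bz (dot u v) = ∑ i ∈ Finset.range n, vec u i * vec v i := by
  rw [dot_comm, bz_dot v u n hn]
  exact Finset.sum_congr rfl fun i _ => mul_comm _ _

theorem vec_of_le {v : List Bool} {i : ℕ} (h : v.length ≤ i) : vec v i = 0 := by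
  rw [vec, List.getD_eq_default _ _ h]; rfl

theorem bz_bitAt {E : List ℕ} (hE : E.Nodup) {e : ℕ} (he : e ∈ E) (v : List Bool) :
    bz (bitAt E e v) = vec v (E.idxOf e) := by
  have hlt := List.idxOf_lt_length_iff.2 he
  have h1 : ∀ i (hi : i < E.length), vec (E.map fun e' => decide (e' = e)) i =
      if E[i] = e then 1 else 0 := fun i hi => by
    rw [vec, List.getD_eq_getElem _ _ (by simpa using hi), List.getElem_map]
    by_cases h : E[i] = e <;> simp [h]
  rw [bitAt, bz_dot _ _ E.length (by simp), Finset.sum_eq_single (E.idxOf e)]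
  · rw [h1 _ hlt, List.getElem_idxOf, if_pos rfl, one_mul]
  · intro i hi hne
    rw [h1 i (Finset.mem_range.1 hi), if_neg, zero_mul]
    rintro rfl
    exact hne (hE.idxOf_getElem i (Finset.mem_range.1 hi)).symm
  · intro h
    exact absurd (Finset.mem_range.2 hlt) h

/-- The coordinates at given edges. -/
def coords (E es : List ℕ) (y : Sp) : List Bool := es.map fun e => decide (y (E.idxOf e) = 1)

theorem inputs_eq_coords {E es : List ℕ} (hE : E.Nodup) (hes : ∀ e ∈ es, e ∈ E) (v : List Bool) :
    inputs E es v = coords E es (vec v) := by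
  refine List.map_congr_left fun e he => bz_injective ?_
  rw [bz_bitAt hE (hes e he), bz_decide]

theorem vec_coords_add (E es : List ℕ) (x y : Sp) :
    vec (coords E es (x + y)) = vec (coords E es x) + vec (coords E es y) := by
  funext i
  rw [Pi.add_apply]
  by_cases h : i < es.length
  · simp only [vec, coords]
    rw [List.getD_eq_getElem _ _ (by simpa using h), List.getD_eq_getElem _ _ (by simpa using h),
      List.getD_eq_getElem _ _ (by simpa using h)]
    simp only [List.getElem_map, bz_decide, Pi.add_apply]
  · rw [vec_of_le, vec_of_le, vec_of_le, add_zero] <;> simpa [coords] using h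

/-- The assignment of the edges that a vector describes. -/
def assign (E : List ℕ) (m : ℕ) : Sp →+ (Fin m → ZMod 2) :=
  AddMonoidHom.mk' (fun y e => y (E.idxOf (e : ℕ))) fun _ _ => rfl

theorem coords_vtxOf (E : List ℕ) {m : ℕ} (v : Vertex m) (y : Sp) :
    coords E (vtxOf v).1 y =
      (List.ofFn fun i => assign E m y (v.edges.get i)).map fun b => decide (b = 1) := by
  refine List.ext_getElem (by simp [coords, vtxOf]) fun i h1 h2 => ?_
  simp [coords, vtxOf, assign]

theorem map_decide_injective :
    Function.Injective (List.map fun b : ZMod 2 => decide (b = 1)) := by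
  refine List.map_injective_iff.2 fun a b h => ?_
  rw [← bz_decide a, ← bz_decide b]
  exact congrArg bz h

theorem assoc_map_rowOf (t : List (List (ZMod 2) × AlgNum)) (x : List (ZMod 2)) :
    assoc (t.map rowOf) (x.map fun b => decide (b = 1)) =
      (t.lookup x).map fun q => (q.coeffs.map cycOf, q.den) := by
  induction t with
  | nil => rfl
  | cons r t ih =>
    rw [List.map_cons, assoc, List.foldr_cons, ← assoc, ih, List.lookup_cons]
    by_cases h : x = r.1
    · subst h
      simp [rowOf]
    · rw [if_neg, beq_false_of_ne h]
      exact fun e => h (map_decide_injective e).symm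

theorem mem_of_lookup {α β : Type*} [BEq α] [LawfulBEq α] {l : List (α × β)} {a : α} {b : β}
    (h : l.lookup a = some b) : (a, b) ∈ l := by
  induction l with
  | nil => simp at h
  | cons p l ih =>
    rw [List.lookup_cons] at h
    by_cases e : a = p.1
    · subst e
      simp at h
      subst h
      exact List.mem_cons_self
    · rw [beq_false_of_ne e] at h
      exact List.mem_cons_of_mem _ (ih h)

theorem lookup_of_mem {α β : Type*} [BEq α] [LawfulBEq α] {l : List (α × β)} {a : α} {b : β}
    (hl : (l.map Prod.fst).Nodup) (h : (a, b) ∈ l) : l.lookup a = some b := by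
  induction l with
  | nil => simp at h
  | cons p l ih =>
    rw [List.map_cons, List.nodup_cons] at hl
    rw [List.lookup_cons]
    rcases List.mem_cons.1 h with rfl | h
    · simp
    · have e : a ≠ p.1 := by
        rintro rfl
        exact hl.1 (List.mem_map.2 ⟨(p.1, b), h, rfl⟩)
      rw [beq_false_of_ne e]
      exact ih hl.2 h

section
variable {E : List ℕ} {d : ℕ} {θ : ℂ}

theorem vtxNum_spec (hE : E.Nodup) {m : ℕ} {w : Vertex m} (hw : w.WellFormed d)
    (hes : ∀ e ∈ w.edges, (e : ℕ) ∈ E) (v : List Bool) :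
    qval θ (vtxNum E v (vtxOf w)) = w.fn θ (fun i => assign E m (vec v) (w.edges.get i)) ∧
      (vtxNum E v (vtxOf w)).2 ≠ 0 := by
  have hes' : ∀ e ∈ (vtxOf w).1, e ∈ E := fun e he => by
    obtain ⟨e', he', rfl⟩ := List.mem_map.1 he
    exact hes e' he'
  rw [vtxNum, inputs_eq_coords hE hes', coords_vtxOf, show (vtxOf w).2 = w.table.map rowOf from rfl,
    assoc_map_rowOf, Vertex.fn]
  cases h : w.table.lookup (List.ofFn fun i => assign E m (vec v) (w.edges.get i)) with
  | none => simp [qval, nval_nil]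
  | some q =>
    refine ⟨qval_rowNum θ q, ?_⟩
    exact (hw.2 _ (mem_of_lookup h)).2.2.ne'

theorem evalNum_spec (hE : E.Nodup) {Ω : Grid} (hΩ : ∀ w ∈ Ω.vertices, w.WellFormed d)
    (hes : ∀ w ∈ Ω.vertices, ∀ e ∈ w.edges, (e : ℕ) ∈ E) (v : List Bool) :
    qval θ (evalNum E (Ω.vertices.map vtxOf) v) = Ω.weight θ (assign E Ω.numEdges (vec v)) ∧
      (evalNum E (Ω.vertices.map vtxOf) v).2 ≠ 0 := by
  rw [evalNum, Grid.weight, qval]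
  dsimp only
  rw [nval_nprod, nprod_nat]
  revert hΩ hes
  induction Ω.vertices with
  | nil => simp
  | cons w l ih =>
    intro hΩ hes
    obtain ⟨h1, h2⟩ := ih (fun w hw => hΩ w (List.mem_cons_of_mem _ hw))
      (fun w hw => hes w (List.mem_cons_of_mem _ hw))
    obtain ⟨h3, h4⟩ := vtxNum_spec (θ := θ) hE (hΩ w List.mem_cons_self)
      (hes w List.mem_cons_self) v
    constructor
    · simp only [List.map_cons, List.prod_cons, Nat.cast_mul] at h1 ⊢
      rw [mul_div_mul_comm, h1, ← h3]
      rfl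
    · simp only [List.map_cons, List.prod_cons]
      exact mul_ne_zero h4 h2

end

/-! ### The support -/

/-- Evaluation of affine forms at the point with the given coordinates. -/
def pairing (x : List Bool) : Sp →+ ZMod 2 :=
  AddMonoidHom.mk' (fun a => ∑ i ∈ Finset.range (x.length + 1), a i * vec (true :: x) i)
    fun a b => by simp only [Pi.add_apply, add_mul, Finset.sum_add_distrib]

theorem bz_dot_true (a x : List Bool) : bz (dot a (true :: x)) = pairing x (vec a) :=
  bz_dot' _ _ _ (by simp)

theorem mem_points_units {β : Type} (l : List β) {y : Sp} (hy : ∀ i, l.length ≤ i → y i = 0) :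
    y ∈ points ((units l).map vec) 0 := by
  have h := points_units l fun z : Sp => ({z} : Multiset Sp)
  rw [Multiset.sum_map_singleton] at h
  rw [h, Multiset.mem_sum]
  refine ⟨fun i => y i, Finset.mem_univ _, ?_⟩
  rw [Multiset.mem_singleton]
  funext i
  split_ifs with hi
  · rfl
  · exact hy i (not_lt.1 hi)

/-- The forms in the span of `annih w` are those that vanish at each row with a nonzero value. -/
theorem points_annih (w : Vtx) : points ((annih w).map vec) 0 =
    (points ((units (0 :: w.1)).map vec) 0).filter
      fun a => ∀ x ∈ (w.2.filter rowNonzero).map Prod.fst, pairing x a = 0 := by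
  rw [annih]
  induction (w.2.filter rowNonzero).map Prod.fst with
  | nil => simp
  | cons x l ih =>
    rw [List.foldr_cons]
    generalize List.foldr _ _ l = B at ih ⊢
    have h1 := cut_spec sp_add_self (B.map fun a => (vec a, dot a (true :: x))) 0
      (fun a => decide (pairing x a = 1)) (fun y _ b hb => by
        obtain ⟨a, _, rfl⟩ := List.mem_map.1 hb
        apply bz_injective
        rw [bz_xor, bz_decide, bz_decide, map_add, bz_dot_true])
    have h2 := cut_map vec vec_vadd [] false (B.map fun a => (a, dot a (true :: x)))
    have h3 : (cut vadd [] false (B.map fun a => (a, dot a (true :: x)))) =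
        some ([], (cutAux vadd (B.map fun a => (a, dot a (true :: x)))).2) := by
      unfold cut
      cases (cutAux vadd (B.map fun a => (a, dot a (true :: x)))).1 <;> rfl
    rw [h3, vec_nil, List.map_map] at h2
    have h4 : decide (pairing x 0 = 1) = false := by simp
    rw [h4] at h1
    have h5 : (fun b : List Bool × Bool => (vec b.1, b.2)) ∘ (fun a => (a, dot a (true :: x))) =
      fun a => (vec a, dot a (true :: x)) := rfl
    rw [h5] at h2
    rw [h2, List.map_map] at h1
    change _ =
      points ((cutAux vadd (B.map fun a => (a, dot a (true :: x)))).2.map vec) (vec []) at h1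
    rw [vec_nil] at h1
    rw [← h1]
    have h6 : B.map (Prod.fst ∘ fun a => (vec a, dot a (true :: x))) = B.map vec := rfl
    rw [h6, ih, Multiset.filter_filter]
    refine Multiset.filter_congr fun a _ => ?_
    have h7 : ∀ t : ZMod 2, decide (t = 1) = false ↔ t = 0 := by decide
    rw [h7, List.forall_mem_cons]

/-- The support of a local affine function is affine, since a twist does not change it. -/
theorem isAffineRel_supp {n : ℕ} {f : CFun n} (hf : f ∈ localAffine n) (hne : (supp f).Nonempty) :
    IsAffineRel (supp f) := by
  obtain ⟨s, hs⟩ := hne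
  have h1 := (hf s hs).1
  have halpha : alpha ≠ 0 := by rw [alpha]; exact Complex.exp_ne_zero _
  have h2 : supp (transform (fun i => transM (alpha ^ (s i).val)) f) = supp f := by
    ext x
    change transform _ _ _ ≠ 0 ↔ f x ≠ 0
    rw [transform_diag, mul_ne_zero_iff, and_iff_right]
    refine Finset.prod_ne_zero_iff.2 fun i _ => ?_
    split_ifs <;> simp [halpha]
  rwa [h2] at h1

/-- A point outside of the support is separated from it by an affine form. -/
theorem exists_pairing {n : ℕ} {f : CFun n} (hf : f ∈ localAffine n) {y : Cube n} (hy : f y = 0) :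
    ∃ a : Sp, (∀ i, n + 1 ≤ i → a i = 0) ∧
      (∀ x, f x ≠ 0 → pairing ((List.ofFn x).map fun b => decide (b = 1)) a = 0) ∧
      pairing ((List.ofFn y).map fun b => decide (b = 1)) a ≠ 0 := by
  have hpair : ∀ (x : Cube n) (c : ZMod 2) (r : Fin n → ZMod 2),
      pairing ((List.ofFn x).map fun b => decide (b = 1))
        (fun i => if h : i < n + 1 then Fin.cons (α := fun _ => ZMod 2) c r ⟨i, h⟩ else 0) =
        c + ∑ j, r j * x j := by
    intro x c r
    change ∑ i ∈ Finset.range _, _ = _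
    rw [List.length_map, List.length_ofFn, Finset.sum_range, Fin.sum_univ_succ]
    congr 1
    · simp
    · refine Finset.sum_congr rfl fun j _ => ?_
      have h1 : vec (true :: (List.ofFn x).map fun b => decide (b = 1)) (j.succ : ℕ) = x j := by
        rw [Fin.val_succ, vec_cons_succ, vec, List.getD_eq_getElem _ _ (by simp)]
        simp [bz_decide]
      dsimp only
      rw [h1, dif_pos j.succ.isLt]
      rfl
  by_cases hne : (supp f).Nonempty
  · obtain ⟨k, A, b, hA⟩ := isAffineRel_supp hf hne
    have hy' : ¬ A.mulVec y = b := fun h => by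
      have : y ∈ supp f := by rw [hA]; exact h
      exact this hy
    obtain ⟨i, hi⟩ := Function.ne_iff.1 hy'
    refine ⟨fun j =>
        if h : j < n + 1 then Fin.cons (α := fun _ => ZMod 2) (b i) (A i) ⟨j, h⟩ else 0,
      fun j hj => dif_neg (not_lt.2 hj), fun x hx => ?_, ?_⟩
    · have hx' : A.mulVec x = b := by
        have : x ∈ supp f := hx
        rwa [hA] at this
      rw [hpair, ← hx']
      exact CharTwo.add_self_eq_zero _
    · rw [hpair]
      intro h
      exact hi (CharTwo.add_eq_zero.1 h).symm
  · refine ⟨fun j => if h : j < n + 1 then Fin.cons (α := fun _ => ZMod 2) 1 0 ⟨j, h⟩ else 0,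
      fun j hj => dif_neg (not_lt.2 hj), fun x hx => absurd ⟨x, hx⟩ hne, ?_⟩
    rw [hpair]; simp

/-- The affine forms found for a vertex define the support of its function. -/
theorem annih_spec {m : ℕ} {w : Vertex m} {M : List CycInt} {θ : ℂ} (hM : Describes M θ)
    (hw : w.WellFormed M.length) (hf : w.fn θ ∈ localAffine w.edges.length)
    (y : Cube w.edges.length) :
    (∀ a ∈ annih (vtxOf w), dot a (true :: (List.ofFn y).map fun b => decide (b = 1)) = false) ↔
      w.fn θ y ≠ 0 := by
  have hdot : ∀ a (x : List Bool), dot a (true :: x) = false ↔ pairing x (vec a) = 0 := by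
    intro a x
    rw [← bz_dot_true]
    cases dot a (true :: x) <;> simp
  have hsupp : ∀ x : Cube w.edges.length, w.fn θ x ≠ 0 →
      ((List.ofFn x).map fun b => decide (b = 1)) ∈
        ((vtxOf w).2.filter rowNonzero).map Prod.fst := by
    intro x hx
    rw [Vertex.fn] at hx
    cases h : w.table.lookup (List.ofFn x) with
    | none => simp [h] at hx
    | some q =>
      have h1 := mem_of_lookup h
      rw [h] at hx
      refine List.mem_map.2 ⟨rowOf (List.ofFn x, q), List.mem_filter.2
        ⟨List.mem_map_of_mem h1, ?_⟩, rfl⟩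
      exact (hM.rowNonzero_iff (hw.2 _ h1).2).2 hx
  have hrows : ∀ x' ∈ ((vtxOf w).2.filter rowNonzero).map Prod.fst,
      ∃ x : Cube w.edges.length, w.fn θ x ≠ 0 ∧ x' = (List.ofFn x).map fun b => decide (b = 1) := by
    intro x' hx'
    obtain ⟨r', hr', rfl⟩ := List.mem_map.1 hx'
    obtain ⟨hr1, hr2⟩ := List.mem_filter.1 hr'
    obtain ⟨r, hr, rfl⟩ := List.mem_map.1 hr1
    obtain ⟨hl, hwf⟩ := hw.2 r hr
    have e : List.ofFn (fun i : Fin w.edges.length => r.1.get (i.cast hl.symm)) = r.1 :=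
      List.ext_getElem (by simp [hl]) fun i h1 h2 => by simp
    refine ⟨fun i => r.1.get (i.cast hl.symm), ?_, by rw [e]; rfl⟩
    rw [Vertex.fn, e, lookup_of_mem hw.1 hr]
    exact (hM.rowNonzero_iff hwf).1 hr2
  have hP := points_annih (vtxOf w)
  constructor
  · intro h hy
    obtain ⟨a, ha1, ha2, ha3⟩ := exists_pairing hf hy
    have ha : a ∈ points ((annih (vtxOf w)).map vec) 0 := by
      rw [hP, Multiset.mem_filter]
      refine ⟨mem_points_units _ fun i hi => ha1 i (by simpa [vtxOf] using hi), fun x' hx' => ?_⟩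
      obtain ⟨x, hx, rfl⟩ := hrows x' hx'
      exact ha2 x hx
    refine ha3 (points_induction (T := fun a => pairing _ a = 0) (map_zero _) ?_ a ha)
    intro z _ b hb hz
    obtain ⟨b', hb', rfl⟩ := List.mem_map.1 hb
    rw [map_add, hz, zero_add]
    exact (hdot _ _).1 (h b' hb')
  · intro hy a ha
    rw [hdot]
    have h1 : vec a ∈ points ((annih (vtxOf w)).map vec) 0 := by
      have := add_mem_points sp_add_self (List.mem_map_of_mem (f := vec) ha)
        (mem_points_self ((annih (vtxOf w)).map vec) 0)
      rwa [zero_add] at this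
    rw [hP, Multiset.mem_filter] at h1
    exact h1.2 _ (hsupp y hy)

theorem solve_cons (E : List ℕ) (c : List ℕ × List Bool) (cs : List (List ℕ × List Bool)) :
    solve E (c :: cs) = (solve E cs).elim none fun s =>
      cut vadd s.1 (dot c.2 (true :: inputs E c.1 s.1))
        (s.2.map fun b => (b, dot c.2 (false :: inputs E c.1 b))) := rfl

/-- The solutions of a system of equations. -/
theorem solve_spec {E : List ℕ} (hE : E.Nodup) (cs : List (List ℕ × List Bool))
    (hcs : ∀ c ∈ cs, ∀ e ∈ c.1, e ∈ E) :
    (points ((units E).map vec) 0).filter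
        (fun y => ∀ c ∈ cs, dot c.2 (true :: coords E c.1 y) = false) =
      (solve E cs).elim 0 fun s => points (s.2.map vec) (vec s.1) := by
  induction cs with
  | nil => simp [solve]
  | cons c cs ih =>
    have ih := ih fun c' hc' => hcs c' (List.mem_cons_of_mem _ hc')
    have h1 : ∀ y, (∀ c' ∈ c :: cs, dot c'.2 (true :: coords E c'.1 y) = false) ↔
        dot c.2 (true :: coords E c.1 y) = false ∧
          ∀ c' ∈ cs, dot c'.2 (true :: coords E c'.1 y) = false := fun y => List.forall_mem_cons
    simp only [h1]
    rw [← Multiset.filter_filter, ih, solve_cons]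
    cases solve E cs with
    | none => simp
    | some s =>
      simp only [Option.elim_some]
      have h2 := cut_spec sp_add_self
        ((s.2.map fun b => (b, dot c.2 (false :: inputs E c.1 b))).map fun b => (vec b.1, b.2))
        (vec s.1) (fun y => dot c.2 (true :: coords E c.1 y)) (fun y _ b hb => by
          rw [List.map_map] at hb
          obtain ⟨b, _, rfl⟩ := List.mem_map.1 hb
          apply bz_injective
          simp only [Function.comp]
          rw [inputs_eq_coords hE (hcs c List.mem_cons_self), bz_xor, bz_dot _ _ _ le_rfl,
            bz_dot _ _ _ le_rfl, bz_dot _ _ _ le_rfl, ← Finset.sum_add_distrib]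
          refine Finset.sum_congr rfl fun i _ => ?_
          rw [← mul_add]
          congr 1
          cases i with
          | zero => simp
          | succ i => simp [vec_coords_add])
      have h3 := cut_map vec vec_vadd s.1 (dot c.2 (true :: coords E c.1 (vec s.1)))
        (s.2.map fun b => (b, dot c.2 (false :: inputs E c.1 b)))
      rw [h3] at h2
      have h4 : ((s.2.map fun b => (b, dot c.2 (false :: inputs E c.1 b))).map
          fun b => (vec b.1, b.2)).map Prod.fst = s.2.map vec := by
        rw [List.map_map, List.map_map]; rfl
      rw [h4, ← inputs_eq_coords hE (hcs c List.mem_cons_self)] at h2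
      rw [h2]
      cases cut vadd s.1 _ _ <;> rfl

/-! ### The main loop -/

/-- The pair of functions for a vector in the main loop. -/
def vec2 (v : Vec) : Sp × Sp := (vec v.1, vec v.2)

theorem vec2_vadd2 (u v : Vec) : vec2 (vadd2 u v) = vec2 u + vec2 v := by
  rw [vec2, vadd2, vec_vadd, vec_vadd]; rfl

/-- A sequence with one more entry in front. -/
def scons (t : ZMod 2) (x : Sp) : Sp := fun i => Nat.casesOn i t x

theorem vec_cons (b : Bool) (v : List Bool) : vec (b :: v) = scons (bz b) (vec v) := by
  funext i; cases i <;> rfl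

/-- The value of the product of weights at the auxiliary coordinates. -/
def weightVal : List (List ℕ) → Sp → ℂ
  | [], _ => 1
  | a :: w, x => (if x 0 = 0 then 1 else aval a) * weightVal w fun i => x (i + 1)

theorem aval_weight (w : List (List ℕ)) (ext : List Bool) :
    aval (weight w ext) = weightVal w (vec ext) := by
  rw [weight, aval_nprod, List.map_map]
  induction w generalizing ext with
  | nil =>
    refine (List.prod_eq_one fun z hz => ?_)
    obtain ⟨p, hp, rfl⟩ := List.mem_map.1 hz
    have h1 : p.1 = [1] := by
      rcases (mem_zipD hp).1 with h | h
      · simp at h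
      · exact h
    obtain ⟨p1, p2⟩ := p
    dsimp only at h1
    subst h1
    cases p2 <;> simp [aval_singleton]
  | cons a w ih =>
    cases ext with
    | nil =>
      have := ih []
      rw [zipD, List.map_cons, List.prod_cons, weightVal] at *
      simp only [vec_nil, Pi.zero_apply, if_true, Function.comp, cond_false, aval_singleton,
        Nat.cast_one, one_mul] at *
      exact this
    | cons b ext =>
      rw [zipD, List.map_cons, List.prod_cons, ih ext, weightVal]
      congr 1
      cases b <;> simp [aval_singleton]

/-- The function that is summed up in the main loop, given the product `G` of the functions at the
vertices. -/
def loopFun (G : Sp → ℂ) (w : List (List ℕ)) (z : Sp × Sp) : ℂ := weightVal w z.1 * G z.2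

theorem aval_ipow_pow_four (k : ℕ) : aval (ipow k) ^ 4 = 1 := by
  by_cases hk : k < 4
  · rw [aval_ipow hk, ← pow_mul, mul_comm, pow_mul, I_pow_four, one_pow]
  · have : ipow k = ipow 3 := by
      unfold ipow
      rw [if_neg (by omega), if_neg (by omega), if_neg (by omega)]
      rfl
    rw [this, aval_ipow (by norm_num), ← pow_mul, mul_comm, pow_mul, I_pow_four, one_pow]

theorem quad_weightVal {w : List (List ℕ)} (hw : ∀ a ∈ w, ∃ k, a = ipow k) :
    Quad (weightVal w) .univ := by
  induction w with
  | nil => exact Quad.const one_ne_zero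
  | cons a w ih =>
    obtain ⟨k, rfl⟩ := hw a List.mem_cons_self
    have h1 := ((quad_bit (aval_ipow_pow_four k)).comp
      (Pi.evalAddMonoidHom (fun _ : ℕ => ZMod 2) 0)).mono (A' := .univ) fun _ _ => trivial
    have h2 := ((ih fun a ha => hw a (List.mem_cons_of_mem _ ha)).comp
      (AddMonoidHom.mk' (fun (x : Sp) i => x (i + 1)) fun _ _ => rfl)).mono (A' := .univ)
      fun _ _ => trivial
    exact h1.mul h2

theorem quad_loopFun {G : Sp → ℂ} {A : Set Sp} (hG : Quad G A) {w : List (List ℕ)}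
    (hw : ∀ a ∈ w, ∃ k, a = ipow k) : Quad (loopFun G w) {z | z.2 ∈ A} :=
  (((quad_weightVal hw).comp (AddMonoidHom.fst Sp Sp)).mono fun _ _ => trivial).mul
    (hG.comp (AddMonoidHom.snd Sp Sp))

theorem sum_map_filter {W : Type} (P : Multiset W) (φ : W → Bool) (f : W → ℂ) :
    ((P.filter fun y => φ y = false).map f).sum = (P.map fun y => bif φ y then 0 else f y).sum := by
  induction P using Multiset.induction_on with
  | empty => simp
  | cons a P ih => cases h : φ a <;> simp [h, ih]

/-- Along a direction `b`, the phase of a function with quadratic phase is constant up to signs,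
and the signs are given by an affine form. -/
theorem Quad.tags_spec {W : Type} [AddCommGroup W] {h : W → ℂ} {A : Set W} (hh : Quad h A)
    {b p : W} {B : List W} (hB : ∀ y ∈ points (b :: B) p, y ∈ A) (h2 : ∀ x : W, x + x = 0) {c : ℂ}
    (hc : h (p + b) = c * h p) :
    (∀ y ∈ points B p, h (y + b) = (if h (y + b) = c * h y then 1 else -1) * c * h y) ∧
      ∀ y ∈ points B p, ∀ b' ∈ B, (!decide (h (y + b' + b) = c * h (y + b'))) =
        (!decide (h (y + b) = c * h y) ^^ !decide (h (p + b' + b) = c * h (p + b'))) := by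
  rw [points_cons] at hB
  have hA : ∀ y ∈ points B p, y ∈ A ∧ y + b ∈ A := fun y hy =>
    ⟨hB y (Multiset.mem_add.2 (.inl hy)),
      hB _ (Multiset.mem_add.2 (.inr (Multiset.mem_map_of_mem _ hy)))⟩
  have hp := mem_points_self B p
  have hc0 : c ≠ 0 := by
    rintro rfl
    rw [zero_mul] at hc
    exact hh.1 _ (hA p hp).2 hc
  have hs : ∀ b' ∈ B, ∃ s : ℂ, (s = 1 ∨ s = -1) ∧ ∀ y ∈ points B p, ∀ d : ℂ,
      h (y + b) = d * h y → h (y + b' + b) = s * d * h (y + b') := by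
    intro b' hb'
    obtain ⟨s, hs, e⟩ := hh.2 b b'
    refine ⟨s, hs, fun y hy d hd => ?_⟩
    have hy' := add_mem_points h2 hb' hy
    have h3 := (hA _ hy').2
    rw [add_right_comm] at h3 ⊢
    have := e y (hA y hy).1 (hA y hy).2 (hA _ hy').1 h3
    rw [hd] at this
    have h0 := hh.1 y (hA y hy).1
    refine mul_right_cancel₀ h0 ?_
    rw [this]; ring
  have hpm : ∀ y ∈ points B p, h (y + b) = c * h y ∨ h (y + b) = -c * h y := by
    refine points_induction (.inl hc) fun y hy b' hb' hy' => ?_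
    obtain ⟨s, hs, e⟩ := hs b' hb'
    rcases hy' with hy' | hy' <;> rcases hs with rfl | rfl
    · exact .inl (by rw [e y hy _ hy']; ring)
    · exact .inr (by rw [e y hy _ hy']; ring)
    · exact .inr (by rw [e y hy _ hy']; ring)
    · exact .inl (by rw [e y hy _ hy']; ring)
  have hne : ∀ y ∈ points B p, ¬ (-c * h y = c * h y) := fun y hy e => by
    have h0 := hh.1 y (hA y hy).1
    have h3 : c * h y = 0 := by linear_combination (-1 / 2 : ℂ) * e
    exact mul_ne_zero hc0 h0 h3
  constructor
  · intro y hy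
    rcases hpm y hy with e | e
    · rw [if_pos e, one_mul, e]
    · rw [if_neg (by rw [e]; exact hne y hy), e]; ring
  · intro y hy b' hb'
    obtain ⟨s, hs, e⟩ := hs b' hb'
    have hy' := add_mem_points h2 hb' hy
    have hp' := add_mem_points h2 hb' hp
    have e1 := e p hp _ hc
    rcases hpm y hy with e2 | e2 <;> have e3 := e y hy _ e2 <;> rcases hs with rfl | rfl
    · rw [one_mul] at e1 e3
      simp [e1, e2, e3]
    · rw [neg_one_mul] at e1 e3
      simp [e1, e2, e3, hne _ hy', hne _ hp', -neg_mul]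
    · rw [one_mul] at e1 e3
      simp [e1, e2, e3, hne _ hy', hne _ hy, -neg_mul]
    · have e4 : -1 * -c * h (y + b') = c * h (y + b') := by ring
      rw [e4] at e3
      rw [neg_one_mul] at e1
      simp [e1, e2, e3, hne _ hy, hne _ hp', -neg_mul]

/-- What the main loop is about: the product `G` of the functions at the vertices, with its
representation by numbers. -/
structure Ctx.Represents (c : Ctx) (θ : ℂ) (m : List CycInt) (G : Sp → ℂ) : Prop where
  describes : Describes m θ
  modulus : c.1 = negModulus (m.map cycOf)
  eval : ∀ v, qval θ (evalNum c.2.1 c.2.2 v) = G (vec v)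
  den : ∀ v, (evalNum c.2.1 c.2.2 v).2 ≠ 0

section
variable {c : Ctx} {θ : ℂ} {m : List CycInt} {G : Sp → ℂ}

theorem Ctx.Represents.qval_hval (hc : c.Represents θ m G) (w : List (List ℕ)) (y : Vec) :
    qval θ (hval c w y) = loopFun G w (vec2 y) := by
  rw [hval, qval, (isVal_nval θ).map_mul, nval_singleton, aval_weight, loopFun, vec2, ← hc.eval,
    qval, mul_div_assoc]

theorem Ctx.Represents.hval_den (hc : c.Represents θ m G) (w : List (List ℕ)) (y : Vec) :
    (hval c w y).2 ≠ 0 := hc.den _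

theorem I_pow_inj {j k : ℕ} (hj : j < 4) (hk : k < 4) (h : I ^ j = I ^ k) : j = k := by
  interval_cases j <;> interval_cases k <;> simp [I_pow_three, Complex.ext_iff] at h ⊢ <;>
    norm_num at h

theorem Ctx.Represents.phaseAt_spec (hc : c.Represents θ m G) {A : Set Sp} (hG : Quad G A)
    {w : List (List ℕ)} (hw : ∀ a ∈ w, ∃ k, a = ipow k) {b y : Vec} (hy : (vec2 y).2 ∈ A)
    (hb : (vec2 y + vec2 b).2 ∈ A) : phaseAt c w b y < 4 ∧ ∀ k < 4,
      (phaseAt c w b y = k ↔ loopFun G w (vec2 y + vec2 b) = I ^ k * loopFun G w (vec2 y)) := by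
  have hQ := quad_loopFun hG hw
  obtain ⟨k, hk, e⟩ := hQ.exists_phase sp2_add_self (y := vec2 y) (b := vec2 b) hy hb
  rw [← vec2_vadd2, ← hc.qval_hval, ← hc.qval_hval] at e
  have h1 := hc.describes.phase_spec hk (hc.hval_den w _) (hc.hval_den w _) e
  rw [← hc.modulus, hc.qval_hval, hc.qval_hval, vec2_vadd2, ← phaseAt] at h1
  refine ⟨h1.1, fun k hk => ⟨fun h => h ▸ h1.2, fun h => ?_⟩⟩
  rw [h1.2] at h
  exact I_pow_inj h1.1 hk (mul_right_cancel₀ (hQ.1 _ hy) h)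

/-- The invariant of the main loop: the sum that is left, times the factor, is `S`. -/
structure LoopInv (G : Sp → ℂ) (A : Set Sp) (S : ℂ) (s : LState) : Prop where
  weights : ∀ a ∈ s.2.1, ∃ k, a = ipow k
  support : ∀ z ∈ points (s.2.2.2.map vec2) (vec2 s.2.2.1), z.2 ∈ A
  sum : S = aval s.1 * ((points (s.2.2.2.map vec2) (vec2 s.2.2.1)).map (loopFun G s.2.1)).sum

theorem LoopInv.loopStep (hc : c.Represents θ m G) {A : Set Sp} (hG : Quad G A) {S : ℂ} {s : LState}
    (h : LoopInv G A S s) : LoopInv G A S (loopStep c s) := by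
  obtain ⟨fac, w, p, _ | ⟨b, B⟩⟩ := s
  · exact h
  obtain ⟨hw, hA, hS⟩ := h
  dsimp only at hw hA hS
  rw [List.map_cons] at hA hS
  have hQ := quad_loopFun hG hw
  have hA' : ∀ y ∈ points (B.map vec2) (vec2 p), y.2 ∈ A ∧ (y + vec2 b).2 ∈ A := fun y hy => by
    rw [points_cons] at hA
    exact ⟨hA y (Multiset.mem_add.2 (.inl hy)),
      hA _ (Multiset.mem_add.2 (.inr (Multiset.mem_map_of_mem _ hy)))⟩
  have hp := hA' _ (mem_points_self _ _)
  obtain ⟨hk4, hk⟩ := hc.phaseAt_spec hG hw hp.1 hp.2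
  have hkp := (hk _ hk4).1 rfl
  obtain ⟨ht1, ht2⟩ := hQ.tags_spec hA sp2_add_self hkp
  have htags : tags c w p b B = B.map fun b' =>
      (b', !decide (loopFun G w (vec2 p + vec2 b' + vec2 b) =
      I ^ phaseAt c w b p * loopFun G w (vec2 p + vec2 b'))) := by
    refine List.map_congr_left fun b' hb' => ?_
    have h1 := hA' _ (add_mem_points sp2_add_self (List.mem_map_of_mem hb') (mem_points_self _ _))
    rw [← vec2_vadd2] at h1
    have h2 := (hc.phaseAt_spec hG hw h1.1 h1.2).2 _ hk4
    rw [vec2_vadd2] at h2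
    simp only [h2]
  have hsum : S = aval fac * ((points (B.map vec2) (vec2 p)).map fun z =>
      (1 + (if loopFun G w (z + vec2 b) = I ^ phaseAt c w b p * loopFun G w z then 1 else -1) *
        I ^ phaseAt c w b p) * loopFun G w z).sum := by
    rw [hS, points_cons, Multiset.map_add, Multiset.sum_add, Multiset.map_map,
      ← Multiset.sum_map_add]
    congr 2
    refine Multiset.map_congr rfl fun z hz => ?_
    have h1 := ht1 z hz
    rw [Function.comp]
    linear_combination h1
  rw [Holant.loopStep]
  dsimp only
  rw [htags]
  generalize phaseAt c w b p = k at *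
  cases hodd : decide (k = 1) || decide (k = 3)
  · -- an even power of `i`: the factor `1 ± i ^ k` is `2` on an affine subspace, and `0` elsewhere
    rw [cond_false]
    have hk02 : k = 0 ∨ k = 2 := by
      simp only [Bool.or_eq_false_iff, decide_eq_false_iff_not] at hodd
      omega
    set φ : Sp × Sp → Bool := fun z =>
      (!decide (loopFun G w (z + vec2 b) = I ^ k * loopFun G w z)) ^^ decide (k = 2) with hφ
    have hφp : φ (vec2 p) = decide (k = 2) := by simp [hφ, hkp]
    have h1 := cut_spec sp2_add_self ((B.map fun b' => (b', !decide (loopFun G w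
      (vec2 p + vec2 b' + vec2 b) = I ^ k * loopFun G w (vec2 p + vec2 b')))).map
        fun t => (vec2 t.1, t.2)) (vec2 p) φ (by
      intro y hy t ht
      rw [List.map_map] at hy ht
      rw [List.map_map] at hy
      obtain ⟨b', hb', rfl⟩ := List.mem_map.1 ht
      have := ht2 y hy _ (List.mem_map_of_mem hb')
      simp only [hφ, Function.comp]
      rw [this, Bool.xor_right_comm])
    rw [cut_map vec2 vec2_vadd2, hφp, List.map_map, List.map_map] at h1
    have h2 : S = aval fac * 2 *
        (((points (B.map vec2) (vec2 p)).filter fun z => φ z = false).map (loopFun G w)).sum := by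
      rw [hsum, sum_map_filter, mul_assoc]
      refine congrArg _ (Eq.trans ?_ Multiset.sum_map_mul_left)
      refine congrArg _ (Multiset.map_congr rfl fun z _ => ?_)
      simp only [hφ]
      by_cases h3 : loopFun G w (z + vec2 b) = I ^ k * loopFun G w z
      · rcases hk02 with rfl | rfl
        · rw [if_pos h3, decide_eq_true h3]; simp [one_add_one_eq_two]
        · rw [if_pos h3, decide_eq_true h3]; simp
      · rcases hk02 with rfl | rfl
        · rw [if_neg h3, decide_eq_false h3]; simp
        · rw [if_neg h3, decide_eq_false h3]; simp [one_add_one_eq_two]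
    have h3 : B.map ((Prod.fst ∘ fun t : Vec × Bool => (vec2 t.1, t.2)) ∘ fun b' => (b', !decide
        (loopFun G w (vec2 p + vec2 b' + vec2 b) = I ^ k * loopFun G w (vec2 p + vec2 b')))) =
        B.map vec2 := rfl
    rw [h3] at h1
    rw [h1] at h2
    cases e : cut vadd2 p (decide (k = 2)) (B.map fun b' => (b', !decide
        (loopFun G w (vec2 p + vec2 b' + vec2 b) = I ^ k * loopFun G w (vec2 p + vec2 b')))) with
    | none =>
      rw [e] at h2
      refine ⟨hw, ?_, ?_⟩
      · intro z hz
        obtain rfl : z = vec2 p := by simpa [points] using hz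
        exact hp.1
      · rw [h2]; simp [aval_nil]
    | some t =>
      rw [e] at h1 h2
      refine ⟨hw, fun z hz => ?_, ?_⟩
      · have h4 : z ∈ (points (B.map vec2) (vec2 p)).filter fun z => φ z = false := by
          rw [h1]; exact hz
        exact (hA' z (Multiset.mem_filter.1 h4).1).1
      · rw [h2]
        dsimp only [Option.elim_some]
        rw [isVal_aval.map_mul, aval_singleton]
        rfl
  · -- an odd power of `i`: as `1 - i ^ k = i ^ (4 - k) * (1 + i ^ k)`, the factor `1 ± i ^ k` is
    -- constant up to a weight on the sign, which becomes an auxiliary coordinate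
    rw [cond_true]
    have hk13 : k = 1 ∨ k = 3 := by simpa using hodd
    set τ : Sp × Sp → Bool := fun z =>
      !decide (loopFun G w (z + vec2 b) = I ^ k * loopFun G w z) with hτ
    set l : List ((Sp × Sp) × (Sp × Sp)) := B.map fun b' => (vec2 b', vec2 (tagged b'
      (!decide (loopFun G w (vec2 p + vec2 b' + vec2 b) = I ^ k * loopFun G w (vec2 p + vec2 b')))))
      with hl
    have hl1 : l.map Prod.fst = B.map vec2 := by rw [hl, List.map_map]; rfl
    have htag : ∀ (v : Vec) (t : Bool), vec2 (tagged v t) = (scons (bz t) (vec2 v).1, (vec2 v).2) :=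
      fun v t => by rw [tagged, vec2, vec_cons]; rfl
    have hpts := points_map (fun z : Sp × Sp => (scons (bz (τ z)) z.1, z.2)) l (vec2 p) (by
      intro y hy t ht
      rw [hl1] at hy
      obtain ⟨b', hb', rfl⟩ := List.mem_map.1 ht
      have := ht2 y hy _ (List.mem_map_of_mem hb')
      dsimp only
      rw [htag]
      simp only [hτ]
      rw [this, bz_xor]
      ext i
      · cases i <;> rfl
      · rfl)
    have hbase : (scons (bz (τ (vec2 p))) (vec2 p).1, (vec2 p).2) = vec2 (tagged p false) := by
      rw [htag]; simp [hτ, hkp]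
    have hl2 : l.map Prod.snd = ((B.map fun b' => (b', !decide (loopFun G w
        (vec2 p + vec2 b' + vec2 b) = I ^ k * loopFun G w (vec2 p + vec2 b')))).map
        fun t => tagged t.1 t.2).map vec2 := by
      rw [hl, List.map_map, List.map_map, List.map_map]; rfl
    rw [hbase, hl1, hl2] at hpts
    refine ⟨?_, fun z hz => ?_, ?_⟩
    · intro a ha
      rcases List.mem_cons.1 ha with rfl | ha
      · exact ⟨_, rfl⟩
      · exact hw a ha
    · dsimp only at hz
      rw [hpts] at hz
      obtain ⟨y, hy, rfl⟩ := Multiset.mem_map.1 hz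
      exact (hA' y hy).1
    · dsimp only
      rw [hpts, hsum, isVal_aval.map_mul, isVal_aval.map_add, aval_singleton, aval_ipow hk4,
        Multiset.map_map, mul_assoc]
      refine congrArg _ (Eq.trans (congrArg _ (Multiset.map_congr rfl fun z _ => ?_))
        Multiset.sum_map_mul_left)
      have h3 : loopFun G (ipow (4 - k) :: w) (scons (bz (τ z)) z.1, z.2) =
          (if bz (τ z) = 0 then 1 else aval (ipow (4 - k))) * loopFun G w z := by
        rw [loopFun, weightVal, mul_assoc]; rfl
      rw [Function.comp, h3, aval_ipow (by omega)]
      simp only [hτ]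
      by_cases h4 : loopFun G w (z + vec2 b) = I ^ k * loopFun G w z
      · rw [if_pos h4, decide_eq_true h4]; simp
      · rw [if_neg h4, decide_eq_false h4]
        rcases hk13 with rfl | rfl <;> simp [I_pow_three] <;>
          linear_combination (loopFun G w z) * I_mul_I

theorem length_loopStep_le (c : Ctx) (s : LState) :
    (loopStep c s).2.2.2.length ≤ s.2.2.2.length - 1 := by
  obtain ⟨fac, w, p, _ | ⟨b, B⟩⟩ := s
  · exact le_rfl
  · rw [loopStep]
    dsimp only
    cases decide (phaseAt c w b p = 1) || decide (phaseAt c w b p = 3)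
    · rw [cond_false]
      cases e : cut vadd2 p (decide (phaseAt c w b p = 2)) (tags c w p b B) with
      | none => simp
      | some t =>
        have := (cut_forall (P := fun _ => True) (fun _ _ _ _ => trivial) trivial
          (fun _ _ => trivial) e).2.2
        simpa [tags] using this
    · simp [tags]

/-- The main loop computes the sum over an affine space that is contained in the support. -/
theorem gauss_spec (hc : c.Represents θ m G) {A : Set Sp} (hG : Quad G A)
    (s : List Bool × List (List Bool)) (hs : ∀ y ∈ points (s.2.map vec) (vec s.1), y ∈ A) :
    ((points (s.2.map vec) (vec s.1)).map G).sum =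
      aval (gauss c s).1 * qval θ (hval c (gauss c s).2.1 (gauss c s).2.2.1) := by
  have h0 : LoopInv G A ((points (s.2.map vec) (vec s.1)).map G).sum
      ([1], [], ([], s.1), s.2.map fun b => ([], b)) := by
    have h1 := points_map (fun y : Sp => ((0 : Sp), y)) (s.2.map fun b => (vec b, vec2 ([], b)))
      (vec s.1) (by
        intro y _ b hb
        obtain ⟨b', _, rfl⟩ := List.mem_map.1 hb
        simp [vec2])
    rw [List.map_map, List.map_map] at h1
    have h2 : points ((s.2.map fun b => (([], b) : Vec)).map vec2) (vec2 ([], s.1)) =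
        (points (s.2.map vec) (vec s.1)).map fun y : Sp => ((0 : Sp), y) := by
      rw [List.map_map, vec2, vec_nil]
      exact h1
    refine ⟨by simp, fun z hz => ?_, ?_⟩
    · dsimp only at hz
      rw [h2] at hz
      obtain ⟨y, hy, rfl⟩ := Multiset.mem_map.1 hz
      exact hs y hy
    · dsimp only
      rw [h2, Multiset.map_map, aval_singleton, Nat.cast_one, one_mul]
      congr 1
      refine Multiset.map_congr rfl fun y _ => ?_
      simp [loopFun, weightVal]
  have key : ∀ (l : List (List Bool)) (t : LState),
      LoopInv G A ((points (s.2.map vec) (vec s.1)).map G).sum t → t.2.2.2.length ≤ l.length →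
      LoopInv G A ((points (s.2.map vec) (vec s.1)).map G).sum
          (l.foldl (fun t _ => Holant.loopStep c t) t) ∧
        (l.foldl (fun t _ => Holant.loopStep c t) t).2.2.2 = [] := by
    intro l
    induction l with
    | nil => exact fun t ht hl => ⟨ht, List.length_eq_zero_iff.1 (Nat.le_zero.1 hl)⟩
    | cons a l ih =>
      intro t ht hl
      refine ih _ (ht.loopStep hc hG) ?_
      have := length_loopStep_le c t
      rw [List.length_cons] at hl
      dsimp only
      omega
  obtain ⟨h1, h2⟩ := key s.2 _ h0 (by simp)
  have h3 := h1.sum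
  rw [← gauss] at h2 h3
  rw [h2] at h3
  rw [h3, hc.qval_hval]
  simp [points]

end

/-! ### Correctness of the algorithm -/

section
variable {Ω : Grid} {θ : ℂ}

theorem mem_labels_dataOf (h : Ω.IsInstance localAffine θ) (e : ℕ) :
    e ∈ labels (Ω.vertices.map vtxOf) ↔ e < Ω.numEdges := by
  rw [mem_labels, List.flatMap_map, List.mem_flatMap]
  constructor
  · rintro ⟨v, _, he⟩
    obtain ⟨e', _, rfl⟩ := List.mem_map.1 he
    exact e'.isLt
  · intro he
    have h1 : (⟨e, he⟩ : Fin Ω.numEdges) ∈ Ω.vertices.flatMap Vertex.edges := by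
      refine List.count_pos_iff.1 ?_
      rw [h.2.1]; norm_num
    obtain ⟨v, hv, hev⟩ := List.mem_flatMap.1 h1
    exact ⟨v, hv, List.mem_map.2 ⟨_, hev, rfl⟩⟩

/-- The Holant value as a sum over vectors. -/
theorem holant_eq_sum (h : Ω.IsInstance localAffine θ) : Ω.holant θ =
    ((points ((units (labels (Ω.vertices.map vtxOf))).map vec) 0).map fun y =>
      Ω.weight θ (assign (labels (Ω.vertices.map vtxOf)) Ω.numEdges y)).sum := by
  rw [points_units]
  generalize hE : labels (Ω.vertices.map vtxOf) = E
  have hmem : ∀ e, e ∈ E ↔ e < Ω.numEdges := fun e => by rw [← hE, mem_labels_dataOf h]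
  have hnd : E.Nodup := hE ▸ nodup_labels _
  let ε : Fin Ω.numEdges → Fin E.length := fun e =>
    ⟨E.idxOf (e : ℕ), List.idxOf_lt_length_iff.2 ((hmem e).2 e.isLt)⟩
  have hε : Function.Bijective ε := by
    constructor
    · intro e e' he
      have h1 : E.idxOf (e : ℕ) = E.idxOf (e' : ℕ) := congrArg Fin.val he
      exact Fin.ext ((List.idxOf_inj ((hmem e).2 e.isLt)).1 h1)
    · intro i
      refine ⟨⟨E[i], (hmem _).1 (List.getElem_mem _)⟩, Fin.ext ?_⟩
      exact hnd.idxOf_getElem i i.isLt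
  have h1 := Equiv.sum_comp ((Equiv.ofBijective ε hε).symm.arrowCongr (Equiv.refl (ZMod 2)))
    (Ω.weight θ)
  refine h1.symm.trans (Finset.sum_congr rfl fun x _ => congrArg _ ?_)
  funext e
  change x (ε e) = if h : E.idxOf (e : ℕ) < E.length then x ⟨E.idxOf (e : ℕ), h⟩ else 0
  rw [dif_pos (ε e).isLt]

/-- The equations describe the support of the product of the functions. -/
theorem constraints_spec (h : Ω.IsInstance localAffine θ) (E : List ℕ) (y : Sp) :
    (∀ c ∈ constraints (Ω.vertices.map vtxOf), dot c.2 (true :: coords E c.1 y) = false) ↔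
      Ω.weight θ (assign E Ω.numEdges y) ≠ 0 := by
  rw [Grid.weight, ne_eq, List.prod_eq_zero_iff, constraints]
  simp only [List.mem_flatMap, List.mem_map, not_exists, not_and]
  constructor
  · rintro h1 v hv
    refine (annih_spec h.1 (h.2.2 v hv).1 (h.2.2 v hv).2 _).1 fun a ha => ?_
    have := h1 ((vtxOf v).1, a) ⟨_, ⟨v, hv, rfl⟩, a, ha, rfl⟩
    rwa [coords_vtxOf] at this
  · rintro h1 _ ⟨_, ⟨v, hv, rfl⟩, a, ha, rfl⟩
    rw [coords_vtxOf]
    exact (annih_spec h.1 (h.2.2 v hv).1 (h.2.2 v hv).2 _).2 (h1 v hv) a ha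

theorem answer_of_none {d : Data} (h : solve (labels d.2) (constraints d.2) = none) :
    answer d = (nf (negModulus d.1) [], 1) := by
  rw [answer, h]; rfl

theorem answer_of_some {d : Data} {s : List Bool × List (List Bool)} {c : Ctx}
    (hc : c = (negModulus d.1, labels d.2, d.2))
    (h : solve (labels d.2) (constraints d.2) = some s) :
    answer d = (nf (negModulus d.1) (NAr.mul [(gauss c s).1]
      (hval c (gauss c s).2.1 (gauss c s).2.2.1).1),
      (hval c (gauss c s).2.1 (gauss c s).2.2.1).2) := by
  subst hc
  rw [answer, h]; rfl

/-- The algorithm computes the Holant value. -/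
theorem answer_spec (h : Ω.IsInstance localAffine θ) :
    (algNumOf (answer (dataOf Ω))).WellFormed Ω.modulus.length ∧
      (algNumOf (answer (dataOf Ω))).value θ = Ω.holant θ := by
  have hnd := nodup_labels (Ω.vertices.map vtxOf)
  have hmem := mem_labels_dataOf h
  have hH := holant_eq_sum h
  have hes : ∀ w ∈ Ω.vertices, ∀ e ∈ w.edges, (e : ℕ) ∈ labels (Ω.vertices.map vtxOf) :=
    fun w _ e _ => (hmem e).2 e.isLt
  have hsolve := solve_spec hnd (constraints (Ω.vertices.map vtxOf)) (by
    intro c hc e he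
    obtain ⟨w', hw', hc⟩ := List.mem_flatMap.1 hc
    obtain ⟨a, _, rfl⟩ := List.mem_map.1 hc
    obtain ⟨w, hw, rfl⟩ := List.mem_map.1 hw'
    obtain ⟨e', he', rfl⟩ := List.mem_map.1 he
    exact hes w hw e' he')
  have hc : Ctx.Represents (negModulus (Ω.modulus.map cycOf), labels (Ω.vertices.map vtxOf),
      Ω.vertices.map vtxOf) θ Ω.modulus
      fun y => Ω.weight θ (assign (labels (Ω.vertices.map vtxOf)) Ω.numEdges y) :=
    ⟨h.1, rfl, fun v => (evalNum_spec hnd (fun w hw => (h.2.2 w hw).1) hes v).1,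
      fun v => (evalNum_spec (θ := θ) hnd (fun w hw => (h.2.2 w hw).1) hes v).2⟩
  have hnone := answer_of_none (d := dataOf Ω)
  have hsome := fun s => answer_of_some (d := dataOf Ω) (s := s) rfl
  rw [dataOf] at hnone hsome ⊢
  dsimp only at hnone hsome
  generalize labels (Ω.vertices.map vtxOf) = E at *
  have hG : Quad (fun y => Ω.weight θ (assign E Ω.numEdges y))
      {y | Ω.weight θ (assign E Ω.numEdges y) ≠ 0} := (quad_weight h).comp (assign E Ω.numEdges)
  have hfilter : ∀ y, (∀ c ∈ constraints (Ω.vertices.map vtxOf),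
      dot c.2 (true :: coords E c.1 y) = false) ↔ Ω.weight θ (assign E Ω.numEdges y) ≠ 0 :=
    constraints_spec h E
  simp only [hfilter] at hsolve
  have hsum : Ω.holant θ = (((points ((units E).map vec) 0).filter fun y =>
      Ω.weight θ (assign E Ω.numEdges y) ≠ 0).map
        fun y => Ω.weight θ (assign E Ω.numEdges y)).sum := by
    rw [hH]
    induction points ((units E).map vec) 0 using Multiset.induction_on with
    | empty => simp
    | cons a P ih =>
      by_cases h0 : Ω.weight θ (assign E Ω.numEdges a) = 0
      · rw [Multiset.map_cons, Multiset.sum_cons, ih,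
          Multiset.filter_cons_of_neg (p := fun y => Ω.weight θ (assign E Ω.numEdges y) ≠ 0) _
            (not_not.2 h0), h0, zero_add]
      · rw [Multiset.map_cons, Multiset.sum_cons, ih,
          Multiset.filter_cons_of_pos (p := fun y => Ω.weight θ (assign E Ω.numEdges y) ≠ 0) _ h0,
          Multiset.map_cons, Multiset.sum_cons]
  rw [hsolve] at hsum
  cases hs : solve E (constraints (Ω.vertices.map vtxOf)) with
  | none =>
    rw [hs] at hsum
    rw [hnone hs, h.1.value_algNumOf]
    refine ⟨h.1.wellFormed_algNumOf _ one_pos, ?_⟩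
    rw [Option.elim_none] at hsum
    rw [hsum]
    simp [qval, nval_nil]
  | some s =>
    rw [hs] at hsum hsolve
    rw [Option.elim_some] at hsum hsolve
    rw [hsome s hs, h.1.value_algNumOf]
    have h1 := gauss_spec hc hG s fun y hy => by
      rw [← hsolve] at hy
      exact (Multiset.mem_filter.1 hy).2
    refine ⟨h.1.wellFormed_algNumOf _ (Nat.pos_of_ne_zero (hc.hval_den _ _)), ?_⟩
    rw [hsum, h1, qval, (isVal_nval θ).map_mul, nval_singleton, mul_div_assoc]
    rfl

end

end Holant
end
theorem mainTheorem4 : Holant.InPolyTime Holant.localAffine :=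
  ⟨fun Ω => Holant.algNumOf (Holant.answer (Holant.dataOf Ω.1)),
    Holant.computableInPolyTime_answer _, fun _ _ h => Holant.answer_spec h⟩
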